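/- Conventions. A graph $E=(E^0,E^1,r_E,s_E)$ is a directed graph (arbitrary sets of vertices and edges, range and source maps); it is finite if $E^0$ and $E^1$ are finite. A vertex $v$ is a sink if $s_E^{-1}(v)=\varnothing$, a source if $r_E^{-1}(v)=\varnothing$, and regular if $s_E^{-1}(v)$ is finite and nonempty. For a commutative unital ring $R$, the Leavitt path algebra $L_R(E)$ is the universal associative (not necessarily unital) $R$-algebra generated by pairwise orthogonal idempotents $\{v : v\in E^0\}$ and elements $\{e,e^*: e\in E^1\}$ subject to: $s_E(e)e=e=e\,r_E(e)$ and $r_E(e)e^*=e^*=e^*s_E(e)$; $e^*e=r_E(e)$ and $e^*f=0$ for $e\ne f$; and $v=\sum_{s_E(e)=v}ee^*$ for every regular vertex $v$. If $E$ is a finite graph with no sinks and no sources, then $L_R(E)$ is called an algebraic Cuntz–Krieger algebra. For a subset $X\subseteq E^0$, $H_E(X)$ is the smallest subset of $E^0$ that contains $X$ and contains every vertex which can be reached by a path from one of its elements. A directed forest $T=(T^0,T^1)$ in $E$ is a subgraph of $E$ without cycles such that $|T^1\cap r_E^{-1}(v)|\le 1$ for every $v\in T^0$; $T^r$ is the set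 of $v\in T^0$ with $T^1\cap r_E^{-1}(v)=\varnothing$; and $v\ge_T u$ means that there is a path in $T$ (possibly of length $0$) from $v$ to $u$. $T$ is row-finite if every vertex of $T$ emits finitely many edges of $T$, and path-finite if $T$ has no right-infinite, left-infinite or bi-infinite path whose vertices are pairwise distinct. The $T$-corner of $E$ is the graph $E(T)$ with $$E(T)^0=T^0\setminus\{v\in T^0:\varnothing\ne s_E^{-1}(v)\subseteq T^1\},$$ $$E(T)^1=\{e_u: e\in s_E^{-1}(T^0)\setminus T^1,\ u\in E(T)^0,\ r_E(e)\ge_T u\},\quad s_{E(T)}(e_u)=s_E(e),\quad r_{E(T)}(e_u)=u.$$ Theorem. Let $R$ be a commutative unital ring, let $E$ be a graph and let $X\subsetneq E^0$ be a finite set. Let $T$ be a row-finite, path-finite directed forest in $E$ with $T^r=X$ and $T^0=H_E(X)$, and put $P_X=\sum_{x\in X}x\in L_R(E)$. Then $L_R(E(T))\cong P_XL_R(E)P_X$ as $R$-algebras. If in addition $L_R(E)$ is an algebraic Cuntz–Krieger algebra, that is, if $E$ is a finite graph with no sinks and no sources, then $L_R(E(T))$ is isomorphic as an $R$-algebra to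 an algebraic Cuntz–Krieger algebra, that is, to $L_R(F)$ for some finite graph $F$ with no sinks and no sources. -/

import Mathlib

noncomputable section

/-- A directed graph `E = (E⁰, E¹, r, s)`; loops and multiple edges are allowed, and there is no
cardinality restriction. -/
structure DiGraph where
  /-- the vertices, `E⁰` -/
  V : Type*
  /-- the edges, `E¹` -/
  Edge : Type*
  /-- the source map -/
  s : Edge → V
  /-- the range map -/
  r : Edge → V

namespace DiGraph

universe u v w w'

section Graphs

variable (E : DiGraph.{u, v})

/-- The edges emitted by a vertex, `s⁻¹(x)`. -/
def outEdges (x : E.V) : Set E.Edge := {e | E.s e = x}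

/-- The edges received by a vertex, `r⁻¹(x)`. -/
def inEdges (x : E.V) : Set E.Edge := {e | E.r e = x}

/-- A regular vertex emits finitely many edges, and at least one. -/
def IsRegular (x : E.V) : Prop := (E.outEdges x).Finite ∧ (E.outEdges x).Nonempty

/-- A sink emits no edges. -/
def IsSink (x : E.V) : Prop := E.outEdges x = ∅

/-- A source receives no edges. -/
def IsSource (x : E.V) : Prop := E.inEdges x = ∅

/-- A finite graph has finitely many vertices and finitely many edges. -/
def IsFinite : Prop := Finite E.V ∧ Finite E.Edge

/-- Every vertex emits only finitely many edges. -/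
def IsRowFinite : Prop := ∀ x, (E.outEdges x).Finite

/-- `E.Geq x y` means `x ≥ y`: there is a finite path (possibly of length `0`) from `x` to `y`. -/
def Geq : E.V → E.V → Prop :=
  Relation.ReflTransGen fun x y => ∃ e, E.s e = x ∧ E.r e = y

/-- A nonempty list of edges `e₁ … eₙ` is a cycle if `r(eᵢ) = s(eᵢ₊₁)` for all `i < n`,
`r(eₙ) = s(e₁)`, and the sources `s(eᵢ)` are pairwise distinct. -/
def IsCycle (p : List E.Edge) : Prop :=
  ∃ h : p ≠ [], p.IsChain (fun e f => E.r e = E.s f) ∧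
    E.r (p.getLast h) = E.s (p.head h) ∧ (p.map E.s).Nodup

/-- A graph without cycles. -/
def IsAcyclic : Prop := ∀ p, ¬ E.IsCycle p

/-- A right-infinite path `e₀ e₁ e₂ …` whose vertices are pairwise distinct. -/
def IsRightInfiniteSimple (p : ℕ → E.Edge) : Prop :=
  (∀ i, E.r (p i) = E.s (p (i + 1))) ∧ Function.Injective fun i => E.s (p i)

/-- A left-infinite path `… e₂ e₁ e₀` whose vertices are pairwise distinct. -/
def IsLeftInfiniteSimple (p : ℕ → E.Edge) : Prop :=
  (∀ i, E.r (p (i + 1)) = E.s (p i)) ∧ Function.Injective fun i => E.r (p i)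

/-- A bi-infinite path `… e₋₁ e₀ e₁ …` whose vertices are pairwise distinct. -/
def IsBiInfiniteSimple (p : ℤ → E.Edge) : Prop :=
  (∀ i, E.r (p i) = E.s (p (i + 1))) ∧ Function.Injective fun i => E.s (p i)

/-- A path-finite graph has no (right-, left- or bi-)infinite vertex-simple path. -/
def IsPathFinite : Prop :=
  (¬ ∃ p, E.IsRightInfiniteSimple p) ∧ (¬ ∃ p, E.IsLeftInfiniteSimple p) ∧
    (¬ ∃ p, E.IsBiInfiniteSimple p)

/-- A set of vertices is hereditary if it contains every vertex that can be reached from it. -/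
def IsHereditary (H : Set E.V) : Prop := ∀ x ∈ H, ∀ y, E.Geq x y → y ∈ H

/-- `H_E(X)`, the smallest hereditary set of vertices that contains `X`. -/
def hereditaryClosure (X : Set E.V) : Set E.V :=
  ⋂₀ {H | E.IsHereditary H ∧ X ⊆ H}

/-- The graphs whose Leavitt path algebra is called an algebraic Cuntz-Krieger algebra: finite
graphs with no sinks and no sources. -/
def IsCuntzKrieger : Prop :=
  E.IsFinite ∧ (∀ x, ¬ E.IsSink x) ∧ (∀ x, ¬ E.IsSource x)

end Graphs

/-- A subgraph `T` of `E`: sets `T⁰` of vertices and `T¹` of edges such that the source and the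
range of each edge in `T¹` lie in `T⁰`. -/
structure Subgraph (E : DiGraph.{u, v}) where
  /-- the vertices, `T⁰` -/
  verts : Set E.V
  /-- the edges, `T¹` -/
  edges : Set E.Edge
  s_mem : ∀ e ∈ edges, E.s e ∈ verts
  r_mem : ∀ e ∈ edges, E.r e ∈ verts

namespace Subgraph

variable {E : DiGraph.{u, v}} (T : E.Subgraph)

/-- A subgraph, as a graph in its own right. -/
def toDiGraph : DiGraph.{u, v} where
  V := T.verts
  Edge := T.edges
  s e := ⟨E.s e, T.s_mem e e.2⟩
  r e := ⟨E.r e, T.r_mem e e.2⟩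

/-- A directed forest in `E` is an acyclic subgraph in which each vertex receives at most one edge
of the subgraph. -/
def IsDirectedForest : Prop :=
  T.toDiGraph.IsAcyclic ∧ ∀ x ∈ T.verts, (T.edges ∩ E.inEdges x).encard ≤ 1

/-- `T^r`, the vertices of `T` that receive no edge of `T`. -/
def roots : Set E.V := {x ∈ T.verts | T.edges ∩ E.inEdges x = ∅}

/-- `x ≥_T y`: there is a path in `T` from `x` to `y`. -/
def Geq (x y : E.V) : Prop :=
  ∃ (hx : x ∈ T.verts) (hy : y ∈ T.verts), T.toDiGraph.Geq ⟨x, hx⟩ ⟨y, hy⟩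

/-- `E(T)⁰ = T⁰ \ {x | ∅ ≠ s_E⁻¹(x) ⊆ T¹}`. -/
def cornerVerts : Set E.V :=
  T.verts \ {x | x ∈ T.verts ∧ (E.outEdges x).Nonempty ∧ E.outEdges x ⊆ T.edges}

/-- `E(T)¹ = {e_u | e ∈ s_E⁻¹(T⁰) \ T¹, u ∈ E(T)⁰, r_E(e) ≥_T u}`; the edge `e_u` is the pair
`(e, u)`. -/
def cornerEdges : Set (E.Edge × E.V) :=
  {p | E.s p.1 ∈ T.verts ∧ p.1 ∉ T.edges ∧ p.2 ∈ T.cornerVerts ∧ T.Geq (E.r p.1) p.2}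

/-- The `T`-corner `E(T)` of `E`, with `s(e_u) = s_E(e)` and `r(e_u) = u`. -/
def cornerGraph : DiGraph.{u, max u v} where
  V := T.cornerVerts
  Edge := T.cornerEdges
  s p := ⟨E.s p.1.1, p.2.1, fun h => p.2.2.1 (h.2.2 rfl)⟩
  r p := ⟨p.1.2, p.2.2.2.1⟩

end Subgraph

section Leavitt

/-- The generators of the Leavitt path algebra: vertices, edges and ghost edges. -/
inductive Generator (E : DiGraph.{u, v}) : Type (max u v)
  | vert (x : E.V)
  | edge (e : E.Edge)
  | ghost (e : E.Edge)

variable (R : Type w) [CommRing R] (E : DiGraph.{u, v})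

/-- The free (associative, not necessarily unital) `R`-algebra on vertices, edges and ghost
edges. -/
abbrev FreeLeavitt : Type (max u v w) := MonoidAlgebra R (FreeSemigroup E.Generator)

variable {E} in
/-- A generator, in the free algebra. -/
def gen (g : E.Generator) : FreeLeavitt R E := MonoidAlgebra.single (FreeSemigroup.of g) 1

open Generator in
/-- The defining relations of the Leavitt path algebra. -/
inductive LeavittRel : FreeLeavitt R E → FreeLeavitt R E → Prop
  | vert_idem (x : E.V) : LeavittRel (gen R (vert x) * gen R (vert x)) (gen R (vert x))
  | vert_orth (x y : E.V) (h : x ≠ y) : LeavittRel (gen R (vert x) * gen R (vert y)) 0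
  | s_edge (e : E.Edge) : LeavittRel (gen R (vert (E.s e)) * gen R (edge e)) (gen R (edge e))
  | edge_r (e : E.Edge) : LeavittRel (gen R (edge e) * gen R (vert (E.r e))) (gen R (edge e))
  | r_ghost (e : E.Edge) : LeavittRel (gen R (vert (E.r e)) * gen R (ghost e)) (gen R (ghost e))
  | ghost_s (e : E.Edge) : LeavittRel (gen R (ghost e) * gen R (vert (E.s e))) (gen R (ghost e))
  | ck1_self (e : E.Edge) : LeavittRel (gen R (ghost e) * gen R (edge e)) (gen R (vert (E.r e)))
  | ck1_ne (e f : E.Edge) (h : e ≠ f) : LeavittRel (gen R (ghost e) * gen R (edge f)) 0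
  | ck2 (x : E.V) (h : E.IsRegular x) :
      LeavittRel (gen R (vert x)) (∑ e ∈ h.1.toFinset, gen R (edge e) * gen R (ghost e))

/-- The congruence generated by all scalar multiples of the defining relations. (As the free
algebra has no unit, closure under scalars has to be built in.) -/
def leavittCon : RingCon (FreeLeavitt R E) :=
  ringConGen fun a b => ∃ (t : R) (a' b' : FreeLeavitt R E),
    LeavittRel R E a' b' ∧ a = t • a' ∧ b = t • b'

theorem leavittCon_smul (t : R) {a b : FreeLeavitt R E} (h : leavittCon R E a b) :
    leavittCon R E (t • a) (t • b) := by
  change RingConGen.Rel _ a b at h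
  induction h with
  | of a b h =>
    obtain ⟨t', a', b', h, rfl, rfl⟩ := h
    exact RingConGen.Rel.of _ _ ⟨t * t', a', b', h, smul_smul .., smul_smul ..⟩
  | refl a => exact (leavittCon R E).refl _
  | symm _ ih => exact (leavittCon R E).symm ih
  | trans _ _ ih₁ ih₂ => exact (leavittCon R E).trans ih₁ ih₂
  | add _ _ ih₁ ih₂ => rw [smul_add, smul_add]; exact (leavittCon R E).add ih₁ ih₂
  | mul _ h ih _ =>
    rw [← smul_mul_assoc, ← smul_mul_assoc]
    exact (leavittCon R E).mul ih h

/-- The Leavitt path algebra `L_R(E)`: the universal `R`-algebra (associative, in general without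
unit) on the vertices, edges and ghost edges of `E`, subject to the relations above. -/
def LeavittPathAlgebra : Type (max u v w) := (leavittCon R E).Quotient

namespace LeavittPathAlgebra

instance : NonUnitalRing (LeavittPathAlgebra R E) :=
  inferInstanceAs (NonUnitalRing (leavittCon R E).Quotient)

instance : SMul R (LeavittPathAlgebra R E) where
  smul t := Quotient.map' (t • ·) fun _ _ h => leavittCon_smul R E t h

instance : Module R (LeavittPathAlgebra R E) where
  one_smul := by rintro ⟨a⟩; exact congrArg (Quot.mk _) (one_smul R a)
  mul_smul := by rintro t t' ⟨a⟩; exact congrArg (Quot.mk _) (mul_smul t t' a)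
  smul_zero := fun t => congrArg (Quot.mk _) (smul_zero t)
  smul_add := by rintro t ⟨a⟩ ⟨b⟩; exact congrArg (Quot.mk _) (smul_add t a b)
  add_smul := by rintro t t' ⟨a⟩; exact congrArg (Quot.mk _) (add_smul t t' a)
  zero_smul := by rintro ⟨a⟩; exact congrArg (Quot.mk _) (zero_smul R a)

instance : IsScalarTower R (LeavittPathAlgebra R E) (LeavittPathAlgebra R E) where
  smul_assoc := by rintro t ⟨a⟩ ⟨b⟩; exact congrArg (Quot.mk _) (smul_mul_assoc t a b)

instance : SMulCommClass R (LeavittPathAlgebra R E) (LeavittPathAlgebra R E) where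
  smul_comm := by rintro t ⟨a⟩ ⟨b⟩; exact congrArg (Quot.mk _) (mul_smul_comm t a b).symm

/-- The quotient map from the free algebra, as a homomorphism of `R`-algebras. -/
def ofFree : FreeLeavitt R E →ₙₐ[R] LeavittPathAlgebra R E where
  toFun a := (a : (leavittCon R E).Quotient)
  map_smul' _ _ := rfl
  map_zero' := rfl
  map_add' _ _ := rfl
  map_mul' _ _ := rfl

variable {E}

/-- A vertex, as an element of `L_R(E)`. -/
def vert (x : E.V) : LeavittPathAlgebra R E := ofFree R E (gen R (.vert x))

/-- An edge, as an element of `L_R(E)`. -/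
def edge (e : E.Edge) : LeavittPathAlgebra R E := ofFree R E (gen R (.edge e))

/-- A ghost edge, as an element of `L_R(E)`. -/
def ghost (e : E.Edge) : LeavittPathAlgebra R E := ofFree R E (gen R (.ghost e))

/-- `P_X = ∑_{x ∈ X} x`. -/
def vertSum (X : Finset E.V) : LeavittPathAlgebra R E := ∑ x ∈ X, vert R x

end LeavittPathAlgebra

end Leavitt

section Algebras

variable (R : Type w) [CommRing R]

/-- The corner `pAp = {p b p | b ∈ A}` of an `R`-algebra `A`. -/
def cornerSubalgebra {A : Type w'} [NonUnitalRing A] [Module R A] [IsScalarTower R A A]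
    [SMulCommClass R A A] (p : A) : NonUnitalSubalgebra R A where
  __ := NonUnitalSubsemiring.corner p
  smul_mem' := by
    rintro t _ ⟨b, rfl⟩
    exact ⟨t • b, by simp [mul_smul_comm, smul_mul_assoc]⟩

/-- Isomorphism of (not necessarily unital) `R`-algebras. -/
def AlgIso (A : Type*) (B : Type*) [NonUnitalRing A] [Module R A] [NonUnitalRing B]
    [Module R B] : Prop :=
  ∃ φ : A →ₙₐ[R] B, Function.Bijective φ

/-- `A` is isomorphic to an algebraic Cuntz-Krieger algebra over `R`. -/
def IsoToAlgebraicCuntzKrieger (A : Type*) [NonUnitalRing A] [Module R A] : Prop :=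
  ∃ F : DiGraph.{0, 0}, F.IsCuntzKrieger ∧ AlgIso R A (LeavittPathAlgebra R F)

end Algebras

end DiGraph

end

/-! The forest `T` has finite out-degrees and no infinite paths, so the finitely many roots have
finitely many descendants and `T.verts` is finite. As a vertex receives at most one edge of `T`,
each `u` in `T.verts` is reached by exactly one path p_u of `T` from exactly one root. Put q(u) = u
- ∑ e e*, summed over the edges of `T` emitted by u. The elements p_u q(u) p_u* are orthogonal
idempotents with sum P_X (`up_mul_down`, `sum_down_mul_up`), and q(u) = 0 unless u is a vertex of
E(T) (`q_eq_zero`). Sending u to p_u q(u) p_u* and e_u to p_{s(e)} e p q(u) p_u*, with p the path of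
`T` from r(e) to u, defines a Leavitt family of E(T) (`cornerFamily`), hence a homomorphism
`cornerHom` into the corner.

Surjectivity: L_R(E) is spanned by products of a path and a ghost path. Between two roots these meet
at a vertex y of `T`, because `T.verts` is hereditary. Writing y as the sum of the p q(u) p* over
the paths p of `T` from y to u separates the two factors, and an induction along each path shows
that it is a product of images of generators (`path_mul_mem_range`, `mul_ghost_mem_range`).

Injectivity: L_R(E) is made to act on a module in which the left regular representation of L_R(E(T))
can be recognized. At the vertices of `T` the module consists of columns over L_R(E(T)): edges of
`T` act as projections, the other edges through the e_u (`columnRep`). Paths leading into `T.verts`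
extend this to all vertices (`LocalRep.extend`), and one copy per vertex makes the vertices
orthogonal (`LocalRep.family`). In this module `cornerHom a` acts on an embedded c as a * c
(`rep_cornerHom_embed`), so a can be recovered from its image.

For the second claim, E(T) is finite without sinks but may have sources. The vertices reachable from
cycles form a core in which every vertex receives an edge. A vertex outside the core that emits only
into the core is absorbed by two moves that preserve the algebra. If it emits a single edge e, an
edge from the core with the same range is redirected to it (`algIso_redirect`); otherwise e is first
split off to a vertex of its own (`outSplit.algIso`). Once the core is everything, there are no
sources. -/

noncomputable section

open scoped Classical

namespace DiGraph

universe u v w u' v'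

/-! ### Universal property of the Leavitt path algebra. -/

/-- Elements of a ring that satisfy the defining relations of the Leavitt path algebra of `E`. -/
structure LeavittFamily (E : DiGraph.{u, v}) (A : Type*) [NonUnitalRing A] where
  /-- the images of the vertices -/
  vert : E.V → A
  /-- the images of the edges -/
  edge : E.Edge → A
  /-- the images of the ghost edges -/
  ghost : E.Edge → A
  vert_idem (x : E.V) : vert x * vert x = vert x
  vert_orth (x y : E.V) (h : x ≠ y) : vert x * vert y = 0
  s_edge (e : E.Edge) : vert (E.s e) * edge e = edge e
  edge_r (e : E.Edge) : edge e * vert (E.r e) = edge e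
  r_ghost (e : E.Edge) : vert (E.r e) * ghost e = ghost e
  ghost_s (e : E.Edge) : ghost e * vert (E.s e) = ghost e
  ck1_self (e : E.Edge) : ghost e * edge e = vert (E.r e)
  ck1_ne (e f : E.Edge) (h : e ≠ f) : ghost e * edge f = 0
  ck2 (x : E.V) (h : E.IsRegular x) : ∑ e ∈ h.1.toFinset, edge e * ghost e = vert x

namespace LeavittFamily

variable {E : DiGraph.{u, v}} {A : Type*} [NonUnitalRing A] (F : E.LeavittFamily A)

/-- The image of a generator. -/
def ofGen : E.Generator → A
  | .vert x => F.vert x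
  | .edge e => F.edge e
  | .ghost e => F.ghost e

variable (R : Type w) [CommRing R] [Module R A] [IsScalarTower R A A] [SMulCommClass R A A]

/-- The homomorphism from the free algebra given by a Leavitt family. -/
def liftFree : FreeLeavitt R E →ₙₐ[R] A :=
  MonoidAlgebra.liftMagma R (FreeSemigroup.lift F.ofGen)

theorem liftFree_gen (g : E.Generator) : F.liftFree R (gen R g) = F.ofGen g := by
  simp [liftFree, gen]

theorem liftFree_eq_of_con {a b : FreeLeavitt R E} (h : leavittCon R E a b) :
    F.liftFree R a = F.liftFree R b := by
  change RingConGen.Rel _ a b at h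
  induction h with
  | of a b h =>
    obtain ⟨t, a', b', h, rfl, rfl⟩ := h
    rw [map_smul, map_smul]
    congr 1
    cases h with
    | vert_idem x => simpa [liftFree_gen, ofGen] using F.vert_idem x
    | vert_orth x y h => simpa [liftFree_gen, ofGen] using F.vert_orth x y h
    | s_edge e => simpa [liftFree_gen, ofGen] using F.s_edge e
    | edge_r e => simpa [liftFree_gen, ofGen] using F.edge_r e
    | r_ghost e => simpa [liftFree_gen, ofGen] using F.r_ghost e
    | ghost_s e => simpa [liftFree_gen, ofGen] using F.ghost_s e
    | ck1_self e => simpa [liftFree_gen, ofGen] using F.ck1_self e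
    | ck1_ne e f h => simpa [liftFree_gen, ofGen] using F.ck1_ne e f h
    | ck2 x h => simpa [liftFree_gen, ofGen, map_sum] using (F.ck2 x h).symm
  | refl a => rfl
  | symm _ ih => exact ih.symm
  | trans _ _ ih₁ ih₂ => exact ih₁.trans ih₂
  | add _ _ ih₁ ih₂ => rw [map_add, map_add, ih₁, ih₂]
  | mul _ _ ih₁ ih₂ => rw [map_mul, map_mul, ih₁, ih₂]

/-- The universal property of the Leavitt path algebra. -/
def lift : LeavittPathAlgebra R E →ₙₐ[R] A where
  toFun := Quotient.lift (F.liftFree R) fun _ _ h => F.liftFree_eq_of_con R h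
  map_smul' := by rintro t ⟨a⟩; exact map_smul (F.liftFree R) t a
  map_zero' := map_zero (F.liftFree R)
  map_add' := by rintro ⟨a⟩ ⟨b⟩; exact map_add (F.liftFree R) a b
  map_mul' := by rintro ⟨a⟩ ⟨b⟩; exact map_mul (F.liftFree R) a b

@[simp]
theorem lift_vert (x : E.V) : F.lift R (LeavittPathAlgebra.vert R x) = F.vert x :=
  F.liftFree_gen R (.vert x)

@[simp]
theorem lift_edge (e : E.Edge) : F.lift R (LeavittPathAlgebra.edge R e) = F.edge e :=
  F.liftFree_gen R (.edge e)

@[simp]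
theorem lift_ghost (e : E.Edge) : F.lift R (LeavittPathAlgebra.ghost R e) = F.ghost e :=
  F.liftFree_gen R (.ghost e)

end LeavittFamily

namespace LeavittPathAlgebra

variable {R : Type w} [CommRing R] {E : DiGraph.{u, v}}

theorem ofFree_surjective : Function.Surjective (ofFree R E) := by
  rintro ⟨a⟩; exact ⟨a, rfl⟩

theorem ofFree_eq_of_rel {a b : FreeLeavitt R E} (h : LeavittRel R E a b) :
    ofFree R E a = ofFree R E b :=
  Quotient.sound (RingConGen.Rel.of _ _ ⟨1, a, b, h, (one_smul ..).symm, (one_smul ..).symm⟩)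

theorem vert_idem (x : E.V) : vert R x * vert R x = vert R x := by
  simpa [vert] using ofFree_eq_of_rel (.vert_idem (R := R) x)

theorem vert_orth (x y : E.V) (h : x ≠ y) : vert R x * vert R y = 0 := by
  simpa [vert] using ofFree_eq_of_rel (.vert_orth (R := R) x y h)

theorem s_edge (e : E.Edge) : vert R (E.s e) * edge R e = edge R e := by
  simpa [vert, edge] using ofFree_eq_of_rel (.s_edge (R := R) e)

theorem edge_r (e : E.Edge) : edge R e * vert R (E.r e) = edge R e := by
  simpa [vert, edge] using ofFree_eq_of_rel (.edge_r (R := R) e)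

theorem r_ghost (e : E.Edge) : vert R (E.r e) * ghost R e = ghost R e := by
  simpa [vert, ghost] using ofFree_eq_of_rel (.r_ghost (R := R) e)

theorem ghost_s (e : E.Edge) : ghost R e * vert R (E.s e) = ghost R e := by
  simpa [vert, ghost] using ofFree_eq_of_rel (.ghost_s (R := R) e)

theorem ck1_self (e : E.Edge) : ghost R e * edge R e = vert R (E.r e) := by
  simpa [vert, edge, ghost] using ofFree_eq_of_rel (.ck1_self (R := R) e)

theorem ck1_ne (e f : E.Edge) (h : e ≠ f) : ghost R e * edge R f = 0 := by
  simpa [edge, ghost] using ofFree_eq_of_rel (.ck1_ne (R := R) e f h)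

theorem ck2 (x : E.V) (h : E.IsRegular x) :
    ∑ e ∈ h.1.toFinset, edge R e * ghost R e = vert R x := by
  simpa [vert, edge, ghost, map_sum] using (ofFree_eq_of_rel (.ck2 (R := R) x h)).symm

/-- A subalgebra that contains all vertices, edges and ghost edges is everything. -/
theorem mem_of_generators (S : NonUnitalSubalgebra R (LeavittPathAlgebra R E))
    (hv : ∀ x, vert R x ∈ S) (he : ∀ e, edge R e ∈ S) (hg : ∀ e, ghost R e ∈ S)
    (a : LeavittPathAlgebra R E) : a ∈ S := by
  obtain ⟨a, rfl⟩ := ofFree_surjective a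
  induction a using MonoidAlgebra.induction_linear with
  | zero => rw [map_zero]; exact zero_mem S
  | add a b ha hb => rw [map_add]; exact add_mem ha hb
  | single g t =>
    have : (MonoidAlgebra.single g t : FreeLeavitt R E) = t • MonoidAlgebra.single g 1 := by simp
    rw [this, map_smul]
    refine SMulMemClass.smul_mem t ?_
    induction g using FreeSemigroup.recOnMul with
    | ih1 g =>
      cases g with
      | vert x => exact hv x
      | edge e => exact he e
      | ghost e => exact hg e
    | ih2 g g' h h' =>
      have : (MonoidAlgebra.single (FreeSemigroup.of g * g') 1 : FreeLeavitt R E) =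
          MonoidAlgebra.single (FreeSemigroup.of g) 1 * MonoidAlgebra.single g' 1 := by
        rw [MonoidAlgebra.single_mul_single, one_mul]
      rw [this, map_mul]
      exact mul_mem (h (by simp)) (h' (by simp))

theorem hom_ext {A : Type*} [NonUnitalRing A] [Module R A]
    {φ ψ : LeavittPathAlgebra R E →ₙₐ[R] A} (hv : ∀ x, φ (vert R x) = ψ (vert R x))
    (he : ∀ e, φ (edge R e) = ψ (edge R e)) (hg : ∀ e, φ (ghost R e) = ψ (ghost R e)) :
    φ = ψ := by
  ext a
  let S : NonUnitalSubalgebra R (LeavittPathAlgebra R E) :=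
    { carrier := {a | φ a = ψ a}
      add_mem' := fun {a b} ha hb => by
        change φ (a + b) = ψ (a + b)
        rw [map_add, map_add, ha, hb]
      zero_mem' := by change φ 0 = ψ 0; rw [map_zero, map_zero]
      mul_mem' := fun {a b} ha hb => by
        change φ (a * b) = ψ (a * b)
        rw [map_mul, map_mul, ha, hb]
      smul_mem' := fun t a ha => by
        change φ (t • a) = ψ (t • a)
        rw [map_smul, map_smul, ha] }
  exact mem_of_generators S hv he hg a

/-- Leavitt families that are mutually inverse on generators give an isomorphism. -/
theorem algIso_of_families {E' : DiGraph.{u', v'}}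
    (F : E.LeavittFamily (LeavittPathAlgebra R E')) (G : E'.LeavittFamily (LeavittPathAlgebra R E))
    (hv : ∀ x, G.lift R (F.vert x) = vert R x) (he : ∀ e, G.lift R (F.edge e) = edge R e)
    (hg : ∀ e, G.lift R (F.ghost e) = ghost R e)
    (hv' : ∀ x, F.lift R (G.vert x) = vert R x) (he' : ∀ e, F.lift R (G.edge e) = edge R e)
    (hg' : ∀ e, F.lift R (G.ghost e) = ghost R e) :
    AlgIso R (LeavittPathAlgebra R E) (LeavittPathAlgebra R E') := by
  have h₁ : (G.lift R).comp (F.lift R) = NonUnitalAlgHom.id R _ :=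
    hom_ext (by simpa using hv) (by simpa using he) (by simpa using hg)
  have h₂ : (F.lift R).comp (G.lift R) = NonUnitalAlgHom.id R _ :=
    hom_ext (by simpa using hv') (by simpa using he') (by simpa using hg')
  exact ⟨F.lift R, Function.bijective_iff_has_inverse.2
    ⟨G.lift R, fun a => DFunLike.congr_fun h₁ a, fun a => DFunLike.congr_fun h₂ a⟩⟩

end LeavittPathAlgebra

theorem AlgIso.trans {R : Type w} [CommRing R] {A B C : Type*} [NonUnitalRing A] [Module R A]
    [NonUnitalRing B] [Module R B] [NonUnitalRing C] [Module R C] (h : AlgIso R A B)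
    (h' : AlgIso R B C) : AlgIso R A C := by
  obtain ⟨φ, hφ⟩ := h
  obtain ⟨ψ, hψ⟩ := h'
  exact ⟨ψ.comp φ, hψ.comp hφ⟩

/-! ### Walks in acyclic graphs and well-foundedness. -/

section Walks

variable (E : DiGraph.{u, v})

/-- There is an edge from `x` to `y`. -/
def Adj (x y : E.V) : Prop := ∃ e, E.s e = x ∧ E.r e = y

variable {E}

theorem Adj.of_edge (e : E.Edge) : E.Adj (E.s e) (E.r e) := ⟨e, rfl, rfl⟩

/-- The walk has n + 1 edges; the values of f beyond n are junk. -/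
theorem exists_walk_of_transGen {x y : E.V} (h : Relation.TransGen E.Adj x y) :
    ∃ (n : ℕ) (f : ℕ → E.Edge), (∀ i < n, E.r (f i) = E.s (f (i + 1))) ∧ E.s (f 0) = x ∧
      E.r (f n) = y := by
  induction h using Relation.TransGen.head_induction_on with
  | single h => obtain ⟨e, rfl, rfl⟩ := h; exact ⟨0, fun _ => e, by simp⟩
  | head h _ ih =>
    obtain ⟨e, rfl, he⟩ := h
    obtain ⟨n, f, hf, h0, hn⟩ := ih
    refine ⟨n + 1, fun i => Nat.casesOn i e f, fun i hi => ?_, rfl, hn⟩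
    cases i with
    | zero => exact he.trans h0.symm
    | succ i => exact hf i (by omega)

/-- A graph without cycles has no closed walks. -/
theorem IsAcyclic.irrefl (hE : E.IsAcyclic) (x : E.V) : ¬ Relation.TransGen E.Adj x x := by
  intro h
  -- A closed walk with the fewest edges is a cycle.
  have hex : ∃ (n : ℕ) (f : ℕ → E.Edge), (∀ i < n, E.r (f i) = E.s (f (i + 1))) ∧
      E.r (f n) = E.s (f 0) := by
    obtain ⟨n, f, hf, h0, hn⟩ := exists_walk_of_transGen h
    exact ⟨n, f, hf, hn.trans h0.symm⟩
  obtain ⟨f, hf, hc⟩ := Nat.find_spec hex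
  have hmin : ∀ {m}, m < Nat.find hex → _ := fun {m} => Nat.find_min hex (m := m)
  set n := Nat.find hex
  -- If the sources of the edges i < j agreed, the edges i, …, j - 1 would form a shorter closed
  -- walk, with last index j - i - 1.
  have hlt : ∀ i j, i < j → j ≤ n → E.s (f i) ≠ E.s (f j) := fun i j hij hj hs => by
    refine hmin (m := j - i - 1) (by omega) ⟨fun k => f (i + k), fun k hk => hf _ (by omega), ?_⟩
    have := hf (j - 1) (by omega)
    rw [show j - 1 + 1 = j by omega] at this
    simpa only [show i + (j - i - 1) = j - 1 by omega, add_zero] using this.trans hs.symm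
  refine hE ((List.range (n + 1)).map f) ⟨by simp, ?_, ?_, ?_⟩
  · rw [List.isChain_map, List.isChain_range]
    intro m hm
    exact hf m (by omega)
  · simpa using hc
  · rw [List.map_map]
    refine List.Nodup.map_on (fun i hi j hj hij => ?_) List.nodup_range
    rw [List.mem_range] at hi hj
    by_contra hne
    rcases lt_or_gt_of_ne hne with h | h
    · exact hlt i j h (by omega) hij
    · exact hlt j i h (by omega) hij.symm

theorem injective_of_transGen {α : Type*} {r : α → α → Prop} (hr : ∀ x, ¬ Relation.TransGen r x x)
    (g : ℕ → α) (hg : ∀ i, r (g i) (g (i + 1))) : Function.Injective g := by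
  have key : ∀ i k, Relation.TransGen r (g i) (g (i + k + 1)) := fun i k => by
    induction k with
    | zero => exact .single (hg i)
    | succ k ih => exact ih.tail (hg _)
  intro i j hij
  by_contra hne
  rcases lt_or_gt_of_ne hne with h | h
  · obtain ⟨k, rfl⟩ := Nat.exists_eq_add_of_lt h
    exact hr _ (by simpa [← hij] using key i k)
  · obtain ⟨k, rfl⟩ := Nat.exists_eq_add_of_lt h
    exact hr _ (by simpa [hij] using key j k)

/-- An infinite descending chain is a right-infinite path, and acyclicity makes its vertices
distinct. The resulting induction proves a statement at a vertex from the ranges of its edges. -/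
theorem IsAcyclic.wellFounded_down (hE : E.IsAcyclic)
    (h : ¬ ∃ p, E.IsRightInfiniteSimple p) : WellFounded fun y x => E.Adj x y := by
  rw [wellFounded_iff_isEmpty_descending_chain]
  refine ⟨fun ⟨g, hg⟩ => h ?_⟩
  choose p hp using hg
  refine ⟨p, fun i => ((hp i).2.trans (hp (i + 1)).1.symm), ?_⟩
  have : (fun i => E.s (p i)) = g := funext fun i => (hp i).1
  rw [this]
  exact injective_of_transGen hE.irrefl g fun i => ⟨p i, hp i⟩

theorem IsAcyclic.wellFounded_up (hE : E.IsAcyclic)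
    (h : ¬ ∃ p, E.IsLeftInfiniteSimple p) : WellFounded E.Adj := by
  rw [wellFounded_iff_isEmpty_descending_chain]
  refine ⟨fun ⟨g, hg⟩ => h ?_⟩
  choose p hp using hg
  refine ⟨p, fun i => ((hp (i + 1)).2.trans (hp i).1.symm), ?_⟩
  have : (fun i => E.r (p i)) = g := funext fun i => (hp i).2
  rw [this]
  refine injective_of_transGen (r := Function.swap E.Adj) (fun x hx => ?_) g
    fun i => ⟨p i, hp i⟩
  exact hE.irrefl x (Relation.transGen_swap.1 hx)

end Walks

/-! ### Combinatorics of the forest. -/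

namespace Subgraph

variable {E : DiGraph.{u, v}} {T : E.Subgraph}

variable (T) in
/-- There is an edge of `T` from `x` to `y`. -/
def Step (x y : E.V) : Prop := ∃ e ∈ T.edges, E.s e = x ∧ E.r e = y

theorem toDiGraph_adj_iff (x y : T.toDiGraph.V) : T.toDiGraph.Adj x y ↔ T.Step x.1 y.1 := by
  constructor
  · rintro ⟨e, h, h'⟩
    exact ⟨e.1, e.2, congrArg Subtype.val h, congrArg Subtype.val h'⟩
  · rintro ⟨e, he, h, h'⟩
    exact ⟨⟨e, he⟩, Subtype.ext h, Subtype.ext h'⟩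

theorem Step.left_mem {x y : E.V} (h : T.Step x y) : x ∈ T.verts := by
  obtain ⟨e, he, rfl, rfl⟩ := h; exact T.s_mem e he

theorem Step.right_mem {x y : E.V} (h : T.Step x y) : y ∈ T.verts := by
  obtain ⟨e, he, rfl, rfl⟩ := h; exact T.r_mem e he

/-- Replaces paths in the subtype graph by a relation on `E.V`, so that later inductions avoid
subtypes. -/
theorem geq_iff {x y : E.V} : T.Geq x y ↔ x ∈ T.verts ∧ Relation.ReflTransGen T.Step x y := by
  constructor
  · rintro ⟨hx, hy, h⟩
    exact ⟨hx, Relation.ReflTransGen.lift (p := T.Step) Subtype.val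
      (fun a b hab => (toDiGraph_adj_iff a b).1 hab) _ _ h⟩
  · rintro ⟨hx, h⟩
    induction h with
    | refl => exact ⟨hx, hx, .refl⟩
    | tail _ hbc ih =>
      obtain ⟨_, hb, h⟩ := ih
      exact ⟨hx, hbc.right_mem, h.tail ((toDiGraph_adj_iff ⟨_, hb⟩ ⟨_, hbc.right_mem⟩).2 hbc)⟩

theorem Geq.left_mem {x y : E.V} (h : T.Geq x y) : x ∈ T.verts := h.1

theorem Geq.right_mem {x y : E.V} (h : T.Geq x y) : y ∈ T.verts := h.2.1

theorem Geq.refl {x : E.V} (h : x ∈ T.verts) : T.Geq x x := ⟨h, h, .refl⟩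

theorem Geq.trans {x y z : E.V} (h : T.Geq x y) (h' : T.Geq y z) : T.Geq x z :=
  geq_iff.2 ⟨h.left_mem, (geq_iff.1 h).2.trans (geq_iff.1 h').2⟩

theorem Geq.of_edge {e : E.Edge} (he : e ∈ T.edges) : T.Geq (E.s e) (E.r e) :=
  geq_iff.2 ⟨T.s_mem e he, .single ⟨e, he, rfl, rfl⟩⟩

theorem Geq.head {e : E.Edge} (he : e ∈ T.edges) {u : E.V} (h : T.Geq (E.r e) u) :
    T.Geq (E.s e) u := (Geq.of_edge he).trans h

theorem Geq.eq_or_edge {x u : E.V} (h : T.Geq x u) :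
    x = u ∨ ∃ e ∈ T.edges, E.s e = x ∧ T.Geq (E.r e) u := by
  rcases Relation.ReflTransGen.cases_head (geq_iff.1 h).2 with h | ⟨y, ⟨e, he, rfl, rfl⟩, h⟩
  · exact .inl h
  · exact .inr ⟨e, he, rfl, geq_iff.2 ⟨T.r_mem e he, h⟩⟩

theorem Geq.eq_or_edge_last {x u : E.V} (h : T.Geq x u) :
    x = u ∨ ∃ e ∈ T.edges, T.Geq x (E.s e) ∧ E.r e = u := by
  rcases Relation.ReflTransGen.cases_tail (geq_iff.1 h).2 with h' | ⟨y, hy, ⟨e, he, rfl, rfl⟩⟩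
  · exact .inl h'.symm
  · exact .inr ⟨e, he, geq_iff.2 ⟨h.left_mem, hy⟩, rfl⟩

variable (T) in
/-- A finite directed forest with hereditary vertex set and set of roots `X`. -/
structure IsFiniteForest (X : Finset E.V) : Prop where
  hereditary : ∀ e, E.s e ∈ T.verts → E.r e ∈ T.verts
  finite_verts : T.verts.Finite
  finite_out : ∀ x, {e ∈ T.edges | E.s e = x}.Finite
  wf : WellFounded fun y x => T.Step x y
  branch : ∀ e ∈ T.edges, ∀ f ∈ T.edges, E.s e = E.s f → ∀ u, T.Geq (E.r e) u →
    T.Geq (E.r f) u → e = f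
  not_geq : ∀ e ∈ T.edges, ¬ T.Geq (E.r e) (E.s e)
  root_mem : ∀ x ∈ X, x ∈ T.verts
  exists_root : ∀ u ∈ T.verts, ∃ x ∈ X, T.Geq x u
  root_unique : ∀ u, ∀ x ∈ X, ∀ y ∈ X, T.Geq x u → T.Geq y u → x = y

/-- Collects all that the rest of the proof uses of the forest: finiteness is a König argument, and
the uniqueness statements hold because the ancestors of a vertex form a chain. -/
theorem isFiniteForest {X : Finset E.V} (hforest : T.IsDirectedForest)
    (hrow : T.toDiGraph.IsRowFinite) (hpath : T.toDiGraph.IsPathFinite)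
    (hroots : T.roots = X) (hverts : T.verts = E.hereditaryClosure X) : T.IsFiniteForest X := by
  have hin : ∀ e ∈ T.edges, ∀ f ∈ T.edges, E.r e = E.r f → e = f := fun e he f hf hef =>
    Set.encard_le_one_iff.1 (hforest.2 (E.r f) (T.r_mem f hf)) e f ⟨he, hef⟩ ⟨hf, rfl⟩
  have hlift : ∀ {x y : E.V} (hx : x ∈ T.verts) (hy : y ∈ T.verts), T.Geq x y →
      Relation.ReflTransGen T.toDiGraph.Adj ⟨x, hx⟩ ⟨y, hy⟩ := fun hx hy h => h.2.2
  have hnot : ∀ e ∈ T.edges, ¬ T.Geq (E.r e) (E.s e) := fun e he h =>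
    hforest.1.irrefl ⟨E.s e, T.s_mem e he⟩ <| Relation.TransGen.head'
      ((toDiGraph_adj_iff ⟨_, T.s_mem e he⟩ ⟨_, T.r_mem e he⟩).2 ⟨e, he, rfl, rfl⟩)
      (hlift _ _ h)
  -- Well-foundedness passes from the subtype to `E.V`, since points outside `T.verts` have no
  -- predecessors at all.
  have hacc : ∀ (r : E.V → E.V → Prop) (r' : T.toDiGraph.V → T.toDiGraph.V → Prop),
      (∀ x y, r x y → ∃ hx hy, r' ⟨x, hx⟩ ⟨y, hy⟩) → WellFounded r' → WellFounded r := by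
    intro r r' h hwf
    refine ⟨fun x => ⟨x, fun y hyx => ?_⟩⟩
    obtain ⟨hy, -, -⟩ := h _ _ hyx
    have key : ∀ z : T.toDiGraph.V, Acc r z.1 := by
      intro z
      induction z using hwf.induction with
      | _ z ih =>
        refine ⟨_, fun a ha => ?_⟩
        obtain ⟨h1, h2, h3⟩ := h _ _ ha
        exact ih _ h3
    exact key ⟨y, hy⟩
  have hwf : WellFounded fun y x => T.Step x y :=
    hacc _ _ (fun x y h => ⟨h.right_mem, h.left_mem, (toDiGraph_adj_iff ⟨_, h.left_mem⟩
      ⟨_, h.right_mem⟩).2 h⟩) (hforest.1.wellFounded_down hpath.1)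
  have hwf' : WellFounded T.Step :=
    hacc _ _ (fun x y h => ⟨h.left_mem, h.right_mem, (toDiGraph_adj_iff ⟨_, h.left_mem⟩
      ⟨_, h.right_mem⟩).2 h⟩) (hforest.1.wellFounded_up hpath.2.1)
  -- Walking backwards in `T` is deterministic, so of two ancestors of u one lies above the other.
  have hlin : ∀ a b u, T.Geq a u → T.Geq b u → T.Geq a b ∨ T.Geq b a := by
    intro a b u ha hb
    have hr : Relator.RightUnique (Function.swap T.Step) := by
      rintro x y z ⟨e, he, rfl, rfl⟩ ⟨f, hf, rfl, hfe⟩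
      rw [hin f hf e he hfe]
    have h1 := Relation.reflTransGen_swap.2 (geq_iff.1 ha).2
    have h2 := Relation.reflTransGen_swap.2 (geq_iff.1 hb).2
    rcases Relation.ReflTransGen.total_of_right_unique hr h1 h2 with h | h
    · exact .inr (geq_iff.2 ⟨hb.left_mem, Relation.reflTransGen_swap.1 h⟩)
    · exact .inl (geq_iff.2 ⟨ha.left_mem, Relation.reflTransGen_swap.1 h⟩)
  have hout : ∀ x, {e ∈ T.edges | E.s e = x}.Finite := by
    intro x
    by_cases hx : x ∈ T.verts
    · refine ((hrow ⟨x, hx⟩).image Subtype.val).subset ?_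
      rintro e ⟨he, rfl⟩
      exact ⟨⟨e, he⟩, rfl, rfl⟩
    · convert Set.finite_empty
      ext e
      simp only [Set.mem_ofPred_eq, Set.mem_empty_iff_false, iff_false]
      rintro ⟨he, rfl⟩
      exact hx (T.s_mem e he)
  have hmem : ∀ x ∈ X, x ∈ T.verts ∧ T.edges ∩ E.inEdges x = ∅ := fun x hx => by
    have : x ∈ T.roots := by rw [hroots]; exact hx
    exact this
  -- Follow incoming edges of `T` backwards; this stops, and only at a vertex of `T.roots`.
  have hroot : ∀ u ∈ T.verts, ∃ x ∈ X, T.Geq x u := by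
    intro u
    refine hwf'.induction (C := fun u => u ∈ T.verts → ∃ x ∈ X, T.Geq x u) u fun u ih hu => ?_
    by_cases h : ∃ e ∈ T.edges, E.r e = u
    · obtain ⟨e, he, rfl⟩ := h
      obtain ⟨x, hx, hxe⟩ := ih (E.s e) ⟨e, he, rfl, rfl⟩ (T.s_mem e he)
      exact ⟨x, hx, hxe.trans (.of_edge he)⟩
    · refine ⟨u, ?_, .refl hu⟩
      rw [← Finset.mem_coe, ← hroots]
      exact ⟨hu, Set.eq_empty_of_forall_notMem fun e he => h ⟨e, he.1, he.2⟩⟩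
  -- König's lemma as an induction: the descendants of x are x and those of the finitely many ranges
  -- below it.
  have hdesc : ∀ x, {y | T.Geq x y}.Finite := by
    intro x
    refine hwf.induction (C := fun x => {y | T.Geq x y}.Finite) x fun x ih => ?_
    refine ((Set.finite_singleton x).union
      ((hout x).biUnion (t := fun e => {y | T.Geq (E.r e) y}) ?_)).subset ?_
    · rintro e ⟨he, rfl⟩
      exact ih _ ⟨e, he, rfl, rfl⟩
    · intro y hy
      rcases Geq.eq_or_edge hy with rfl | ⟨e, he, hs, h⟩
      · exact .inl rfl
      · exact .inr (Set.mem_biUnion (x := e) ⟨he, hs⟩ h)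
  refine ⟨fun e he => ?_, ?_, hout, hwf, ?_, hnot, fun x hx => (hmem x hx).1, hroot, ?_⟩
  · rw [hverts] at he ⊢
    exact fun H hH => hH.1 _ (he H hH) _ (.single ⟨e, rfl, rfl⟩)
  · refine (X.finite_toSet.biUnion (t := fun x => {y | T.Geq x y}) fun x _ => hdesc x).subset ?_
    intro u hu
    obtain ⟨x, hx, h⟩ := hroot u hu
    exact Set.mem_biUnion (x := x) hx h
  -- A path of `T` of positive length into r(f) ends with f, so it passes through s(f) = s(e);
  -- starting at r(e) it would close a cycle.
  · have key : ∀ e ∈ T.edges, ∀ f ∈ T.edges, E.s e = E.s f → T.Geq (E.r e) (E.r f) → e = f := by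
      intro e he f hf hs h
      rcases h.eq_or_edge_last with h | ⟨g, hg, hge, hgf⟩
      · exact hin e he f hf h
      · obtain rfl := hin g hg f hf hgf
        rw [← hs] at hge
        exact absurd hge (hnot e he)
    intro e he f hf hs u hu hu'
    rcases hlin _ _ u hu hu' with h | h
    · exact key e he f hf hs h
    · exact (key f hf e he hs.symm h).symm
  -- A root receives no edge of `T`, so it is its own only ancestor.
  · have key : ∀ x, ∀ y ∈ X, T.Geq x y → x = y := by
      intro x y hy h
      rcases h.eq_or_edge_last with h | ⟨g, hg, -, h⟩
      · exact h
      · have : g ∈ T.edges ∩ E.inEdges y := ⟨hg, h⟩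
        rw [(hmem y hy).2] at this
        exact absurd this (Set.notMem_empty g)
    intro u x hx y hy hxu hyu
    rcases hlin x y u hxu hyu with h | h
    · exact key x y hy h
    · exact (key y x hx h).symm

end Subgraph

/-- Rewrites with a * b = c inside a right-associated product. -/
theorem mul_mul_of_mul_eq {A : Type*} [Semigroup A] {a b c : A} (h : a * b = c) (z : A) :
    a * (b * z) = c * z := by
  rw [← mul_assoc, h]

namespace LeavittPathAlgebra

variable {R : Type w} [CommRing R] {E : DiGraph.{u, v}}

theorem vert_mul_vert (x y : E.V) : vert R x * vert R y = if x = y then vert R x else 0 := by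
  split_ifs with h
  · rw [← h, vert_idem]
  · exact vert_orth x y h

theorem ghost_mul_edge (e f : E.Edge) :
    ghost R e * edge R f = if e = f then vert R (E.r e) else 0 := by
  split_ifs with h
  · rw [← h, ck1_self]
  · exact ck1_ne e f h

theorem vert_mul_edge (x : E.V) (e : E.Edge) :
    vert R x * edge R e = if x = E.s e then edge R e else 0 := by
  rw [← s_edge, ← mul_assoc, vert_mul_vert]
  split_ifs with h
  · rw [h]
  · rw [zero_mul]

theorem ghost_mul_vert (x : E.V) (e : E.Edge) :
    ghost R e * vert R x = if E.s e = x then ghost R e else 0 := by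
  rw [← ghost_s, mul_assoc, vert_mul_vert]
  split_ifs with h
  · rfl
  · rw [mul_zero]

end LeavittPathAlgebra

open LeavittPathAlgebra

/-! ### The elements q(u) and the path elements of the forest. -/

namespace Subgraph.IsFiniteForest

variable {E : DiGraph.{u, v}} {T : E.Subgraph} {X : Finset E.V} (h : T.IsFiniteForest X)
  (R : Type w) [CommRing R]

/-- The edges of `T` emitted by a vertex. -/
def outT (x : E.V) : Finset E.Edge := (h.finite_out x).toFinset

theorem mem_outT {x : E.V} {e : E.Edge} : e ∈ h.outT x ↔ e ∈ T.edges ∧ E.s e = x := by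
  simp [outT]

/-- The vertices of `T`. -/
def vertsT : Finset E.V := h.finite_verts.toFinset

theorem mem_vertsT {x : E.V} : x ∈ h.vertsT ↔ x ∈ T.verts := by simp [vertsT]

theorem outT_induction {C : E.V → Prop} (step : ∀ x, (∀ e ∈ h.outT x, C (E.r e)) → C x) (x : E.V) :
    C x :=
  h.wf.induction x fun x ih => step x fun e he =>
    ih _ ⟨e, (h.mem_outT.1 he).1, (h.mem_outT.1 he).2, rfl⟩

/-- The part `x - ∑ e e*` of the vertex `x`, the sum over the edges of `T` emitted by `x`. -/
def q (x : E.V) : LeavittPathAlgebra R E := vert R x - ∑ e ∈ h.outT x, edge R e * ghost R e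

theorem q_add (x : E.V) : h.q R x + ∑ e ∈ h.outT x, edge R e * ghost R e = vert R x := by
  simp [q]

theorem vert_mul_q (x : E.V) : vert R x * h.q R x = h.q R x := by
  rw [q, mul_sub, vert_idem, Finset.mul_sum]
  congr 1
  refine Finset.sum_congr rfl fun e he => ?_
  rw [← mul_assoc, ← (h.mem_outT.1 he).2, s_edge]

theorem q_mul_vert (x : E.V) : h.q R x * vert R x = h.q R x := by
  rw [q, sub_mul, vert_idem, Finset.sum_mul]
  congr 1
  refine Finset.sum_congr rfl fun e he => ?_
  rw [mul_assoc, ← (h.mem_outT.1 he).2, ghost_s]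

/-- For e in `T` the subtracted term e e* reproduces e; for e outside `T` every subtracted term dies
by the first Cuntz–Krieger relation. -/
theorem q_mul_edge (e : E.Edge) :
    h.q R (E.s e) * edge R e = if e ∈ T.edges then 0 else edge R e := by
  rw [q, sub_mul, s_edge, Finset.sum_mul]
  split_ifs with he
  · rw [Finset.sum_eq_single_of_mem e (h.mem_outT.2 ⟨he, rfl⟩), mul_assoc, ck1_self, edge_r,
      sub_self]
    intro f _ hf
    rw [mul_assoc, ck1_ne _ _ hf, mul_zero]
  · rw [Finset.sum_eq_zero, sub_zero]
    intro f hf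
    rw [mul_assoc, ck1_ne f e (fun hfe => he (hfe ▸ (h.mem_outT.1 hf).1)), mul_zero]

theorem ghost_mul_q (e : E.Edge) :
    ghost R e * h.q R (E.s e) = if e ∈ T.edges then 0 else ghost R e := by
  rw [q, mul_sub, ghost_s, Finset.mul_sum]
  split_ifs with he
  · rw [Finset.sum_eq_single_of_mem e (h.mem_outT.2 ⟨he, rfl⟩), ← mul_assoc, ck1_self, r_ghost,
      sub_self]
    intro f _ hf
    rw [← mul_assoc, ck1_ne _ _ hf.symm, zero_mul]
  · rw [Finset.sum_eq_zero, sub_zero]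
    intro f hf
    rw [← mul_assoc, ck1_ne e f (fun hfe => he (hfe ▸ (h.mem_outT.1 hf).1)), zero_mul]

theorem q_mul_edge_of_mem {x : E.V} {e : E.Edge} (he : e ∈ h.outT x) :
    h.q R x * edge R e = 0 := by
  obtain ⟨he', rfl⟩ := h.mem_outT.1 he
  rw [q_mul_edge, if_pos he']

theorem ghost_mul_q_of_mem {x : E.V} {e : E.Edge} (he : e ∈ h.outT x) :
    ghost R e * h.q R x = 0 := by
  obtain ⟨he', rfl⟩ := h.mem_outT.1 he
  rw [ghost_mul_q, if_pos he']

theorem q_mul_q (x : E.V) : h.q R x * h.q R x = h.q R x := by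
  nth_rw 2 [q]
  rw [mul_sub, q_mul_vert, Finset.mul_sum, Finset.sum_eq_zero, sub_zero]
  intro e he
  rw [← mul_assoc, h.q_mul_edge_of_mem R he, zero_mul]

/-- The sum of `p q(u)` over the paths `p` in `T` from `x` to `u`; there is at most one. -/
def down : E.V → E.V → LeavittPathAlgebra R E :=
  h.wf.fix (C := fun _ => E.V → LeavittPathAlgebra R E) fun x ih u =>
    -- The first summand is the path of length 0; the others split off the first edge of a longer
    -- path. The attached membership proofs justify the recursion.
    (if x = u then h.q R x else 0) + ∑ e ∈ (h.outT x).attach,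
      edge R e.1 * ih (E.r e.1) ⟨e, (h.mem_outT.1 e.2).1, (h.mem_outT.1 e.2).2, rfl⟩ u

/-- The sum of `q(u) p*` over the paths `p` in `T` from `x` to `u`; there is at most one. -/
def up (u : E.V) : E.V → LeavittPathAlgebra R E :=
  h.wf.fix (C := fun _ => LeavittPathAlgebra R E) fun x ih =>
    (if x = u then h.q R x else 0) + ∑ e ∈ (h.outT x).attach,
      ih (E.r e.1) ⟨e, (h.mem_outT.1 e.2).1, (h.mem_outT.1 e.2).2, rfl⟩ * ghost R e.1

theorem down_eq (x u : E.V) : h.down R x u =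
    (if x = u then h.q R x else 0) + ∑ e ∈ h.outT x, edge R e * h.down R (E.r e) u := by
  conv_lhs => rw [down, WellFounded.fix_eq]
  congr 1
  exact Finset.sum_attach (h.outT x) fun e => edge R e * h.down R (E.r e) u

theorem up_eq (u x : E.V) : h.up R u x =
    (if x = u then h.q R x else 0) + ∑ e ∈ h.outT x, h.up R u (E.r e) * ghost R e := by
  conv_lhs => rw [up, WellFounded.fix_eq]
  congr 1
  exact Finset.sum_attach (h.outT x) fun e => h.up R u (E.r e) * ghost R e

theorem vert_mul_down (x u : E.V) : vert R x * h.down R x u = h.down R x u := by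
  rw [down_eq, mul_add, Finset.mul_sum, mul_ite, vert_mul_q, mul_zero]
  congr 1
  refine Finset.sum_congr rfl fun e he => ?_
  rw [← mul_assoc, ← (h.mem_outT.1 he).2, s_edge]

theorem up_mul_vert (u x : E.V) : h.up R u x * vert R x = h.up R u x := by
  rw [up_eq, add_mul, Finset.sum_mul, ite_mul, q_mul_vert, zero_mul]
  congr 1
  refine Finset.sum_congr rfl fun e he => ?_
  rw [mul_assoc, ← (h.mem_outT.1 he).2, ghost_s]

theorem down_mul_q (x u : E.V) : h.down R x u * h.q R u = h.down R x u := by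
  induction x using h.outT_induction with
  | step x ih =>
    rw [down_eq, add_mul, Finset.sum_mul]
    congr 1
    · split_ifs with hx
      · rw [hx, q_mul_q]
      · rw [zero_mul]
    · exact Finset.sum_congr rfl fun e he => by rw [mul_assoc, ih e he]

theorem q_mul_up (u x : E.V) : h.q R u * h.up R u x = h.up R u x := by
  induction x using h.outT_induction with
  | step x ih =>
    rw [up_eq, mul_add, Finset.mul_sum]
    congr 1
    · split_ifs with hx
      · rw [hx, q_mul_q]
      · rw [mul_zero]
    · exact Finset.sum_congr rfl fun e he => by rw [← mul_assoc, ih e he]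

theorem not_geq_of_mem {x : E.V} {e : E.Edge} (he : e ∈ h.outT x) : ¬ T.Geq (E.r e) x := by
  obtain ⟨he', rfl⟩ := h.mem_outT.1 he
  exact h.not_geq e he'

theorem geq_of_mem {x u : E.V} {e : E.Edge} (he : e ∈ h.outT x) (hu : T.Geq (E.r e) u) :
    T.Geq x u := by
  obtain ⟨he', rfl⟩ := h.mem_outT.1 he
  exact hu.head he'

theorem r_mem_verts {x : E.V} {e : E.Edge} (he : e ∈ h.outT x) : E.r e ∈ T.verts :=
  T.r_mem e (h.mem_outT.1 he).1

theorem branch_of_mem {x u : E.V} {e f : E.Edge} (he : e ∈ h.outT x) (hf : f ∈ h.outT x)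
    (heu : T.Geq (E.r e) u) (hfu : T.Geq (E.r f) u) : e = f := by
  rw [mem_outT] at he hf
  exact h.branch e he.1 f hf.1 (he.2.trans hf.2.symm) u heu hfu

theorem down_eq_zero {x u : E.V} (hx : x ∈ T.verts) (hu : ¬ T.Geq x u) : h.down R x u = 0 := by
  induction x using h.outT_induction with
  | step x ih =>
    rw [down_eq, if_neg (fun hxu : x = u => hu (hxu ▸ .refl hx)), zero_add]
    refine Finset.sum_eq_zero fun e he => ?_
    rw [ih e he (h.r_mem_verts he) fun h' => hu (h.geq_of_mem he h'), mul_zero]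

theorem up_eq_zero {x u : E.V} (hx : x ∈ T.verts) (hu : ¬ T.Geq x u) : h.up R u x = 0 := by
  induction x using h.outT_induction with
  | step x ih =>
    rw [up_eq, if_neg (fun hxu : x = u => hu (hxu ▸ .refl hx)), zero_add]
    refine Finset.sum_eq_zero fun e he => ?_
    rw [ih e he (h.r_mem_verts he) fun h' => hu (h.geq_of_mem he h'), zero_mul]

theorem down_self {x : E.V} : h.down R x x = h.q R x := by
  rw [down_eq, if_pos rfl, Finset.sum_eq_zero, add_zero]
  intro e he
  rw [h.down_eq_zero R (h.r_mem_verts he) (h.not_geq_of_mem he), mul_zero]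

theorem up_self {x : E.V} : h.up R x x = h.q R x := by
  rw [up_eq, if_pos rfl, Finset.sum_eq_zero, add_zero]
  intro e he
  rw [h.up_eq_zero R (h.r_mem_verts he) (h.not_geq_of_mem he), zero_mul]

/-- The path of `T` to u must start with e: by `branch`, no other edge of `T` from s(e) leads to u.
-/
theorem down_of_edge {e : E.Edge} (he : e ∈ T.edges) {u : E.V} (hu : T.Geq (E.r e) u) :
    h.down R (E.s e) u = edge R e * h.down R (E.r e) u := by
  have he' := h.mem_outT.2 ⟨he, rfl⟩
  rw [down_eq, if_neg (fun hxu : E.s e = u => h.not_geq e he (hxu ▸ hu)), zero_add,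
    Finset.sum_eq_single_of_mem e he']
  intro f hf hfe
  rw [h.down_eq_zero R (h.r_mem_verts hf) fun h' => hfe (h.branch_of_mem hf he' h' hu), mul_zero]

theorem up_of_edge {e : E.Edge} (he : e ∈ T.edges) {u : E.V} (hu : T.Geq (E.r e) u) :
    h.up R u (E.s e) = h.up R u (E.r e) * ghost R e := by
  have he' := h.mem_outT.2 ⟨he, rfl⟩
  rw [up_eq, if_neg (fun hxu : E.s e = u => h.not_geq e he (hxu ▸ hu)), zero_add,
    Finset.sum_eq_single_of_mem e he']
  intro f hf hfe
  rw [h.up_eq_zero R (h.r_mem_verts hf) fun h' => hfe (h.branch_of_mem hf he' h' hu), zero_mul]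

/-- Orthonormality of the path elements. The mixed terms vanish because q(x) annihilates the edges
of `T` emitted by x and their ghosts, and distinct edges are orthogonal. What remains is the same
product at the ranges r(e), where at most one edge leads to u. -/
theorem up_mul_down {x : E.V} (hx : x ∈ T.verts) (u u' : E.V) :
    h.up R u x * h.down R x u' = if u = u' ∧ T.Geq x u then h.q R u else 0 := by
  induction x using h.outT_induction with
  | step x ih =>
    have key : h.up R u x * h.down R x u' = (if x = u ∧ x = u' then h.q R x else 0) +
        ∑ e ∈ h.outT x, h.up R u (E.r e) * h.down R (E.r e) u' := by
      rw [up_eq, down_eq, add_mul, mul_add, mul_add, Finset.mul_sum, Finset.sum_mul,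
        Finset.sum_mul_sum]
      have h1 : (if x = u then h.q R x else 0) * (if x = u' then h.q R x else 0) =
          if x = u ∧ x = u' then h.q R x else 0 := by
        rw [ite_mul, mul_ite, q_mul_q, mul_zero, zero_mul, ite_and]
      have h2 : ∑ e ∈ h.outT x, (if x = u then h.q R x else 0) *
          (edge R e * h.down R (E.r e) u') = 0 := by
        refine Finset.sum_eq_zero fun e he => ?_
        rw [ite_mul, ← mul_assoc, h.q_mul_edge_of_mem R he, zero_mul, zero_mul, ite_self]
      have h3 : ∑ e ∈ h.outT x, h.up R u (E.r e) * ghost R e *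
          (if x = u' then h.q R x else 0) = 0 := by
        refine Finset.sum_eq_zero fun e he => ?_
        rw [mul_ite, mul_assoc, h.ghost_mul_q_of_mem R he, mul_zero, mul_zero, ite_self]
      rw [h1, h2, h3, add_zero, zero_add]
      congr 1
      refine Finset.sum_congr rfl fun e he => ?_
      rw [Finset.sum_eq_single_of_mem e he]
      · rw [mul_assoc, mul_mul_of_mul_eq (ck1_self e), vert_mul_down]
      · intro f _ hf
        rw [mul_assoc, mul_mul_of_mul_eq (ck1_ne e f hf.symm), zero_mul, mul_zero]
    rw [key, Finset.sum_congr rfl fun e he => ih e he (h.r_mem_verts he)]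
    by_cases huu : u = u'
    · subst huu
      simp only [and_self, true_and]
      by_cases hxu : x = u
      · subst hxu
        rw [if_pos rfl, if_pos (.refl hx), Finset.sum_eq_zero, add_zero]
        exact fun e he => if_neg (h.not_geq_of_mem he)
      · rw [if_neg hxu, zero_add]
        split_ifs with hge
        · obtain ⟨e, he, hs, hu⟩ := hge.eq_or_edge.resolve_left hxu
          have he' := h.mem_outT.2 ⟨he, hs⟩
          rw [Finset.sum_eq_single_of_mem e he', if_pos hu]
          exact fun f hf hfe => if_neg fun h' => hfe (h.branch_of_mem hf he' h' hu)
        · exact Finset.sum_eq_zero fun e he => if_neg fun h' => hge (h.geq_of_mem he h')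
    · rw [if_neg (fun h' => huu (h'.1.symm.trans h'.2)), if_neg (fun h' => huu h'.1), zero_add]
      exact Finset.sum_eq_zero fun e _ => if_neg (fun h' => huu h'.1)

/-- Completeness of the path elements: iterate x = q(x) + ∑ e r(e) e* down the forest. -/
theorem sum_down_mul_up {x : E.V} (hx : x ∈ T.verts) :
    ∑ u ∈ h.vertsT, h.down R x u * h.up R u x = vert R x := by
  induction x using h.outT_induction with
  | step x ih =>
    have key : ∀ u, h.down R x u * h.up R u x = (if x = u then h.q R x else 0) +
        ∑ e ∈ h.outT x, edge R e * (h.down R (E.r e) u * h.up R u (E.r e)) * ghost R e := by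
      intro u
      by_cases hxu : x = u
      · subst hxu
        rw [down_self, up_self, q_mul_q, if_pos rfl, Finset.sum_eq_zero, add_zero]
        intro e he
        rw [h.down_eq_zero R (h.r_mem_verts he) (h.not_geq_of_mem he), zero_mul, mul_zero,
          zero_mul]
      · rw [down_eq, up_eq, if_neg hxu, zero_add, zero_add, zero_add, Finset.sum_mul_sum]
        refine Finset.sum_congr rfl fun e he => ?_
        rw [Finset.sum_eq_single_of_mem e he]
        · simp only [mul_assoc]
        -- Two distinct edges of `T` from x cannot both lead to u, so one of the two factors
        -- vanishes.
        · intro f hf hfe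
          by_cases heu : T.Geq (E.r e) u
          · rw [h.up_eq_zero R (h.r_mem_verts hf) fun h' => hfe (h.branch_of_mem hf he h' heu),
              zero_mul, mul_zero]
          · rw [h.down_eq_zero R (h.r_mem_verts he) heu, mul_zero, zero_mul]
    rw [Finset.sum_congr rfl fun u _ => key u, Finset.sum_add_distrib, Finset.sum_comm,
      Finset.sum_ite_eq, if_pos (h.mem_vertsT.2 hx), ← h.q_add R x]
    congr 1
    refine Finset.sum_congr rfl fun e he => ?_
    rw [← Finset.sum_mul, ← Finset.mul_sum, ih e he (h.r_mem_verts he), edge_r]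

/-- The sum of `down x u` over the roots `x`. -/
def rootDown (u : E.V) : LeavittPathAlgebra R E := ∑ x ∈ X, h.down R x u

/-- The sum of `up u x` over the roots `x`. -/
def rootUp (u : E.V) : LeavittPathAlgebra R E := ∑ x ∈ X, h.up R u x

theorem rootDown_mul_q (u : E.V) : h.rootDown R u * h.q R u = h.rootDown R u := by
  simp only [rootDown, Finset.sum_mul, down_mul_q]

theorem q_mul_rootUp (u : E.V) : h.q R u * h.rootUp R u = h.rootUp R u := by
  simp only [rootUp, Finset.mul_sum, q_mul_up]

/-- Only one root lies above u, so the other summands vanish. Summing over all roots in the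
definition avoids a choice of this root. -/
theorem rootDown_eq {x u : E.V} (hx : x ∈ X) (hxu : T.Geq x u) :
    h.rootDown R u = h.down R x u := by
  refine Finset.sum_eq_single_of_mem x hx fun y hy hyx => h.down_eq_zero R (h.root_mem y hy) ?_
  exact fun hyu => hyx (h.root_unique u y hy x hx hyu hxu)

theorem rootUp_eq {x u : E.V} (hx : x ∈ X) (hxu : T.Geq x u) :
    h.rootUp R u = h.up R u x := by
  refine Finset.sum_eq_single_of_mem x hx fun y hy hyx => h.up_eq_zero R (h.root_mem y hy) ?_
  exact fun hyu => hyx (h.root_unique u y hy x hx hyu hxu)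

theorem rootUp_mul_rootDown_self {u : E.V} (hu : u ∈ T.verts) :
    h.rootUp R u * h.rootDown R u = h.q R u := by
  obtain ⟨x, hx, hxu⟩ := h.exists_root u hu
  rw [h.rootUp_eq R hx hxu, h.rootDown_eq R hx hxu, h.up_mul_down R (h.root_mem x hx),
    if_pos ⟨rfl, hxu⟩]

theorem rootUp_mul_rootDown_ne {u u' : E.V} (hu : u ∈ T.verts) (hu' : u' ∈ T.verts)
    (hne : u ≠ u') : h.rootUp R u * h.rootDown R u' = 0 := by
  obtain ⟨x, hx, hxu⟩ := h.exists_root u hu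
  obtain ⟨x', hx', hxu'⟩ := h.exists_root u' hu'
  rw [h.rootUp_eq R hx hxu, h.rootDown_eq R hx' hxu']
  by_cases hxx : x = x'
  · subst hxx
    rw [h.up_mul_down R (h.root_mem x hx), if_neg fun h' => hne h'.1]
  · rw [← up_mul_vert, ← vert_mul_down, mul_assoc, mul_mul_of_mul_eq (vert_orth x x' hxx),
      zero_mul, mul_zero]

theorem vertSum_mul_vertSum : vertSum R X * vertSum R X = vertSum R X := by
  simp only [vertSum, Finset.sum_mul_sum, vert_mul_vert]
  refine Finset.sum_congr rfl fun x hx => ?_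
  rw [Finset.sum_ite_eq, if_pos hx]

theorem vertSum_mul_rootDown (u : E.V) :
    vertSum R X * h.rootDown R u = h.rootDown R u := by
  simp only [vertSum, rootDown, Finset.sum_mul_sum]
  refine Finset.sum_congr rfl fun x hx => ?_
  rw [Finset.sum_eq_single_of_mem x hx, vert_mul_down]
  intro y _ hyx
  rw [← vert_mul_down, mul_mul_of_mul_eq (vert_orth x y hyx.symm), zero_mul]

theorem rootUp_mul_vertSum (u : E.V) :
    h.rootUp R u * vertSum R X = h.rootUp R u := by
  simp only [vertSum, rootUp, Finset.sum_mul_sum]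
  refine Finset.sum_congr rfl fun x hx => ?_
  rw [Finset.sum_eq_single_of_mem x hx, up_mul_vert]
  intro y _ hyx
  rw [← up_mul_vert, mul_assoc, vert_orth x y hyx.symm, mul_zero]

end Subgraph.IsFiniteForest

/-! ### The homomorphism from the algebra of the corner graph. -/

namespace Subgraph.IsFiniteForest

variable {E : DiGraph.{u, v}} {T : E.Subgraph} {X : Finset E.V} (h : T.IsFiniteForest X)
  (R : Type w) [CommRing R]

/-- A vertex removed in E(T) emits only edges of `T`, finitely many and at least one, so the second
Cuntz–Krieger relation turns the subtracted sum into u. -/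
theorem q_eq_zero {u : E.V} (hu : u ∈ T.verts) (hu' : u ∉ T.cornerVerts) : h.q R u = 0 := by
  have hu2 : (E.outEdges u).Nonempty ∧ E.outEdges u ⊆ T.edges := by
    by_contra hcon
    exact hu' ⟨hu, fun h' => hcon h'.2⟩
  have hfin : (E.outEdges u).Finite := (h.finite_out u).subset fun e he => ⟨hu2.2 he, he⟩
  rw [q, ← ck2 u ⟨hfin, hu2.1⟩, sub_eq_zero]
  refine Finset.sum_congr ?_ fun _ _ => rfl
  ext e
  rw [mem_outT, Set.Finite.mem_toFinset]
  exact ⟨fun he => ⟨hu2.2 he, he⟩, fun he => he.2⟩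

-- Descend along `T`: a removed vertex emits an edge of `T`, and the descent ends. Hence every edge
-- outside `T` with source in `T.verts` has at least one copy in E(T).
include h in
theorem exists_corner_of_mem (w : E.V) (hw : w ∈ T.verts) : ∃ u ∈ T.cornerVerts, T.Geq w u := by
  induction w using h.outT_induction with
  | step w ih =>
    by_cases hwc : w ∈ T.cornerVerts
    · exact ⟨w, hwc, .refl hw⟩
    · have : (E.outEdges w).Nonempty ∧ E.outEdges w ⊆ T.edges := by
        by_contra hcon
        exact hwc ⟨hw, fun h' => hcon h'.2⟩
      obtain ⟨e, he⟩ := this.1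
      have he' := h.mem_outT.2 ⟨this.2 he, he⟩
      obtain ⟨u, hu, hwu⟩ := ih e he' (h.r_mem_verts he')
      exact ⟨u, hu, h.geq_of_mem he' hwu⟩

include h in
theorem finite_cornerGraph_verts : Finite T.cornerGraph.V :=
  h.finite_verts.subset Set.sdiff_subset

/-- The set of all vertices of the corner graph. -/
def cornerV : Finset T.cornerGraph.V := @Finset.univ _ (@Fintype.ofFinite _ h.finite_cornerGraph_verts)

@[simp]
theorem mem_cornerV (u : T.cornerGraph.V) : u ∈ h.cornerV := @Finset.mem_univ _ (_) u

/-- The removed vertices contribute nothing to `sum_down_mul_up`, since q vanishes there. -/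
theorem sum_cornerV {x : E.V} (hx : x ∈ T.verts) :
    ∑ u ∈ h.cornerV, h.down R x u.1 * h.up R u.1 x = vert R x := by
  rw [← h.sum_down_mul_up R hx]
  refine Finset.sum_of_injOn (fun u : T.cornerGraph.V => u.1) Subtype.val_injective.injOn
    (fun u _ => h.mem_vertsT.2 u.2.1) ?_ fun _ _ => rfl
  intro u hu hu'
  have hq : h.q R u = 0 := h.q_eq_zero R (h.mem_vertsT.1 hu) fun hc =>
    hu' ⟨⟨u, hc⟩, h.mem_cornerV _, rfl⟩
  rw [← down_mul_q, hq, mul_zero, zero_mul]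

-- Each edge outside `T` emitted by x has a copy, so finitely many copies allow only finitely many
-- such edges; the edges of `T` at x are finite in number anyway.
include h in
theorem isRegular_of_corner {x : T.cornerGraph.V} (hx : T.cornerGraph.IsRegular x) :
    E.IsRegular x.1 := by
  constructor
  · refine ((h.finite_out x.1).union (hx.1.image fun p : T.cornerGraph.Edge => p.1.1)).subset ?_
    intro e he
    by_cases heT : e ∈ T.edges
    · exact .inl ⟨heT, he⟩
    · have hs : E.s e ∈ T.verts := by rw [show E.s e = x.1 from he]; exact x.2.1
      obtain ⟨u, hu, hru⟩ := h.exists_corner_of_mem (E.r e) (h.hereditary e hs)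
      exact .inr ⟨⟨(e, u), hs, heT, hu, hru⟩, Subtype.ext he, rfl⟩
  · obtain ⟨p, hp⟩ := hx.2
    exact ⟨p.1.1, congrArg Subtype.val hp⟩

/-- The sum over the edges of the corner graph emitted by a vertex, as an iterated sum. -/
theorem sum_corner_outEdges {M : Type*} [AddCommMonoid M] {x : T.cornerGraph.V}
    (hx : (T.cornerGraph.outEdges x).Finite) (hx' : (E.outEdges x.1).Finite)
    (F : T.cornerGraph.Edge → M) :
    ∑ p ∈ hx.toFinset, F p = ∑ e ∈ hx'.toFinset with e ∉ T.edges, ∑ u ∈ h.cornerV,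
      if hp : (e, u.1) ∈ T.cornerEdges then F ⟨(e, u.1), hp⟩ else 0 := by
  rw [← Finset.sum_product']
  refine Finset.sum_of_injOn (fun p : T.cornerGraph.Edge => (p.1.1, T.cornerGraph.r p)) ?_ ?_ ?_ ?_
  · intro p _ p' _ hpp
    rw [Prod.mk.injEq] at hpp
    exact Subtype.ext (Prod.ext hpp.1 (congrArg Subtype.val hpp.2))
  · intro p hp
    rw [Finset.mem_coe, Set.Finite.mem_toFinset] at hp
    simp only [Finset.coe_product, Finset.coe_filter, Set.mem_prod, Set.mem_ofPred_eq,
      Set.Finite.mem_toFinset, Finset.mem_coe, mem_cornerV, and_true]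
    exact ⟨congrArg Subtype.val hp, p.2.2.1⟩
  · rintro ⟨e, u⟩ heu hne
    refine dif_neg fun hp => hne ⟨⟨(e, u.1), hp⟩, ?_, rfl⟩
    simp only [Finset.mem_product, Finset.mem_filter, Set.Finite.mem_toFinset] at heu
    exact Finset.mem_coe.2 (hx.mem_toFinset.2 (Subtype.ext heu.1.1))
  · rintro p -
    exact (dif_pos (c := (p.1.1, (T.cornerGraph.r p).1) ∈ T.cornerEdges) (t := fun hp =>
      F ⟨(p.1.1, (T.cornerGraph.r p).1), hp⟩) p.2).symm

theorem corner_edge_s_mem (p : T.cornerGraph.Edge) : E.s p.1.1 ∈ T.verts := p.2.1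

include h in
theorem corner_edge_r_mem (p : T.cornerGraph.Edge) : E.r p.1.1 ∈ T.verts :=
  h.hereditary _ p.2.1

theorem corner_edge_notMem (p : T.cornerGraph.Edge) : p.1.1 ∉ T.edges := p.2.2.1

theorem corner_edge_geq (p : T.cornerGraph.Edge) : T.Geq (E.r p.1.1) p.1.2 := p.2.2.2.2

theorem corner_edge_target_mem (p : T.cornerGraph.Edge) : p.1.2 ∈ T.verts :=
  (corner_edge_geq p).right_mem

/-- The image of a vertex of the corner graph. -/
def cVert (u : E.V) : LeavittPathAlgebra R E := h.rootDown R u * h.rootUp R u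

/-- The image of an edge of the corner graph. -/
def cEdge (p : E.Edge × E.V) : LeavittPathAlgebra R E :=
  h.rootDown R (E.s p.1) * (edge R p.1 * (h.down R (E.r p.1) p.2 * h.rootUp R p.2))

/-- The image of a ghost edge of the corner graph. -/
def cGhost (p : E.Edge × E.V) : LeavittPathAlgebra R E :=
  h.rootDown R p.2 * (h.up R p.2 (E.r p.1) * (ghost R p.1 * h.rootUp R (E.s p.1)))

theorem cVert_mul_cVert {u : E.V} (hu : u ∈ T.verts) :
    h.cVert R u * h.cVert R u = h.cVert R u := by
  rw [cVert, mul_assoc, mul_mul_of_mul_eq (h.rootUp_mul_rootDown_self R hu), q_mul_rootUp]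

theorem cVert_mul_rootDown {u : E.V} (hu : u ∈ T.verts) :
    h.cVert R u * h.rootDown R u = h.rootDown R u := by
  rw [cVert, mul_assoc, h.rootUp_mul_rootDown_self R hu, rootDown_mul_q]

theorem rootUp_mul_cVert {u : E.V} (hu : u ∈ T.verts) :
    h.rootUp R u * h.cVert R u = h.rootUp R u := by
  rw [cVert, mul_mul_of_mul_eq (h.rootUp_mul_rootDown_self R hu), q_mul_rootUp]

theorem cEdge_mul_cGhost {p : E.Edge × E.V} (hp : p ∈ T.cornerEdges) :
    h.cEdge R p * h.cGhost R p = h.rootDown R (E.s p.1) * (edge R p.1 *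
      (h.down R (E.r p.1) p.2 * h.up R p.2 (E.r p.1)) * ghost R p.1) * h.rootUp R (E.s p.1) := by
  simp only [cEdge, cGhost, mul_assoc]
  rw [mul_mul_of_mul_eq (h.rootUp_mul_rootDown_self R (corner_edge_target_mem ⟨p, hp⟩)),
    mul_mul_of_mul_eq (h.q_mul_up R _ _)]

/-- The Leavitt family of the corner graph in `L_R(E)`. -/
def cornerFamily : T.cornerGraph.LeavittFamily (LeavittPathAlgebra R E) where
  vert u := h.cVert R u.1
  edge p := h.cEdge R p.1
  ghost p := h.cGhost R p.1
  vert_idem u := h.cVert_mul_cVert R u.2.1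
  vert_orth u u' hne := by
    rw [cVert, mul_assoc, cVert, mul_mul_of_mul_eq (h.rootUp_mul_rootDown_ne R u.2.1 u'.2.1
      fun h' => hne (Subtype.ext h')), zero_mul, mul_zero]
  s_edge p := mul_mul_of_mul_eq (h.cVert_mul_rootDown R (corner_edge_s_mem p)) _
  edge_r p := by
    change h.cEdge R p.1 * h.cVert R p.1.2 = _
    simp only [cEdge, mul_assoc, h.rootUp_mul_cVert R (corner_edge_target_mem p)]
  r_ghost p := mul_mul_of_mul_eq (h.cVert_mul_rootDown R (corner_edge_target_mem p)) _
  ghost_s p := by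
    change h.cGhost R p.1 * h.cVert R (E.s p.1.1) = _
    simp only [cGhost, mul_assoc, h.rootUp_mul_cVert R (corner_edge_s_mem p)]
  ck1_self p := by
    change h.cGhost R p.1 * h.cEdge R p.1 = h.cVert R p.1.2
    simp only [cGhost, cEdge, mul_assoc]
    -- The product collapses from its middle: the root factors give q(s(e)), which e* absorbs
    -- because e is outside `T`; then e* e = r(e), and the inner path factors give q(u).
    rw [mul_mul_of_mul_eq (h.rootUp_mul_rootDown_self R (corner_edge_s_mem p)),
      mul_mul_of_mul_eq (h.ghost_mul_q R p.1.1), if_neg (corner_edge_notMem p),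
      mul_mul_of_mul_eq (ck1_self p.1.1), mul_mul_of_mul_eq (h.vert_mul_down R _ _),
      mul_mul_of_mul_eq (h.up_mul_down R (h.corner_edge_r_mem p) _ _),
      if_pos ⟨rfl, corner_edge_geq p⟩, q_mul_rootUp, cVert]
  ck1_ne p p' hne := by
    simp only [cGhost, cEdge, mul_assoc]
    by_cases hs : E.s p.1.1 = E.s p'.1.1
    · rw [← hs, mul_mul_of_mul_eq (h.rootUp_mul_rootDown_self R (corner_edge_s_mem p)),
        mul_mul_of_mul_eq (h.ghost_mul_q R p.1.1), if_neg (corner_edge_notMem p)]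
      by_cases he : p.1.1 = p'.1.1
      · rw [← he, mul_mul_of_mul_eq (ck1_self p.1.1), mul_mul_of_mul_eq (h.vert_mul_down R _ _),
          mul_mul_of_mul_eq (h.up_mul_down R (h.corner_edge_r_mem p) _ _),
          if_neg fun h' => hne (Subtype.ext (Prod.ext he h'.1)), zero_mul, mul_zero]
      · rw [mul_mul_of_mul_eq (ck1_ne _ _ he), zero_mul, mul_zero, mul_zero]
    · rw [mul_mul_of_mul_eq (h.rootUp_mul_rootDown_ne R (corner_edge_s_mem p)
        (corner_edge_s_mem p') hs), zero_mul, mul_zero, mul_zero, mul_zero]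
  ck2 x hx := by
    have hx' := h.isRegular_of_corner hx
    rw [h.sum_corner_outEdges hx.1 hx'.1 fun p => h.cEdge R p.1 * h.cGhost R p.1]
    -- For fixed e the copies e_u add up, because the path elements from r(e) sum to r(e); a missing
    -- copy corresponds to a vanishing path element.
    have key : ∀ e ∈ hx'.1.toFinset.filter (· ∉ T.edges), (∑ u ∈ h.cornerV,
        if hp : (e, u.1) ∈ T.cornerEdges then h.cEdge R (e, u.1) * h.cGhost R (e, u.1) else 0) =
        h.rootDown R x.1 * (edge R e * ghost R e) * h.rootUp R x.1 := by
      intro e he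
      rw [Finset.mem_filter, Set.Finite.mem_toFinset] at he
      have hs : E.s e = x.1 := he.1
      have hsm : E.s e ∈ T.verts := hs ▸ x.2.1
      rw [← edge_r e, ← h.sum_cornerV R (h.hereditary e hsm), Finset.mul_sum, Finset.sum_mul,
        Finset.mul_sum, Finset.sum_mul]
      refine Finset.sum_congr rfl fun u _ => ?_
      split_ifs with hp
      · rw [h.cEdge_mul_cGhost R hp, hs]
      · rw [h.down_eq_zero R (h.hereditary e hsm) fun hge => hp ⟨hsm, he.2, u.2, hge⟩]
        simp only [zero_mul, mul_zero]
    rw [Finset.sum_congr rfl key, ← Finset.sum_mul, ← Finset.mul_sum]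
    -- By the second relation at x in E, the edges outside `T` account for exactly what q(x) leaves
    -- over.
    have hq : ∑ e ∈ hx'.1.toFinset.filter (· ∉ T.edges), edge R e * ghost R e = h.q R x.1 := by
      rw [q, ← ck2 x.1 hx', eq_sub_iff_add_eq, add_comm,
        ← Finset.sum_filter_add_sum_filter_not hx'.1.toFinset (· ∈ T.edges)]
      congr 1
      refine Finset.sum_congr ?_ fun _ _ => rfl
      ext e
      rw [mem_outT, Finset.mem_filter, Set.Finite.mem_toFinset, and_comm]
      rfl
    rw [hq, rootDown_mul_q, cVert]

/-- The homomorphism from the Leavitt path algebra of the corner graph to that of `E`. -/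
def cornerHom : LeavittPathAlgebra R T.cornerGraph →ₙₐ[R] LeavittPathAlgebra R E :=
  (h.cornerFamily R).lift R

theorem cornerHom_vert (u : T.cornerGraph.V) : h.cornerHom R (vert R u) = h.cVert R u.1 :=
  (h.cornerFamily R).lift_vert R u

theorem cornerHom_edge (p : T.cornerGraph.Edge) : h.cornerHom R (edge R p) = h.cEdge R p.1 :=
  (h.cornerFamily R).lift_edge R p

theorem cornerHom_ghost (p : T.cornerGraph.Edge) : h.cornerHom R (ghost R p) = h.cGhost R p.1 :=
  (h.cornerFamily R).lift_ghost R p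

theorem cornerHom_mem (a : LeavittPathAlgebra R T.cornerGraph) :
    h.cornerHom R a ∈ cornerSubalgebra R (vertSum R X) := by
  have hmem : ∀ b : LeavittPathAlgebra R E, vertSum R X * b = b → b * vertSum R X = b →
      b ∈ cornerSubalgebra R (vertSum R X) := fun b h1 h2 =>
    (Subsemigroup.mem_corner_iff (vertSum_mul_vertSum R)).2 ⟨h1, h2⟩
  refine mem_of_generators ((cornerSubalgebra R (vertSum R X)).comap (h.cornerHom R))
    (fun x => ?_) (fun e => ?_) (fun e => ?_) a
  · rw [NonUnitalSubalgebra.mem_comap, cornerHom_vert]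
    refine hmem _ ?_ ?_
    · rw [cVert, ← mul_assoc, vertSum_mul_rootDown]
    · rw [cVert, mul_assoc, rootUp_mul_vertSum]
  · rw [NonUnitalSubalgebra.mem_comap, cornerHom_edge]
    refine hmem _ ?_ ?_
    · rw [cEdge, ← mul_assoc, vertSum_mul_rootDown]
    · simp only [cEdge, mul_assoc, rootUp_mul_vertSum]
  · rw [NonUnitalSubalgebra.mem_comap, cornerHom_ghost]
    refine hmem _ ?_ ?_
    · rw [cGhost, ← mul_assoc, vertSum_mul_rootDown]
    · simp only [cGhost, mul_assoc, rootUp_mul_vertSum]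

end Subgraph.IsFiniteForest

/-! ### Surjectivity: spanning by paths and ghost paths. -/

namespace LeavittPathAlgebra

variable (R : Type w) [CommRing R] {E : DiGraph.{u, v}}

/-- The elements of `L_R(E)` that are given by paths from one vertex to another. -/
inductive IsPathElt : E.V → LeavittPathAlgebra R E → E.V → Prop
  | nil (x : E.V) : IsPathElt x (vert R x) x
  | snoc {x : E.V} {a : LeavittPathAlgebra R E} (e : E.Edge) (h : IsPathElt x a (E.s e)) :
      IsPathElt x (a * edge R e) (E.r e)

/-- The elements of `L_R(E)` that are given by ghost paths from one vertex to another. -/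
inductive IsGhostElt : E.V → LeavittPathAlgebra R E → E.V → Prop
  | nil (x : E.V) : IsGhostElt x (vert R x) x
  | cons {x : E.V} {a : LeavittPathAlgebra R E} (e : E.Edge) (h : IsGhostElt (E.s e) a x) :
      IsGhostElt (E.r e) (ghost R e * a) x

variable {R}

theorem IsPathElt.vert_mul {x y : E.V} {a : LeavittPathAlgebra R E} (h : IsPathElt R x a y) :
    vert R x * a = a := by
  induction h with
  | nil => exact vert_idem x
  | snoc e _ ih => rw [← mul_assoc, ih]

theorem IsPathElt.mul_vert {x y : E.V} {a : LeavittPathAlgebra R E} (h : IsPathElt R x a y) :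
    a * vert R y = a := by
  cases h with
  | nil => exact vert_idem x
  | snoc e _ => rw [mul_assoc, edge_r]

theorem IsGhostElt.mul_vert {x y : E.V} {a : LeavittPathAlgebra R E} (h : IsGhostElt R x a y) :
    a * vert R y = a := by
  induction h with
  | nil x => exact vert_idem x
  | cons e _ ih => rw [mul_assoc, ih]

theorem IsPathElt.cons {e : E.Edge} {x y : E.V} {a : LeavittPathAlgebra R E}
    (h : IsPathElt R x a y) (hx : x = E.r e) : IsPathElt R (E.s e) (edge R e * a) y := by
  induction h with
  | nil =>
    rw [hx, edge_r, ← s_edge]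
    exact .snoc e (.nil _)
  | snoc f _ ih =>
    rw [← mul_assoc]
    exact .snoc f ih

/-- Path elements are built by appending edges, but a ghost edge on the left cancels against the
first edge; hence this view from the head. -/
theorem IsPathElt.cases_head {x y : E.V} {a : LeavittPathAlgebra R E} (h : IsPathElt R x a y) :
    (x = y ∧ a = vert R x) ∨
      ∃ e b, E.s e = x ∧ a = edge R e * b ∧ IsPathElt R (E.r e) b y := by
  induction h with
  | nil => exact .inl ⟨rfl, rfl⟩
  | snoc e _ ih =>
    rcases ih with ⟨rfl, rfl⟩ | ⟨f, b, rfl, rfl, hb⟩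
    · exact .inr ⟨e, vert R (E.r e), rfl, by rw [s_edge, edge_r], .nil _⟩
    · exact .inr ⟨f, b * edge R e, rfl, mul_assoc .., .snoc e hb⟩

variable (R E) in
/-- The elements of `L_R(E)` that are the product of a path and a ghost path. -/
def monomials : Set (LeavittPathAlgebra R E) :=
  {c | ∃ x a y b z, IsPathElt R x a y ∧ IsGhostElt R y b z ∧ c = a * b}

/-- Only a ghost edge could spoil the shape of a monomial. It meets the first edge of the path and
gives a vertex or 0, or, if the path has length 0, joins the ghost path or gives 0. -/
theorem generator_mul_mem_span {g c : LeavittPathAlgebra R E}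
    (hg : (∃ x, g = vert R x) ∨ (∃ e, g = edge R e) ∨ ∃ e, g = ghost R e)
    (hc : c ∈ monomials R E) : g * c ∈ Submodule.span R (monomials R E) := by
  obtain ⟨x, a, y, b, z, ha, hb, rfl⟩ := hc
  rcases hg with ⟨t, rfl⟩ | ⟨e, rfl⟩ | ⟨e, rfl⟩
  · rw [← ha.vert_mul, ← mul_assoc, ← mul_assoc, vert_mul_vert]
    split_ifs with h
    · rw [h, ha.vert_mul]
      exact Submodule.subset_span ⟨x, a, y, b, z, ha, hb, rfl⟩
    · simp only [zero_mul, zero_mem]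
  · by_cases h : x = E.r e
    · rw [← mul_assoc]
      exact Submodule.subset_span ⟨_, _, y, b, z, ha.cons h, hb, rfl⟩
    · rw [← ha.vert_mul, ← edge_r, mul_assoc, mul_assoc,
        mul_mul_of_mul_eq (vert_orth _ _ (Ne.symm h)), zero_mul, mul_zero]
      exact zero_mem _
  · rcases ha.cases_head with ⟨rfl, rfl⟩ | ⟨f, a', rfl, rfl, ha'⟩
    · rw [← mul_assoc, ghost_mul_vert]
      split_ifs with h
      · subst h
        exact Submodule.subset_span ⟨_, _, _, _, z, .nil _, .cons e hb, by
          rw [← mul_assoc, r_ghost]⟩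
      · rw [zero_mul]; exact zero_mem _
    · rw [mul_assoc, mul_mul_of_mul_eq (ghost_mul_edge e f)]
      split_ifs with h
      · subst h
        rw [← mul_assoc, ha'.vert_mul]
        exact Submodule.subset_span ⟨_, _, _, _, _, ha', hb, rfl⟩
      · rw [zero_mul]; exact zero_mem _

/-- The Leavitt path algebra is spanned by the products of a path and a ghost path. -/
theorem mem_span_monomials (c : LeavittPathAlgebra R E) :
    c ∈ Submodule.span R (monomials R E) := by
  -- The left multipliers that preserve the span form a subalgebra containing the generators, hence
  -- are everything. So the span is itself a subalgebra, and it contains the generators.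
  let S : NonUnitalSubalgebra R (LeavittPathAlgebra R E) :=
    { carrier := {y | ∀ n ∈ Submodule.span R (monomials R E),
        y * n ∈ Submodule.span R (monomials R E)}
      add_mem' := fun {a b} ha hb n hn => by rw [add_mul]; exact add_mem (ha n hn) (hb n hn)
      zero_mem' := fun n _ => by rw [zero_mul]; exact zero_mem _
      mul_mem' := fun {a b} ha hb n hn => by rw [mul_assoc]; exact ha _ (hb n hn)
      smul_mem' := fun t a ha n hn => by
        rw [smul_mul_assoc]; exact Submodule.smul_mem _ t (ha n hn) }
  have hgen : ∀ g, ((∃ x, g = vert R x) ∨ (∃ e, g = edge R e) ∨ ∃ e, g = ghost R e) → g ∈ S := by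
    intro g hg n hn
    induction hn using Submodule.span_induction with
    | mem c hc => exact generator_mul_mem_span hg hc
    | zero => rw [mul_zero]; exact zero_mem _
    | add a b _ _ ha hb => rw [mul_add]; exact add_mem ha hb
    | smul t a _ ha => rw [mul_smul_comm]; exact Submodule.smul_mem _ t ha
  have hS : ∀ y, y ∈ S := mem_of_generators S (fun x => hgen _ (.inl ⟨x, rfl⟩))
    (fun e => hgen _ (.inr (.inl ⟨e, rfl⟩))) (fun e => hgen _ (.inr (.inr ⟨e, rfl⟩)))
  let S' : NonUnitalSubalgebra R (LeavittPathAlgebra R E) :=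
    { Submodule.span R (monomials R E) with
      mul_mem' := fun {a b} _ hb => hS a b hb }
  refine mem_of_generators S' (fun x => ?_) (fun e => ?_) (fun e => ?_) c
  · exact Submodule.subset_span ⟨x, _, x, _, x, .nil x, .nil x, (vert_idem x).symm⟩
  · exact Submodule.subset_span ⟨_, _, _, _, _, .snoc e (.nil _), .nil _, by
      rw [s_edge, edge_r]⟩
  · exact Submodule.subset_span ⟨_, _, _, _, _, .nil _, .cons e (.nil _), by
      rw [ghost_s, r_ghost]⟩

end LeavittPathAlgebra

namespace Subgraph.IsFiniteForest

variable {E : DiGraph.{u, v}} {T : E.Subgraph} {X : Finset E.V} (h : T.IsFiniteForest X)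
  (R : Type w) [CommRing R]

theorem cVert_mem_range {u : E.V} (hu : u ∈ T.cornerVerts) :
    h.cVert R u ∈ NonUnitalAlgHom.range (h.cornerHom R) :=
  ⟨vert R (E := T.cornerGraph) ⟨u, hu⟩, h.cornerHom_vert R ⟨u, hu⟩⟩

theorem cEdge_mem_range {p : E.Edge × E.V} (hp : p ∈ T.cornerEdges) :
    h.cEdge R p ∈ NonUnitalAlgHom.range (h.cornerHom R) :=
  ⟨edge R (E := T.cornerGraph) ⟨p, hp⟩, h.cornerHom_edge R ⟨p, hp⟩⟩

theorem cGhost_mem_range {p : E.Edge × E.V} (hp : p ∈ T.cornerEdges) :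
    h.cGhost R p ∈ NonUnitalAlgHom.range (h.cornerHom R) :=
  ⟨ghost R (E := T.cornerGraph) ⟨p, hp⟩, h.cornerHom_ghost R ⟨p, hp⟩⟩

include h in
theorem path_target_mem {x y : E.V} {a : LeavittPathAlgebra R E} (ha : IsPathElt R x a y)
    (hx : x ∈ X) : y ∈ T.verts := by
  induction ha with
  | nil => exact h.root_mem x hx
  | snoc e _ ih => exact h.hereditary e ih

include h in
theorem ghost_source_mem {x y : E.V} {a : LeavittPathAlgebra R E} (ha : IsGhostElt R x a y)
    (hy : y ∈ X) : x ∈ T.verts := by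
  induction ha with
  | nil x => exact h.root_mem x hy
  | cons e _ ih => exact h.hereditary e (ih hy)

/-- Induction on the path, through its last edge e. If e lies in `T`, it merges with the path
element below it and the path gets shorter. If not, s(e) is a vertex of E(T), and the product
factors as the same kind of element for the shorter path, at s(e), times the image of e_u. The path
of length 0 gives the image of a vertex. -/
theorem path_mul_mem_range {x y : E.V} {a : LeavittPathAlgebra R E} (ha : IsPathElt R x a y)
    (hx : x ∈ X) {u : E.V} (hu : u ∈ T.cornerVerts) :
    a * (h.down R y u * h.rootUp R u) ∈ NonUnitalAlgHom.range (h.cornerHom R) := by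
  induction ha generalizing u with
  | nil =>
    by_cases hxu : T.Geq x u
    · rw [← mul_assoc, vert_mul_down, ← h.rootDown_eq R hx hxu]
      exact h.cVert_mem_range R hu
    · rw [h.down_eq_zero R (h.root_mem x hx) hxu, zero_mul, mul_zero]
      exact zero_mem _
  | @snoc a e ha ih =>
    have hs := h.path_target_mem R ha hx
    by_cases hru : T.Geq (E.r e) u
    · by_cases he : e ∈ T.edges
      · rw [mul_assoc, ← mul_assoc (edge R e), ← h.down_of_edge R he hru]
        exact ih hu
      · have hp : (e, u) ∈ T.cornerEdges := ⟨hs, he, hu, hru⟩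
        have hc : E.s e ∈ T.cornerVerts := ⟨hs, fun h' => he (h'.2.2 rfl)⟩
        have := mul_mem (ih hc) (h.cEdge_mem_range R hp)
        rw [down_self, cEdge, mul_assoc, mul_assoc,
          mul_mul_of_mul_eq (h.rootUp_mul_rootDown_self R hs),
          mul_mul_of_mul_eq (h.q_mul_edge R e), if_neg he,
          mul_mul_of_mul_eq (h.q_mul_edge R e), if_neg he] at this
        rwa [mul_assoc]
    · rw [h.down_eq_zero R (h.hereditary e hs) hru, zero_mul, mul_zero]
      exact zero_mem _

theorem mul_ghost_mem_range {x y : E.V} {a : LeavittPathAlgebra R E} (ha : IsGhostElt R x a y)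
    (hy : y ∈ X) {u : E.V} (hu : u ∈ T.cornerVerts) :
    h.rootDown R u * h.up R u x * a ∈ NonUnitalAlgHom.range (h.cornerHom R) := by
  induction ha generalizing u with
  | nil x =>
    by_cases hxu : T.Geq x u
    · rw [mul_assoc, up_mul_vert, ← h.rootUp_eq R hy hxu]
      exact h.cVert_mem_range R hu
    · rw [h.up_eq_zero R (h.root_mem x hy) hxu, mul_zero, zero_mul]
      exact zero_mem _
  | @cons x a e ha ih =>
    have hs := h.ghost_source_mem R ha hy
    by_cases hru : T.Geq (E.r e) u
    · by_cases he : e ∈ T.edges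
      · rw [← mul_assoc, mul_assoc (h.rootDown R u), ← h.up_of_edge R he hru]
        exact ih hy hu
      · have hp : (e, u) ∈ T.cornerEdges := ⟨hs, he, hu, hru⟩
        have hc : E.s e ∈ T.cornerVerts := ⟨hs, fun h' => he (h'.2.2 rfl)⟩
        have := mul_mem (h.cGhost_mem_range R hp) (ih hy hc)
        simp only [up_self, cGhost, mul_assoc] at this
        rw [mul_mul_of_mul_eq (h.rootUp_mul_rootDown_self R hs),
          mul_mul_of_mul_eq (h.ghost_mul_q R e), if_neg he,
          mul_mul_of_mul_eq (h.ghost_mul_q R e), if_neg he] at this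
        rwa [mul_assoc]
    · rw [h.up_eq_zero R (h.hereditary e hs) hru, mul_zero, zero_mul]
      exact zero_mem _

/-- Inserting `sum_cornerV` at the vertex where path and ghost path meet turns a compressed monomial
into a sum of products; q(u) = `rootUp` * `rootDown` splits each of them into the factors treated
above. -/
theorem mem_range_of_mem_corner {b : LeavittPathAlgebra R E}
    (hb : b ∈ cornerSubalgebra R (vertSum R X)) :
    b ∈ NonUnitalAlgHom.range (h.cornerHom R) := by
  obtain ⟨c, rfl⟩ := hb
  change vertSum R X * c * vertSum R X ∈ _
  induction mem_span_monomials c using Submodule.span_induction with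
  | zero => rw [mul_zero, zero_mul]; exact zero_mem _
  | add a b _ _ ha hb => rw [mul_add, add_mul]; exact add_mem ha hb
  | smul t a _ ha => rw [mul_smul_comm, smul_mul_assoc]; exact SMulMemClass.smul_mem t ha
  | mem c hc =>
    obtain ⟨x, a, y, b, z, ha, hb, rfl⟩ := hc
    have h1 : vertSum R X * a = if x ∈ X then a else 0 := by
      rw [← ha.vert_mul, ← mul_assoc, vertSum, Finset.sum_mul]
      simp only [vert_mul_vert, Finset.sum_ite_eq', ite_mul, zero_mul]
    have h2 : b * vertSum R X = if z ∈ X then b else 0 := by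
      rw [← hb.mul_vert, mul_assoc, vertSum, Finset.mul_sum]
      simp only [vert_mul_vert, Finset.sum_ite_eq, mul_ite, mul_zero]
    rw [← mul_assoc, mul_assoc, h1, h2]
    by_cases hx : x ∈ X
    · by_cases hz : z ∈ X
      · rw [if_pos hx, if_pos hz, ← ha.mul_vert, mul_assoc,
          ← h.sum_cornerV R (h.path_target_mem R ha hx), Finset.sum_mul, Finset.mul_sum]
        refine sum_mem fun u _ => ?_
        have := mul_mem (h.path_mul_mem_range R ha hx u.2) (h.mul_ghost_mem_range R hb hz u.2)
        simp only [mul_assoc] at this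
        rw [mul_mul_of_mul_eq (h.rootUp_mul_rootDown_self R u.2.1),
          mul_mul_of_mul_eq (h.q_mul_up R _ _)] at this
        rwa [mul_assoc]
      · rw [if_neg hz, mul_zero]; exact zero_mem _
    · rw [if_neg hx, zero_mul]; exact zero_mem _

end Subgraph.IsFiniteForest

/-! ### Injectivity: block operators on families. -/

section MatrixUnits

variable {R : Type w} [CommRing R] {ι : Type*} {D : Type*} [AddCommGroup D] [Module R D]

/-- The endomorphism of `ι → D` that applies `φ` to the component `j` and puts the result into the
component `i`. -/
def blockEnd (i j : ι) (φ : Module.End R D) : Module.End R (ι → D) :=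
  LinearMap.single R (fun _ => D) i ∘ₗ φ ∘ₗ LinearMap.proj j

theorem blockEnd_apply (i j : ι) (φ : Module.End R D) (f : ι → D) :
    blockEnd i j φ f = Pi.single i (φ (f j)) := rfl

theorem blockEnd_mul (i j k : ι) (φ ψ : Module.End R D) :
    blockEnd i j φ * blockEnd j k ψ = blockEnd i k (φ * ψ) := by
  ext1 f
  simp [blockEnd_apply]

theorem blockEnd_mul_of_ne {i j j' k : ι} (h : j ≠ j') (φ ψ : Module.End R D) :
    blockEnd i j φ * blockEnd j' k ψ = 0 := by
  refine LinearMap.ext fun f => ?_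
  simp [blockEnd_apply, Pi.single_eq_of_ne h]

theorem blockEnd_zero (i j : ι) : blockEnd i j (0 : Module.End R D) = 0 := by
  refine LinearMap.ext fun f => ?_
  simp [blockEnd_apply]

theorem blockEnd_sum {κ : Type*} (s : Finset κ) (i j : ι) (φ : κ → Module.End R D) :
    blockEnd i j (∑ k ∈ s, φ k) = ∑ k ∈ s, blockEnd i j (φ k) := by
  refine LinearMap.ext fun f => ?_
  rw [blockEnd_apply, LinearMap.sum_apply, LinearMap.sum_apply]
  exact map_sum (LinearMap.single R (fun _ => D) i) _ _

theorem blockEnd_single (i j : ι) (φ : Module.End R D) (d : D) :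
    blockEnd i j φ (Pi.single j d) = Pi.single i (φ d) := by
  rw [blockEnd_apply, Pi.single_eq_same]

theorem blockEnd_single_of_ne {i j k : ι} (h : j ≠ k) (φ : Module.End R D) (d : D) :
    blockEnd i j φ (Pi.single k d) = 0 := by
  rw [blockEnd_apply, Pi.single_eq_of_ne h, map_zero, Pi.single_zero]

/-- The family of families with a single entry. -/
def single₂ {κ : Type*} (i : ι) (k : κ) (d : D) : ι → κ → D := Pi.single i (Pi.single k d)

theorem single₂_zero {κ : Type*} (i : ι) (k : κ) : single₂ i k (0 : D) = 0 := by
  simp [single₂]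

theorem single₂_same {κ : Type*} (i : ι) (k : κ) (d : D) : single₂ i k d i k = d := by
  simp [single₂]

theorem single₂_of_ne {κ : Type*} {i j : ι} (h : j ≠ i) (k : κ) (d : D) : single₂ i k d j = 0 :=
  Pi.single_eq_of_ne h _

theorem single₂_sum {κ : Type*} (i : ι) (k : κ) {α : Type*} (s : Finset α) (f : α → D) :
    single₂ i k (∑ a ∈ s, f a) = ∑ a ∈ s, single₂ i k (f a) :=
  map_sum ((AddMonoidHom.single (fun _ : ι => κ → D) i).comp
    (AddMonoidHom.single (fun _ : κ => D) k)) f s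

theorem blockEnd_single₂ {κ : Type*} (i j : ι) (k k' : κ) (φ : Module.End R D) (d : D) :
    blockEnd i j (blockEnd k k' φ) (single₂ j k' d) = single₂ i k (φ d) := by
  rw [single₂, blockEnd_single, blockEnd_single, single₂]

theorem blockEnd_single₂_of_ne {κ : Type*} {i j j' : ι} (h : j ≠ j') (k' : κ)
    (φ : Module.End R (κ → D)) (d : D) : blockEnd i j φ (single₂ j' k' d) = 0 :=
  blockEnd_single_of_ne h _ _

end MatrixUnits

/-! ### Injectivity: extending a representation from a hereditary set of vertices. -/

section Representations

variable (R : Type w) [CommRing R] (E : DiGraph.{u, v}) (D : Type*) [AddCommGroup D] [Module R D]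

/-- Endomorphisms of a module that satisfy the relations of the Leavitt path algebra at the vertices
of a set `H`, up to the orthogonality of distinct vertices. -/
structure LocalRep (H : Set E.V) where
  /-- the action of the vertices -/
  vert : E.V → Module.End R D
  /-- the action of the edges -/
  edge : E.Edge → Module.End R D
  /-- the action of the ghost edges -/
  ghost : E.Edge → Module.End R D
  vert_idem (x : E.V) (hx : x ∈ H) : vert x * vert x = vert x
  s_edge (e : E.Edge) (he : E.s e ∈ H) : vert (E.s e) * edge e = edge e
  edge_r (e : E.Edge) (he : E.s e ∈ H) : edge e * vert (E.r e) = edge e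
  r_ghost (e : E.Edge) (he : E.s e ∈ H) : vert (E.r e) * ghost e = ghost e
  ghost_s (e : E.Edge) (he : E.s e ∈ H) : ghost e * vert (E.s e) = ghost e
  ck1_self (e : E.Edge) (he : E.s e ∈ H) : ghost e * edge e = vert (E.r e)
  ck1_ne (e f : E.Edge) (he : E.s e ∈ H) (hs : E.s e = E.s f) (h : e ≠ f) : ghost e * edge f = 0
  ck2 (x : E.V) (hx : x ∈ H) (h : E.IsRegular x) :
    ∑ e ∈ h.1.toFinset, edge e * ghost e = vert x

variable {R E D}

/-- The Leavitt family on `E⁰ → D` given by a representation that is defined at all vertices. -/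
def LocalRep.family (ρ : E.LocalRep R D Set.univ) : E.LeavittFamily (Module.End R (E.V → D)) where
  vert x := blockEnd x x (ρ.vert x)
  edge e := blockEnd (E.s e) (E.r e) (ρ.edge e)
  ghost e := blockEnd (E.r e) (E.s e) (ρ.ghost e)
  vert_idem x := by rw [blockEnd_mul, ρ.vert_idem x trivial]
  vert_orth x y h := blockEnd_mul_of_ne h _ _
  s_edge e := by rw [blockEnd_mul, ρ.s_edge e trivial]
  edge_r e := by rw [blockEnd_mul, ρ.edge_r e trivial]
  r_ghost e := by rw [blockEnd_mul, ρ.r_ghost e trivial]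
  ghost_s e := by rw [blockEnd_mul, ρ.ghost_s e trivial]
  ck1_self e := by rw [blockEnd_mul, ρ.ck1_self e trivial]
  ck1_ne e f h := by
    by_cases hs : E.s e = E.s f
    · rw [hs, blockEnd_mul, ρ.ck1_ne e f trivial hs h, blockEnd_zero]
    · exact blockEnd_mul_of_ne hs _ _
  ck2 x h := by
    rw [← ρ.ck2 x trivial h, blockEnd_sum]
    refine Finset.sum_congr rfl fun e he => ?_
    rw [← show E.s e = x from h.1.mem_toFinset.1 he, blockEnd_mul]

/-- The endomorphism `f ↦ (l ↦ f (e :: l))`. -/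
def listShift (e : E.Edge) : Module.End R (List E.Edge → D) := LinearMap.funLeft R D (List.cons e)

/-- The right inverse of `listShift e` that vanishes on the lists that do not start with `e`. -/
def listCons (e : E.Edge) : Module.End R (List E.Edge → D) :=
  LinearMap.pi fun l => match l with
    | [] => 0
    | e' :: l => if e' = e then LinearMap.proj l else 0

theorem listShift_mul_listCons (e : E.Edge) :
    listShift e * listCons e = (1 : Module.End R (List E.Edge → D)) := by
  refine LinearMap.ext fun f => funext fun l => ?_
  simp [listShift, listCons, LinearMap.funLeft]

theorem listShift_mul_listCons_of_ne {e e' : E.Edge} (h : e' ≠ e) :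
    listShift e' * listCons e = (0 : Module.End R (List E.Edge → D)) := by
  refine LinearMap.ext fun f => funext fun l => ?_
  simp [listShift, listCons, LinearMap.funLeft, h]

/-- A family indexed by lists consists of its component at the empty list and its shifts, so
identities of operators can be checked one first edge at a time. -/
theorem end_list_ext {φ ψ : Module.End R (List E.Edge → D)} (h₀ : ∀ f, φ f [] = ψ f [])
    (h : ∀ e, listShift e * φ = listShift e * ψ) : φ = ψ := by
  refine LinearMap.ext fun f => funext fun l => ?_
  cases l with
  | nil => exact h₀ f
  | cons e l => exact congrFun (LinearMap.congr_fun (h e) f) l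

theorem listShift_mul_blockEnd (e : E.Edge) (φ : Module.End R D) :
    listShift e * blockEnd [] [] φ = 0 := by
  refine LinearMap.ext fun f => funext fun l => ?_
  simp [listShift, blockEnd_apply, LinearMap.funLeft]

namespace LocalRep

variable {H : Set E.V} (ρ : E.LocalRep R D H)

/-- The component `l` of the action of a vertex on the extended representation. -/
def extVertAux : List E.Edge → E.V → ((List E.Edge → D) →ₗ[R] D)
  -- The component l is nonzero at x only if l is a path from x whose sources lie outside H and
  -- whose end lies in H; the end vertex then acts on that component.
  | [], x => if x ∈ H then ρ.vert x ∘ₗ LinearMap.proj [] else 0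
  | e :: l, x => if x ∉ H ∧ E.s e = x then extVertAux l (E.r e) ∘ₗ listShift e else 0

/-- The action of a vertex on the extended representation. -/
def extVert (x : E.V) : Module.End R (List E.Edge → D) := LinearMap.pi fun l => ρ.extVertAux l x

theorem extVert_of_mem {x : E.V} (hx : x ∈ H) : ρ.extVert x = blockEnd [] [] (ρ.vert x) := by
  refine end_list_ext (fun f => ?_) fun e => ?_
  · simp [extVert, extVertAux, hx, blockEnd_apply]
  · rw [listShift_mul_blockEnd]
    refine LinearMap.ext fun f => funext fun l => ?_
    simp [extVert, extVertAux, hx, listShift, LinearMap.funLeft]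

theorem extVert_nil {x : E.V} (hx : x ∉ H) (f : List E.Edge → D) : ρ.extVert x f [] = 0 := by
  simp [extVert, extVertAux, hx]

theorem listShift_mul_extVert {e : E.Edge} (he : E.s e ∉ H) :
    listShift e * ρ.extVert (E.s e) = ρ.extVert (E.r e) * listShift e := by
  refine LinearMap.ext fun f => funext fun l => ?_
  simp [extVert, extVertAux, he, listShift, LinearMap.funLeft]

theorem listShift_mul_extVert_of_ne {e : E.Edge} {x : E.V} (he : E.s e ≠ x) :
    listShift e * ρ.extVert x = 0 := by
  refine LinearMap.ext fun f => funext fun l => ?_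
  simp [extVert, extVertAux, he, listShift, LinearMap.funLeft]

theorem extVert_idem (x : E.V) : ρ.extVert x * ρ.extVert x = ρ.extVert x := by
  refine LinearMap.ext fun f => funext fun l => ?_
  induction l generalizing x f with
  | nil =>
    by_cases hx : x ∈ H
    · rw [ρ.extVert_of_mem hx, blockEnd_mul, ρ.vert_idem x hx]
    · rw [Module.End.mul_apply, ρ.extVert_nil hx, ρ.extVert_nil hx]
  | cons e l ih =>
    by_cases hx : x ∈ H
    · rw [ρ.extVert_of_mem hx, blockEnd_mul, ρ.vert_idem x hx]
    · change (listShift (R := R) e * (ρ.extVert x * ρ.extVert x) : Module.End R _) f l =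
        (listShift (R := R) e * ρ.extVert x : Module.End R _) f l
      by_cases he : E.s e = x
      · subst he
        rw [← mul_assoc, listShift_mul_extVert _ hx, mul_assoc, listShift_mul_extVert _ hx,
          ← mul_assoc]
        exact ih (E.r e) (listShift e f)
      · rw [← mul_assoc, ρ.listShift_mul_extVert_of_ne he, zero_mul]

/-- The action of an edge on the extended representation. -/
def extEdge (e : E.Edge) : Module.End R (List E.Edge → D) :=
  if E.s e ∈ H then blockEnd [] [] (ρ.edge e) else listCons e * ρ.extVert (E.r e)

/-- The action of a ghost edge on the extended representation. -/
def extGhost (e : E.Edge) : Module.End R (List E.Edge → D) :=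
  if E.s e ∈ H then blockEnd [] [] (ρ.ghost e) else ρ.extVert (E.r e) * listShift e

/-- A representation at a hereditary set of vertices extends to a representation at all vertices:
a vertex outside the set acts on the sum of the copies that belong to the paths from that vertex to
the set. -/
def extend (hH : ∀ e, E.s e ∈ H → E.r e ∈ H) : E.LocalRep R (List E.Edge → D) Set.univ where
  vert := ρ.extVert
  edge := ρ.extEdge
  ghost := ρ.extGhost
  vert_idem x _ := ρ.extVert_idem x
  s_edge e _ := by
    by_cases he : E.s e ∈ H
    · rw [extEdge, if_pos he, ρ.extVert_of_mem he, blockEnd_mul, ρ.s_edge e he]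
    · rw [extEdge, if_neg he]
      refine end_list_ext (fun f => ρ.extVert_nil he _) fun e' => ?_
      by_cases hee : e' = e
      · subst hee
        rw [← mul_assoc, ρ.listShift_mul_extVert he, mul_assoc, ← mul_assoc (listShift e'),
          listShift_mul_listCons, one_mul, ρ.extVert_idem]
      · rw [← mul_assoc (listShift e') (listCons e), listShift_mul_listCons_of_ne hee, zero_mul,
          ← mul_assoc]
        by_cases hs : E.s e' = E.s e
        · rw [← hs, ρ.listShift_mul_extVert (hs ▸ he), mul_assoc, ← mul_assoc (listShift e'),
            listShift_mul_listCons_of_ne hee, zero_mul, mul_zero]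
        · rw [ρ.listShift_mul_extVert_of_ne hs, zero_mul]
  edge_r e _ := by
    by_cases he : E.s e ∈ H
    · rw [extEdge, if_pos he, ρ.extVert_of_mem (hH e he), blockEnd_mul, ρ.edge_r e he]
    · rw [extEdge, if_neg he, mul_assoc, ρ.extVert_idem]
  r_ghost e _ := by
    by_cases he : E.s e ∈ H
    · rw [extGhost, if_pos he, ρ.extVert_of_mem (hH e he), blockEnd_mul, ρ.r_ghost e he]
    · rw [extGhost, if_neg he, ← mul_assoc, ρ.extVert_idem]
  ghost_s e _ := by
    by_cases he : E.s e ∈ H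
    · rw [extGhost, if_pos he, ρ.extVert_of_mem he, blockEnd_mul, ρ.ghost_s e he]
    · rw [extGhost, if_neg he, mul_assoc, ρ.listShift_mul_extVert he, ← mul_assoc,
        ρ.extVert_idem]
  ck1_self e _ := by
    by_cases he : E.s e ∈ H
    · rw [extGhost, extEdge, if_pos he, if_pos he, ρ.extVert_of_mem (hH e he), blockEnd_mul,
        ρ.ck1_self e he]
    · rw [extGhost, extEdge, if_neg he, if_neg he, mul_assoc, ← mul_assoc (listShift e),
        listShift_mul_listCons, one_mul, ρ.extVert_idem]
  ck1_ne e f _ hs hne := by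
    by_cases he : E.s e ∈ H
    · rw [extGhost, extEdge, if_pos he, if_pos (hs ▸ he), blockEnd_mul, ρ.ck1_ne e f he hs hne,
        blockEnd_zero]
    · rw [extGhost, extEdge, if_neg he, if_neg (hs ▸ he), mul_assoc, ← mul_assoc (listShift e),
        listShift_mul_listCons_of_ne hne, zero_mul, mul_zero]
  ck2 x _ hx := by
    by_cases hxH : x ∈ H
    · rw [ρ.extVert_of_mem hxH, ← ρ.ck2 x hxH hx, blockEnd_sum]
      refine Finset.sum_congr rfl fun e he => ?_
      have he : E.s e ∈ H := by rwa [show E.s e = x from hx.1.mem_toFinset.1 he]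
      rw [extEdge, extGhost, if_pos he, if_pos he, blockEnd_mul]
    · have hsum : ∑ e ∈ hx.1.toFinset, ρ.extEdge e * ρ.extGhost e =
          ∑ e ∈ hx.1.toFinset, listCons e * (ρ.extVert (E.r e) * listShift e) := by
        refine Finset.sum_congr rfl fun e he => ?_
        have he : E.s e ∉ H := by rwa [show E.s e = x from hx.1.mem_toFinset.1 he]
        rw [extEdge, extGhost, if_neg he, if_neg he, mul_assoc, ← mul_assoc (ρ.extVert _),
          ρ.extVert_idem]
      rw [hsum]
      -- Outside H, both sides vanish at the empty list. After a shift by e, only the summand of e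
      -- can survive, and it does so only if e starts at x.
      refine end_list_ext (fun f => ?_) fun e => ?_
      · rw [ρ.extVert_nil hxH, LinearMap.sum_apply, Finset.sum_apply]
        exact Finset.sum_eq_zero fun e _ => rfl
      · rw [Finset.mul_sum]
        have hz : ∀ f : E.Edge, f ≠ e →
            listShift e * (listCons f * (ρ.extVert (E.r f) * listShift f)) = 0 := fun f hf => by
          rw [← mul_assoc, listShift_mul_listCons_of_ne hf.symm, zero_mul]
        by_cases he : E.s e = x
        · rw [Finset.sum_eq_single_of_mem e (hx.1.mem_toFinset.2 he) fun f _ hf => hz f hf,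
            ← mul_assoc, listShift_mul_listCons, one_mul]
          subst he
          rw [ρ.listShift_mul_extVert hxH]
        · rw [ρ.listShift_mul_extVert_of_ne he]
          refine Finset.sum_eq_zero fun f hf => hz f ?_
          rintro rfl
          exact he (hx.1.mem_toFinset.1 hf)

end LocalRep

end Representations

/-! ### Injectivity: columns over the algebra of the corner graph. -/

namespace Subgraph.IsFiniteForest

variable {E : DiGraph.{u, v}} {T : E.Subgraph} {X : Finset E.V} (h : T.IsFiniteForest X)
  (R : Type w) [CommRing R]

variable (T) in
/-- The edge `e_u` of the corner graph, or `0` if there is no such edge. -/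
def pEdge (e : E.Edge) (u : E.V) : LeavittPathAlgebra R T.cornerGraph :=
  if hp : (e, u) ∈ T.cornerEdges then edge R (E := T.cornerGraph) ⟨(e, u), hp⟩ else 0

variable (T) in
/-- The ghost edge `e_u*` of the corner graph, or `0` if there is no such edge. -/
def pGhost (e : E.Edge) (u : E.V) : LeavittPathAlgebra R T.cornerGraph :=
  if hp : (e, u) ∈ T.cornerEdges then ghost R (E := T.cornerGraph) ⟨(e, u), hp⟩ else 0

theorem vert_mul_pEdge (x : T.cornerGraph.V) (e : E.Edge) (hx : x.1 = E.s e) (u : E.V) :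
    vert R x * pEdge T R e u = pEdge T R e u := by
  unfold pEdge
  split_ifs with hp
  · exact (vert_mul_edge (E := T.cornerGraph) x ⟨(e, u), hp⟩).trans (if_pos (Subtype.ext hx))
  · rw [mul_zero]

theorem pGhost_mul_vert (x : T.cornerGraph.V) (e : E.Edge) (hx : x.1 = E.s e) (u : E.V) :
    pGhost T R e u * vert R x = pGhost T R e u := by
  unfold pGhost
  split_ifs with hp
  · exact (ghost_mul_vert (E := T.cornerGraph) x ⟨(e, u), hp⟩).trans
      (if_pos (Subtype.ext hx.symm))
  · rw [zero_mul]

theorem pEdge_mul_vert (e : E.Edge) (u : T.cornerGraph.V) :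
    pEdge T R e u.1 * vert R u = pEdge T R e u.1 := by
  unfold pEdge
  split_ifs with hp
  · exact edge_r (E := T.cornerGraph) ⟨(e, u.1), hp⟩
  · rw [zero_mul]

theorem vert_mul_pGhost (e : E.Edge) (u : T.cornerGraph.V) :
    vert R u * pGhost T R e u.1 = pGhost T R e u.1 := by
  unfold pGhost
  split_ifs with hp
  · exact r_ghost (E := T.cornerGraph) ⟨(e, u.1), hp⟩
  · rw [mul_zero]

theorem pEdge_eq_zero {e : E.Edge} {u : E.V} (hu : ¬ T.Geq (E.r e) u) : pEdge T R e u = 0 :=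
  dif_neg fun hp => hu hp.2.2.2

theorem pGhost_eq_zero {e : E.Edge} {u : E.V} (hu : ¬ T.Geq (E.r e) u) : pGhost T R e u = 0 :=
  dif_neg fun hp => hu hp.2.2.2

theorem pGhost_mul_pEdge_of_ne {e f : E.Edge} {u u' : E.V} (hne : (e, u) ≠ (f, u')) :
    pGhost T R e u * pEdge T R f u' = 0 := by
  unfold pGhost pEdge
  split_ifs with hp hp'
  · exact ck1_ne _ _ fun hh => hne (congrArg Subtype.val hh)
  · rw [mul_zero]
  · rw [zero_mul]
  · rw [zero_mul]

theorem pGhost_mul_pEdge_self {e : E.Edge} {u : T.cornerGraph.V} (hp : (e, u.1) ∈ T.cornerEdges) :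
    pGhost T R e u.1 * pEdge T R e u.1 = vert R u := by
  rw [pGhost, pEdge, dif_pos hp, dif_pos hp]
  exact ck1_self (E := T.cornerGraph) ⟨(e, u.1), hp⟩

theorem exists_cornerGraph_vert {e : E.Edge} (he : e ∉ T.edges) (hs : E.s e ∈ T.verts) :
    ∃ v : T.cornerGraph.V, v.1 = E.s e := ⟨⟨E.s e, hs, fun h' => he (h'.2.2 rfl)⟩, rfl⟩

-- The copies of the edges emitted by x are indexed by a subset of a finite product. As x was not
-- removed, some edge it emits is outside `T`, and `exists_corner_of_mem` gives that edge a copy.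
include h in
theorem isRegular_corner (x : T.cornerGraph.V) (hx : E.IsRegular x.1) :
    T.cornerGraph.IsRegular x := by
  constructor
  · refine Set.Finite.of_finite_image (f := fun p : T.cornerGraph.Edge => p.1)
      ((hx.1.prod h.finite_verts).subset ?_) Subtype.val_injective.injOn
    rintro _ ⟨p, hp, rfl⟩
    exact ⟨congrArg Subtype.val hp, corner_edge_target_mem p⟩
  · have : ¬ E.outEdges x.1 ⊆ T.edges := fun hsub => x.2.2 ⟨x.2.1, hx.2, hsub⟩
    obtain ⟨e, he, heT⟩ := Set.not_subset.1 this
    have hs : E.s e = x.1 := he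
    have hsm : E.s e ∈ T.verts := hs ▸ x.2.1
    obtain ⟨u, hu, hru⟩ := h.exists_corner_of_mem (E.r e) (h.hereditary e hsm)
    exact ⟨⟨(e, u), hsm, heT, hu, hru⟩, Subtype.ext hs⟩

theorem sum_pEdge_mul_pGhost (x : T.cornerGraph.V) (hx : E.IsRegular x.1) :
    ∑ e ∈ hx.1.toFinset with e ∉ T.edges, ∑ u ∈ h.cornerV,
      pEdge T R e u.1 * pGhost T R e u.1 = vert R x := by
  have hx' := h.isRegular_corner x hx
  rw [← ck2 x hx', h.sum_corner_outEdges hx'.1 hx.1 fun p => edge R p * ghost R p]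
  refine Finset.sum_congr rfl fun e _ => Finset.sum_congr rfl fun u _ => ?_
  unfold pEdge pGhost
  split_ifs
  · rfl
  · rw [mul_zero]

/-- The action of a vertex `x` of `T`: the projection to the components below `x`. -/
def colVert (x : E.V) : Module.End R (T.cornerGraph.V → LeavittPathAlgebra R T.cornerGraph) :=
  LinearMap.pi fun u =>
    if T.Geq x u.1 then LinearMap.mulLeft R (vert R u) ∘ₗ LinearMap.proj u else 0

/-- The action of an edge emitted by a vertex of `T`. -/
def colEdge (e : E.Edge) : Module.End R (T.cornerGraph.V → LeavittPathAlgebra R T.cornerGraph) :=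
  if e ∈ T.edges then colVert R (E.r e) else LinearMap.pi fun u =>
    if u.1 = E.s e then
      ∑ u' ∈ h.cornerV, LinearMap.mulLeft R (pEdge T R e u'.1) ∘ₗ LinearMap.proj u'
    else 0

/-- The action of a ghost edge that ends at a vertex of `T`. -/
def colGhost (e : E.Edge) : Module.End R (T.cornerGraph.V → LeavittPathAlgebra R T.cornerGraph) :=
  if e ∈ T.edges then colVert R (E.r e) else if hs : E.s e ∈ T.cornerVerts then
    LinearMap.pi fun u =>
      LinearMap.mulLeft R (pGhost T R e u.1) ∘ₗ LinearMap.proj (R := R) (⟨E.s e, hs⟩ : T.cornerGraph.V)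
    else 0

variable (f : T.cornerGraph.V → LeavittPathAlgebra R T.cornerGraph) (u : T.cornerGraph.V)

theorem colVert_apply (x : E.V) :
    colVert R x f u = if T.Geq x u.1 then vert R u * f u else 0 := by
  unfold colVert
  rw [LinearMap.pi_apply]
  split_ifs <;> rfl

theorem colEdge_of_mem {e : E.Edge} (he : e ∈ T.edges) : h.colEdge R e = colVert R (E.r e) :=
  if_pos he

theorem colGhost_of_mem {e : E.Edge} (he : e ∈ T.edges) : colGhost R e = colVert R (T := T) (E.r e) :=
  if_pos he

theorem colEdge_apply {e : E.Edge} (he : e ∉ T.edges) : h.colEdge R e f u =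
    if u.1 = E.s e then ∑ u' ∈ h.cornerV, pEdge T R e u'.1 * f u' else 0 := by
  rw [colEdge, if_neg he, LinearMap.pi_apply]
  split_ifs
  · rw [LinearMap.sum_apply]
    rfl
  · rfl

theorem colGhost_apply {e : E.Edge} (he : e ∉ T.edges) (x : T.cornerGraph.V) (hx : x.1 = E.s e) :
    colGhost R e f u = pGhost T R e u.1 * f x := by
  have hs : E.s e ∈ T.cornerVerts := hx ▸ x.2
  rw [colGhost, if_neg he, dif_pos hs]
  have : x = ⟨E.s e, hs⟩ := Subtype.ext hx
  rw [this]
  rfl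

theorem colVert_mul_colVert {x y : E.V} (hxy : T.Geq x y) :
    colVert R x * colVert R (T := T) y = colVert R y := by
  refine LinearMap.ext fun f => funext fun u => ?_
  rw [Module.End.mul_apply, colVert_apply, colVert_apply]
  by_cases h2 : T.Geq y u.1
  · rw [if_pos h2, if_pos (hxy.trans h2), ← mul_assoc, vert_idem]
  · rw [if_neg h2, mul_zero, ite_self]

theorem colVert_mul_colVert' {x y : E.V} (hxy : T.Geq x y) :
    colVert R y * colVert R (T := T) x = colVert R y := by
  refine LinearMap.ext fun f => funext fun u => ?_
  rw [Module.End.mul_apply, colVert_apply, colVert_apply, colVert_apply]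
  by_cases h2 : T.Geq y u.1
  · rw [if_pos h2, if_pos (hxy.trans h2), if_pos h2, ← mul_assoc, vert_idem]
  · rw [if_neg h2, if_neg h2]

/-- The representation of `E`, at the vertices of `T`, on the columns over the Leavitt path algebra
of the corner graph. -/
def columnRep :
    E.LocalRep R (T.cornerGraph.V → LeavittPathAlgebra R T.cornerGraph) T.verts where
  vert := colVert R
  edge := h.colEdge R
  ghost := colGhost R
  vert_idem x hx := colVert_mul_colVert R (.refl hx)
  s_edge e hs := by
    by_cases he : e ∈ T.edges
    · rw [h.colEdge_of_mem R he, colVert_mul_colVert R (.of_edge he)]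
    · refine LinearMap.ext fun f => funext fun u => ?_
      rw [Module.End.mul_apply, colVert_apply, h.colEdge_apply R f u he]
      by_cases hu : u.1 = E.s e
      · rw [if_pos hu, if_pos (hu.symm ▸ .refl hs), Finset.mul_sum]
        refine Finset.sum_congr rfl fun u' _ => ?_
        rw [← mul_assoc, vert_mul_pEdge R u e hu]
      · rw [if_neg hu, mul_zero, ite_self]
  edge_r e hs := by
    by_cases he : e ∈ T.edges
    · rw [h.colEdge_of_mem R he, colVert_mul_colVert R (.refl (T.r_mem e he))]
    · refine LinearMap.ext fun f => funext fun u => ?_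
      rw [Module.End.mul_apply, h.colEdge_apply R _ u he, h.colEdge_apply R _ u he]
      split_ifs
      · refine Finset.sum_congr rfl fun u' _ => ?_
        rw [colVert_apply]
        split_ifs with hge
        · rw [← mul_assoc, pEdge_mul_vert]
        · rw [pEdge_eq_zero R hge, zero_mul, zero_mul]
      · rfl
  r_ghost e hs := by
    by_cases he : e ∈ T.edges
    · rw [colGhost_of_mem R he, colVert_mul_colVert R (.refl (T.r_mem e he))]
    · obtain ⟨v, hv⟩ := exists_cornerGraph_vert he hs
      refine LinearMap.ext fun f => funext fun u => ?_
      rw [Module.End.mul_apply, colVert_apply,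
        colGhost_apply R _ u he v hv]
      split_ifs with hge
      · rw [← mul_assoc, vert_mul_pGhost]
      · rw [pGhost_eq_zero R hge, zero_mul]
  ghost_s e hs := by
    by_cases he : e ∈ T.edges
    · rw [colGhost_of_mem R he, colVert_mul_colVert' R (.of_edge he)]
    · obtain ⟨v, hv⟩ := exists_cornerGraph_vert he hs
      refine LinearMap.ext fun f => funext fun u => ?_
      rw [Module.End.mul_apply, colGhost_apply R _ u he v hv,
        colGhost_apply R _ u he v hv, colVert_apply,
        if_pos (hv.symm ▸ .refl hs), ← mul_assoc]
      congr 1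
      exact pGhost_mul_vert R (T := T) v e hv u.1
  ck1_self e hs := by
    by_cases he : e ∈ T.edges
    · rw [colGhost_of_mem R he, colEdge_of_mem h R he,
        colVert_mul_colVert R (.refl (T.r_mem e he))]
    · obtain ⟨v, hv⟩ := exists_cornerGraph_vert he hs
      refine LinearMap.ext fun f => funext fun u => ?_
      rw [Module.End.mul_apply, colGhost_apply R _ u he v hv,
        h.colEdge_apply R _ _ he, if_pos hv, Finset.mul_sum, colVert_apply,
        Finset.sum_eq_single_of_mem u (h.mem_cornerV u), ← mul_assoc]
      · split_ifs with hge
        · rw [pGhost_mul_pEdge_self R ⟨hs, he, u.2, hge⟩]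
        · rw [pGhost_eq_zero R hge, zero_mul, zero_mul]
      · intro u' _ hne
        rw [← mul_assoc, pGhost_mul_pEdge_of_ne, zero_mul]
        exact fun heq => hne (Subtype.ext (congrArg Prod.snd heq).symm)
  ck1_ne e e' hs hss hne := by
    have hs' : E.s e' ∈ T.verts := hss ▸ hs
    refine LinearMap.ext fun f => funext fun u => ?_
    rw [Module.End.mul_apply, LinearMap.zero_apply, Pi.zero_apply]
    -- For two edges of `T`, no component lies below both ranges. If exactly one of them is in `T`,
    -- the other reads or writes only the component of the common source, which is not below the
    -- range of the first. If both lie outside `T`, the copies are orthogonal in E(T).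
    by_cases he : e ∈ T.edges
    · rw [colGhost_of_mem R he, colVert_apply]
      split_ifs with hge
      · by_cases he' : e' ∈ T.edges
        · rw [colEdge_of_mem h R he', colVert_apply, if_neg, mul_zero]
          exact fun hge' => hne (h.branch e he e' he' hss u.1 hge hge')
        · rw [h.colEdge_apply R _ _ he', if_neg, mul_zero]
          intro hu
          rw [hu, ← hss] at hge
          exact h.not_geq e he hge
      · rfl
    · obtain ⟨v, hv⟩ := exists_cornerGraph_vert he hs
      rw [colGhost_apply R _ u he v hv]
      by_cases he' : e' ∈ T.edges
      · rw [colEdge_of_mem h R he', colVert_apply, if_neg, mul_zero]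
        rw [hv, hss]
        exact h.not_geq e' he'
      · rw [h.colEdge_apply R _ _ he', if_pos (hv.trans hss), Finset.mul_sum]
        refine Finset.sum_eq_zero fun u' _ => ?_
        rw [← mul_assoc, pGhost_mul_pEdge_of_ne, zero_mul]
        exact fun heq => hne (congrArg Prod.fst heq)
  ck2 x hxT hx := by
    refine LinearMap.ext fun f => funext fun u => ?_
    rw [← Finset.sum_filter_add_sum_filter_not hx.1.toFinset (· ∈ T.edges), LinearMap.add_apply,
      Pi.add_apply, LinearMap.sum_apply, LinearMap.sum_apply, Finset.sum_apply, Finset.sum_apply,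
      colVert_apply]
    have h1 : ∀ e ∈ hx.1.toFinset.filter (· ∈ T.edges), (h.colEdge R e * colGhost R e : Module.End R _) f u =
        if T.Geq (E.r e) u.1 then vert R u * f u else 0 := by
      intro e he
      have he := (Finset.mem_filter.1 he).2
      rw [colGhost_of_mem R he, colEdge_of_mem h R he,
        colVert_mul_colVert R (.refl (T.r_mem e he)), colVert_apply]
    have h2 : ∀ e ∈ hx.1.toFinset.filter (· ∉ T.edges), (h.colEdge R e * colGhost R e : Module.End R _) f u =
        if u.1 = x then (∑ u' ∈ h.cornerV, pEdge T R e u'.1 * pGhost T R e u'.1) * f u else 0 := by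
      intro e he
      rw [Finset.mem_filter, Set.Finite.mem_toFinset] at he
      have hs : E.s e = x := he.1
      rw [Module.End.mul_apply, h.colEdge_apply R _ _ he.2, hs]
      split_ifs with hu
      · rw [Finset.sum_mul]
        refine Finset.sum_congr rfl fun u' _ => ?_
        rw [colGhost_apply R _ u' he.2 u (hu.trans hs.symm), mul_assoc]
      · rfl
    rw [Finset.sum_congr rfl h1, Finset.sum_congr rfl h2]
    -- The component u = x is produced by the edges outside `T`, through the second relation in
    -- E(T). A component u ≠ x below x is produced by the one edge of `T` that leads from x towards
    -- u.
    by_cases hu : u.1 = x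
    · subst hu
      simp only [if_true]
      rw [if_pos (.refl hxT), ← Finset.sum_mul, h.sum_pEdge_mul_pGhost R u hx,
        Finset.sum_eq_zero, zero_add]
      intro e he
      rw [Finset.mem_filter, Set.Finite.mem_toFinset] at he
      refine if_neg fun hge => h.not_geq e he.2 ?_
      rw [show E.s e = u.1 from he.1]
      exact hge
    · simp only [if_neg hu, Finset.sum_const_zero, add_zero]
      split_ifs with hge
      · obtain ⟨e, he, hs, hru⟩ := hge.eq_or_edge.resolve_left (Ne.symm hu)
        rw [Finset.sum_eq_single_of_mem e
          (Finset.mem_filter.2 ⟨hx.1.mem_toFinset.2 hs, he⟩), if_pos hru]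
        intro e' he' hne
        rw [Finset.mem_filter, Set.Finite.mem_toFinset] at he'
        have hs' : E.s e' = x := he'.1
        exact if_neg fun hge' => hne (h.branch e' he'.2 e he (hs'.trans hs.symm) u.1 hge' hru)
      · refine Finset.sum_eq_zero fun e he => if_neg fun hge' => hge ?_
        rw [Finset.mem_filter, Set.Finite.mem_toFinset] at he
        have := hge'.head he.2
        rwa [show E.s e = x from he.1] at this

end Subgraph.IsFiniteForest

namespace LeavittPathAlgebra

variable {R : Type w} [CommRing R] {E : DiGraph.{u, v}}

/-- For a graph with finitely many vertices, the sum of the vertices is a unit. -/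
theorem sum_vert_mul (V : Finset E.V) (hV : ∀ x, x ∈ V) (a : LeavittPathAlgebra R E) :
    (∑ x ∈ V, vert R x) * a = a ∧ a * (∑ x ∈ V, vert R x) = a := by
  have hl : ∀ x (b : LeavittPathAlgebra R E), vert R x * b = b → (∑ x ∈ V, vert R x) * b = b := by
    intro x b hb
    rw [Finset.sum_mul, Finset.sum_eq_single_of_mem x (hV x), hb]
    intro y _ hy
    rw [← hb, mul_mul_of_mul_eq (vert_orth y x hy), zero_mul]
  have hr : ∀ x (b : LeavittPathAlgebra R E), b * vert R x = b → b * (∑ x ∈ V, vert R x) = b := by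
    intro x b hb
    rw [Finset.mul_sum, Finset.sum_eq_single_of_mem x (hV x), hb]
    intro y _ hy
    rw [← hb, mul_assoc, vert_orth x y hy.symm, mul_zero]
  let S : NonUnitalSubalgebra R (LeavittPathAlgebra R E) :=
    { carrier := {a | (∑ x ∈ V, vert R x) * a = a ∧ a * (∑ x ∈ V, vert R x) = a}
      add_mem' := fun {a b} ha hb => ⟨by rw [mul_add, ha.1, hb.1], by rw [add_mul, ha.2, hb.2]⟩
      zero_mem' := ⟨mul_zero _, zero_mul _⟩
      mul_mem' := fun {a b} ha hb =>
        ⟨by rw [← mul_assoc, ha.1], by rw [mul_assoc, hb.2]⟩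
      smul_mem' := fun t a ha =>
        ⟨by rw [mul_smul_comm, ha.1], by rw [smul_mul_assoc, ha.2]⟩ }
  exact mem_of_generators S (fun x => ⟨hl x _ (vert_idem x), hr x _ (vert_idem x)⟩)
    (fun e => ⟨hl _ _ (s_edge e), hr _ _ (edge_r e)⟩)
    (fun e => ⟨hl _ _ (r_ghost e), hr _ _ (ghost_s e)⟩) a

end LeavittPathAlgebra

/-! ### Injectivity: recovering left multiplication. -/

namespace Subgraph.IsFiniteForest

variable {E : DiGraph.{u, v}} {T : E.Subgraph} {X : Finset E.V} (h : T.IsFiniteForest X)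
  (R : Type w) [CommRing R]

/-- The representation of `L_R(E)` that extends the representation on columns. -/
def rep : LeavittPathAlgebra R E →ₙₐ[R] Module.End R
    (E.V → List E.Edge → T.cornerGraph.V → LeavittPathAlgebra R T.cornerGraph) :=
  ((h.columnRep R).extend h.hereditary).family.lift R

variable (u : T.cornerGraph.V) (c : LeavittPathAlgebra R T.cornerGraph)

variable {R} in
/-- The column with a single entry. -/
def col : T.cornerGraph.V → LeavittPathAlgebra R T.cornerGraph := Pi.single u (vert R u * c)

variable {R} in
/-- The vector in the component of `x` that is given by a column with a single entry. -/
def vec (x : E.V) :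
    E.V → List E.Edge → T.cornerGraph.V → LeavittPathAlgebra R T.cornerGraph :=
  single₂ x [] (col u c)

theorem vec_zero (x : E.V) : vec u (0 : LeavittPathAlgebra R T.cornerGraph) x = 0 := by
  rw [vec, col, mul_zero, Pi.single_zero, single₂_zero]

theorem colVert_col (x : E.V) : colVert R x (col u c) = if T.Geq x u.1 then col u c else 0 := by
  refine funext fun u' => ?_
  rw [colVert_apply]
  by_cases hu : u' = u
  · subst hu
    split_ifs
    · rw [col, Pi.single_eq_same, ← mul_assoc, vert_idem]
    · rfl
  · rw [col, Pi.single_eq_of_ne hu, mul_zero, ite_self]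
    split_ifs
    · rw [Pi.single_eq_of_ne hu]
    · rfl

theorem colEdge_col {e : E.Edge} (he : e ∉ T.edges) (x : T.cornerGraph.V) (hx : x.1 = E.s e) :
    h.colEdge R e (col u c) = col x (pEdge T R e u.1 * c) := by
  refine funext fun u' => ?_
  rw [h.colEdge_apply R _ _ he, Finset.sum_eq_single_of_mem u (h.mem_cornerV u)]
  · by_cases hu : u' = x
    · rw [hu, if_pos hx, col, col, Pi.single_eq_same, Pi.single_eq_same, ← mul_assoc,
        pEdge_mul_vert, ← mul_assoc, vert_mul_pEdge R x e hx]
    · rw [if_neg fun h' => hu (Subtype.ext (h'.trans hx.symm)), col, Pi.single_eq_of_ne hu]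
  · intro u'' _ hne
    rw [col, Pi.single_eq_of_ne hne, mul_zero]

theorem colGhost_col {e : E.Edge} (he : e ∉ T.edges) (x : T.cornerGraph.V) (hx : x.1 = E.s e) :
    colGhost R e (col x c) = ∑ u ∈ h.cornerV, col u (pGhost T R e u.1 * c) := by
  refine funext fun u' => ?_
  rw [colGhost_apply R _ _ he x hx, Finset.sum_apply,
    Finset.sum_eq_single_of_mem u' (h.mem_cornerV u')]
  · rw [col, col, Pi.single_eq_same, Pi.single_eq_same, ← mul_assoc, ← mul_assoc,
      pGhost_mul_vert R x e hx, vert_mul_pGhost]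
  · intro u _ hne
    rw [col, Pi.single_eq_of_ne hne.symm]

theorem rep_vert_vec {x : E.V} (hx : x ∈ T.verts) (hxu : T.Geq x u.1) :
    h.rep R (vert R x) (vec u c x) = vec u c x := by
  rw [rep, LeavittFamily.lift_vert]
  change blockEnd x x ((h.columnRep R).extVert x) _ = _
  rw [LocalRep.extVert_of_mem _ hx, vec, blockEnd_single₂]
  change single₂ x [] (colVert R x (col u c)) = _
  rw [colVert_col, if_pos hxu]

theorem rep_vert_vec_of_ne {x y : E.V} (hxy : x ≠ y) :
    h.rep R (vert R x) (vec u c y) = 0 := by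
  rw [rep, LeavittFamily.lift_vert]
  exact blockEnd_single₂_of_ne hxy _ _ _

theorem rep_edge_vec {e : E.Edge} (hs : E.s e ∈ T.verts) :
    h.rep R (edge R e) (vec u c (E.r e)) =
      single₂ (E.s e) [] (h.colEdge R e (col u c)) := by
  rw [rep, LeavittFamily.lift_edge]
  change blockEnd _ _ ((h.columnRep R).extEdge e) _ = _
  rw [LocalRep.extEdge, if_pos hs, vec, blockEnd_single₂]
  rfl

theorem rep_ghost_vec {e : E.Edge} (hs : E.s e ∈ T.verts) :
    h.rep R (ghost R e) (vec u c (E.s e)) =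
      single₂ (E.r e) [] (colGhost R e (col u c)) := by
  rw [rep, LeavittFamily.lift_ghost]
  change blockEnd _ _ ((h.columnRep R).extGhost e) _ = _
  rw [LocalRep.extGhost, if_pos hs, vec, blockEnd_single₂]
  rfl

/-- Edges of `T` only move a column to the component of another vertex; the edges outside `T` change
its entry. -/
theorem rep_edge_vec_of_mem {e : E.Edge} (he : e ∈ T.edges) (hu : T.Geq (E.r e) u.1) :
    h.rep R (edge R e) (vec u c (E.r e)) = vec u c (E.s e) := by
  rw [h.rep_edge_vec R u c (T.s_mem e he), h.colEdge_of_mem R he, colVert_col, if_pos hu, vec]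

theorem rep_edge_vec_of_notMem {e : E.Edge} (he : e ∉ T.edges) (x : T.cornerGraph.V)
    (hx : x.1 = E.s e) :
    h.rep R (edge R e) (vec u c (E.r e)) = vec x (pEdge T R e u.1 * c) (E.s e) := by
  rw [h.rep_edge_vec R u c (hx ▸ x.2.1), h.colEdge_col R u c he x hx, vec]

theorem rep_ghost_vec_of_mem {e : E.Edge} (he : e ∈ T.edges) :
    h.rep R (ghost R e) (vec u c (E.s e)) = if T.Geq (E.r e) u.1 then vec u c (E.r e) else 0 := by
  rw [h.rep_ghost_vec R u c (T.s_mem e he), colGhost_of_mem R he, colVert_col]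
  split_ifs
  · rw [vec]
  · exact single₂_zero _ _

theorem rep_ghost_vec_of_notMem {e : E.Edge} (he : e ∉ T.edges) (x : T.cornerGraph.V)
    (hx : x.1 = E.s e) :
    h.rep R (ghost R e) (vec x c (E.s e)) =
      ∑ u ∈ h.cornerV, vec u (pGhost T R e u.1 * c) (E.r e) := by
  rw [h.rep_ghost_vec R x c (hx ▸ x.2.1), h.colGhost_col R c he x hx]
  exact single₂_sum _ _ _ _

/-- If u lies strictly below x, the edge of `T` towards u has e e* fixing the vector, so q(x) kills
it. If u = x, no edge of `T` from x leads to u, and nothing is subtracted. -/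
theorem rep_q_vec {x : E.V} (hxu : T.Geq x u.1) :
    h.rep R (h.q R x) (vec u c x) = if x = u.1 then vec u c x else 0 := by
  have hx := hxu.left_mem
  have key : ∀ e ∈ h.outT x, h.rep R (edge R e * ghost R e) (vec u c x) =
      if T.Geq (E.r e) u.1 then vec u c x else 0 := by
    intro e he
    obtain ⟨heT, rfl⟩ := h.mem_outT.1 he
    rw [map_mul, Module.End.mul_apply, h.rep_ghost_vec_of_mem R u c heT]
    split_ifs with hge
    · exact h.rep_edge_vec_of_mem R u c heT hge
    · exact map_zero _
  rw [q, map_sub, map_sum, LinearMap.sub_apply, LinearMap.sum_apply, Finset.sum_congr rfl key,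
    h.rep_vert_vec R u c hx hxu]
  split_ifs with hxu'
  · rw [Finset.sum_eq_zero, sub_zero]
    intro e he
    refine if_neg fun hge => h.not_geq_of_mem he ?_
    rwa [hxu']
  · obtain ⟨e, he, hs, hru⟩ := hxu.eq_or_edge.resolve_left hxu'
    have he' := h.mem_outT.2 ⟨he, hs⟩
    rw [Finset.sum_eq_single_of_mem e he', if_pos hru, sub_self]
    exact fun f hf hfe => if_neg fun h' => hfe (h.branch_of_mem hf he' h' hru)

theorem rep_down_vec {x : E.V} (hxu : T.Geq x u.1) :
    h.rep R (h.down R x u.1) (vec u c u.1) = vec u c x := by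
  induction x using h.outT_induction with
  | step x ih =>
    by_cases hx : x = u.1
    · rw [hx, down_self, h.rep_q_vec R u c (.refl u.2.1), if_pos rfl]
    · obtain ⟨e, he, rfl, hru⟩ := hxu.eq_or_edge.resolve_left hx
      rw [h.down_of_edge R he hru, map_mul, Module.End.mul_apply,
        ih e (h.mem_outT.2 ⟨he, rfl⟩) hru, h.rep_edge_vec_of_mem R u c he hru]

/-- Descends with the vector along the path of `T` to u; ghosts of edges that do not lead to u kill
it, and q at the end of the descent singles out u' = u. -/
theorem rep_up_vec {x : E.V} (hxu : T.Geq x u.1) (u' : T.cornerGraph.V) :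
    h.rep R (h.up R u'.1 x) (vec u c x) = if u' = u then vec u c u.1 else 0 := by
  induction x using h.outT_induction with
  | step x ih =>
    have key : ∀ e ∈ h.outT x, h.rep R (h.up R u'.1 (E.r e) * ghost R e) (vec u c x) =
        if T.Geq (E.r e) u.1 then (if u' = u then vec u c u.1 else 0) else 0 := by
      intro e he
      obtain ⟨heT, rfl⟩ := h.mem_outT.1 he
      rw [map_mul, Module.End.mul_apply, h.rep_ghost_vec_of_mem R u c heT]
      by_cases hge : T.Geq (E.r e) u.1
      · rw [if_pos hge, if_pos hge, ih e he hge]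
      · rw [if_neg hge, if_neg hge, map_zero]
    rw [up_eq, map_add, map_sum, LinearMap.add_apply, LinearMap.sum_apply,
      Finset.sum_congr rfl key]
    by_cases hx : x = u.1
    · rw [Finset.sum_eq_zero, add_zero]
      · by_cases hu : u' = u
        · rw [if_pos hu, if_pos (hx.trans (congrArg Subtype.val hu.symm)), h.rep_q_vec R u c hxu,
            if_pos hx, hx]
        · rw [if_neg hu, if_neg fun h' => hu (Subtype.ext (h'.symm.trans hx)), map_zero]
          rfl
      · intro e he
        refine if_neg fun hge => h.not_geq_of_mem he ?_
        rwa [hx]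
    · obtain ⟨e, he, hs, hru⟩ := hxu.eq_or_edge.resolve_left hx
      have he' := h.mem_outT.2 ⟨he, hs⟩
      rw [Finset.sum_eq_single_of_mem e he', if_pos hru]
      · have h0 : h.rep R (if x = u'.1 then h.q R x else 0) (vec u c x) = 0 := by
          split_ifs
          · rw [h.rep_q_vec R u c hxu, if_neg hx]
          · rw [map_zero, LinearMap.zero_apply]
        rw [h0, zero_add]
      · exact fun f hf hfe => if_neg fun h' => hfe (h.branch_of_mem hf he' h' hru)

/-- The root above a vertex of the corner graph. -/
def root : E.V := (h.exists_root u.1 u.2.1).choose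

theorem root_mem_X : h.root u ∈ X := (h.exists_root u.1 u.2.1).choose_spec.1

theorem root_geq : T.Geq (h.root u) u.1 := (h.exists_root u.1 u.2.1).choose_spec.2

/-- The embedding of the Leavitt path algebra of the corner graph into the representation. -/
def embed : E.V → List E.Edge → T.cornerGraph.V → LeavittPathAlgebra R T.cornerGraph :=
  ∑ u ∈ h.cornerV, vec u c (h.root u)

theorem embed_of_vert_mul (hc : vert R u * c = c) : h.embed R c = vec u c (h.root u) := by
  refine Finset.sum_eq_single_of_mem u (h.mem_cornerV u) fun u' _ hne => ?_
  rw [← hc, vec, col, ← mul_assoc, vert_orth _ _ hne, zero_mul, Pi.single_zero, single₂_zero]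

theorem rep_rootUp_embed : h.rep R (h.rootUp R u.1) (h.embed R c) = vec u c u.1 := by
  rw [embed, map_sum, h.rootUp_eq R (h.root_mem_X u) (h.root_geq u),
    Finset.sum_eq_single_of_mem u (h.mem_cornerV u), h.rep_up_vec R u c (h.root_geq u), if_pos rfl]
  intro u' _ hne
  by_cases hr : h.root u = h.root u'
  · rw [hr, h.rep_up_vec R u' c (h.root_geq u'), if_neg hne.symm]
  · rw [← up_mul_vert, map_mul, Module.End.mul_apply, h.rep_vert_vec_of_ne R u' c hr, map_zero]

theorem rep_rootDown_vec (hc : vert R u * c = c) :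
    h.rep R (h.rootDown R u.1) (vec u c u.1) = h.embed R c := by
  rw [h.rootDown_eq R (h.root_mem_X u) (h.root_geq u), h.rep_down_vec R u c (h.root_geq u),
    h.embed_of_vert_mul R u c hc]

theorem vec_vert_mul (x : E.V) : vec u (vert R u * c) x = vec u c x := by
  rw [vec, vec, col, col, ← mul_assoc, vert_idem]

/-- It suffices to test generators a. There `rootUp` brings one column from its root down to the
component of its vertex, the middle factor multiplies its entry by the generator of E(T), and
`rootDown` returns it to the root. -/
theorem rep_cornerHom_embed (a : LeavittPathAlgebra R T.cornerGraph)
    (c : LeavittPathAlgebra R T.cornerGraph) :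
    h.rep R (h.cornerHom R a) (h.embed R c) = h.embed R (a * c) := by
  have hadd : ∀ c c', h.embed R (c + c') = h.embed R c + h.embed R c' := by
    intro c c'
    simp only [embed, vec, single₂, col, mul_add, Pi.single_add, Finset.sum_add_distrib]
  have hsmul : ∀ (t : R) c, h.embed R (t • c) = t • h.embed R c := by
    intro t c
    simp only [embed, vec, single₂, col, mul_smul_comm, Pi.single_smul, Finset.smul_sum]
  let S : NonUnitalSubalgebra R (LeavittPathAlgebra R T.cornerGraph) :=
    { carrier := {a | ∀ c, h.rep R (h.cornerHom R a) (h.embed R c) = h.embed R (a * c)}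
      add_mem' := fun {a b} ha hb c => by
        rw [map_add, map_add, LinearMap.add_apply, ha, hb, add_mul, hadd]
      zero_mem' := fun c => by
        have := hsmul 0 0
        rw [zero_smul, zero_smul] at this
        rw [map_zero, map_zero, LinearMap.zero_apply, zero_mul, this]
      mul_mem' := fun {a b} ha hb c => by
        rw [map_mul, map_mul, Module.End.mul_apply, hb, ha, mul_assoc]
      smul_mem' := fun t a ha c => by
        rw [map_smul, map_smul, LinearMap.smul_apply, ha, smul_mul_assoc, hsmul] }
  refine mem_of_generators S (fun x c => ?_) (fun p c => ?_) (fun p c => ?_) a c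
  · rw [cornerHom_vert, cVert, map_mul, Module.End.mul_apply, h.rep_rootUp_embed R x c,
      ← vec_vert_mul, h.rep_rootDown_vec R x]
    rw [← mul_assoc, vert_idem]
  · have hpe : pEdge T R p.1.1 p.1.2 = edge R p := dif_pos p.2
    rw [cornerHom_edge, cEdge, map_mul, map_mul, map_mul, Module.End.mul_apply,
      Module.End.mul_apply, Module.End.mul_apply]
    have h1 := h.rep_rootUp_embed R (T.cornerGraph.r p) c
    have h2 := h.rep_down_vec R (T.cornerGraph.r p) c (corner_edge_geq p)
    have h3 := h.rep_edge_vec_of_notMem R (T.cornerGraph.r p) c (corner_edge_notMem p)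
      (T.cornerGraph.s p) rfl
    have h4 := h.rep_rootDown_vec R (T.cornerGraph.s p) (edge R p * c)
      (by rw [← mul_assoc, s_edge])
    change h.rep R (h.rootUp R p.1.2) (h.embed R c) = _ at h1
    change h.rep R (h.down R _ p.1.2) _ = _ at h2
    change _ = vec _ (pEdge T R p.1.1 p.1.2 * c) _ at h3
    rw [hpe] at h3
    rw [h1, h2, h3]
    exact h4
  · have hpe : pGhost T R p.1.1 p.1.2 = ghost R p := dif_pos p.2
    rw [cornerHom_ghost, cGhost, map_mul, map_mul, map_mul, Module.End.mul_apply,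
      Module.End.mul_apply, Module.End.mul_apply]
    have h1 := h.rep_rootUp_embed R (T.cornerGraph.s p) c
    have h2 := h.rep_ghost_vec_of_notMem R c (corner_edge_notMem p) (T.cornerGraph.s p) rfl
    have h4 := h.rep_rootDown_vec R (T.cornerGraph.r p) (ghost R p * c)
      (by rw [← mul_assoc, r_ghost])
    have h3 : h.rep R (h.up R p.1.2 (E.r p.1.1))
        (∑ u ∈ h.cornerV, vec u (pGhost T R p.1.1 u.1 * c) (E.r p.1.1)) =
        vec (T.cornerGraph.r p) (ghost R p * c) p.1.2 := by
      rw [map_sum, Finset.sum_eq_single_of_mem (T.cornerGraph.r p) (h.mem_cornerV _)]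
      · have := h.rep_up_vec R (T.cornerGraph.r p) (pGhost T R p.1.1 p.1.2 * c)
          (corner_edge_geq p) (T.cornerGraph.r p)
        rw [if_pos rfl, hpe] at this
        rw [← hpe] at this ⊢
        exact this
      · intro u _ hne
        by_cases hge : T.Geq (E.r p.1.1) u.1
        · have := h.rep_up_vec R u (pGhost T R p.1.1 u.1 * c) hge (T.cornerGraph.r p)
          rw [if_neg hne.symm] at this
          exact this
        · rw [pGhost_eq_zero R hge, zero_mul, vec_zero, map_zero]
    change h.rep R (h.rootUp R (E.s p.1.1)) (h.embed R c) = _ at h1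
    rw [h1]
    change h.rep R (ghost R p.1.1) (vec (T.cornerGraph.s p) c (T.cornerGraph.s p).1) = _ at h2
    rw [h2, h3]
    exact h4

/-- The sum of the vertices is a unit of L_R(E(T)). Applying a in the kernel to it shows that a is
embedded as 0, while the entry at the root above u, the empty list and u is u * a; and these sum to
a. -/
theorem cornerHom_injective : Function.Injective (h.cornerHom R) := by
  rw [injective_iff_map_eq_zero]
  intro a ha
  have h0 : h.embed R a = 0 := by
    have := h.rep_cornerHom_embed R a (∑ x ∈ h.cornerV, vert R x)
    rw [ha, map_zero, LinearMap.zero_apply, (sum_vert_mul _ h.mem_cornerV a).2] at this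
    exact this.symm
  rw [← (sum_vert_mul _ h.mem_cornerV a).1, Finset.sum_mul]
  refine Finset.sum_eq_zero fun u _ => ?_
  have hu : h.embed R a (h.root u) [] u = vert R u * a := by
    rw [embed, Finset.sum_apply, Finset.sum_apply, Finset.sum_apply,
      Finset.sum_eq_single_of_mem u (h.mem_cornerV u)]
    · rw [vec, single₂_same, col, Pi.single_eq_same]
    · intro u' _ hne
      rw [vec, col]
      by_cases hr : h.root u = h.root u'
      · rw [hr, single₂_same, Pi.single_eq_of_ne hne.symm]
      · rw [single₂_of_ne hr]
        rfl
  rw [← hu, h0]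
  rfl

include h in
theorem algIso_corner : AlgIso R (LeavittPathAlgebra R T.cornerGraph)
    (cornerSubalgebra R (vertSum R X)) := by
  refine ⟨NonUnitalAlgHom.codRestrict (h.cornerHom R) _ (h.cornerHom_mem R), ?_, ?_⟩
  · intro a b hab
    exact h.cornerHom_injective R (congrArg Subtype.val hab)
  · intro b
    obtain ⟨a, ha⟩ := h.mem_range_of_mem_corner R b.2
    exact ⟨a, Subtype.ext ha⟩

end Subgraph.IsFiniteForest

/-! ### Finite graphs and their isomorphisms. -/

section FiniteSums

theorem sum_outEdges {E : DiGraph.{u, v}} [Fintype E.Edge] {M : Type*} [AddCommMonoid M] {x : E.V}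
    (h : (E.outEdges x).Finite) (F : E.Edge → M) :
    ∑ e ∈ h.toFinset, F e = ∑ e, if E.s e = x then F e else 0 := by
  rw [← Finset.sum_filter]
  refine Finset.sum_congr ?_ fun _ _ => rfl
  ext e
  simp [outEdges]

theorem sum_subtype_eq_sum_dite {α M : Type*} [Fintype α] [AddCommMonoid M] {p : α → Prop}
    [Fintype {a // p a}] (F : {a // p a} → M) :
    ∑ a, F a = ∑ a, if h : p a then F ⟨a, h⟩ else 0 := by
  refine Finset.sum_of_injOn Subtype.val Subtype.val_injective.injOn (by simp) ?_ ?_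
  · intro a _ ha
    exact dif_neg fun h => ha ⟨⟨a, h⟩, by simp, rfl⟩
  · intro a _
    exact (dif_pos (c := p a.1) (t := fun h => F ⟨a.1, h⟩) a.2).symm

theorem LeavittPathAlgebra.sum_edge_mul_ghost {R : Type w} [CommRing R] {E : DiGraph.{u, v}}
    [Fintype E.Edge] {x : E.V} (hx : ∃ e, E.s e = x) :
    ∑ e, (if E.s e = x then edge R e * ghost R e else 0) = vert R x := by
  have hx' : E.IsRegular x := ⟨Set.toFinite _, hx⟩
  rw [← ck2 x hx', sum_outEdges]

end FiniteSums

section GraphIso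

/-- Isomorphic finite graphs have isomorphic Leavitt path algebras. -/
theorem algIso_of_equiv (R : Type w) [CommRing R] {E : DiGraph.{u, v}} {E' : DiGraph.{u', v'}}
    (φ : E.V ≃ E'.V) (ψ : E.Edge ≃ E'.Edge) (hs : ∀ e, E'.s (ψ e) = φ (E.s e))
    (hr : ∀ e, E'.r (ψ e) = φ (E.r e)) :
    AlgIso R (LeavittPathAlgebra R E) (LeavittPathAlgebra R E') := by
  have key : ∀ x, ψ '' E.outEdges x = E'.outEdges (φ x) := by
    intro x
    ext e
    constructor
    · rintro ⟨e, rfl, rfl⟩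
      exact hs e
    · intro he
      refine ⟨ψ.symm e, φ.injective ?_, ψ.apply_symm_apply e⟩
      rw [← hs, ψ.apply_symm_apply]
      exact he
  have hreg : ∀ x, E.IsRegular x ↔ E'.IsRegular (φ x) := by
    intro x
    rw [IsRegular, IsRegular, ← key, Set.finite_image_iff ψ.injective.injOn, Set.image_nonempty]
  let F : E.LeavittFamily (LeavittPathAlgebra R E') :=
    { vert := fun x => vert R (φ x)
      edge := fun e => edge R (ψ e)
      ghost := fun e => ghost R (ψ e)
      vert_idem := fun x => vert_idem _
      vert_orth := fun x y h => vert_orth _ _ (φ.injective.ne h)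
      s_edge := fun e => by rw [← hs, s_edge]
      edge_r := fun e => by rw [← hr, edge_r]
      r_ghost := fun e => by rw [← hr, r_ghost]
      ghost_s := fun e => by rw [← hs, ghost_s]
      ck1_self := fun e => by rw [← hr, ck1_self]
      ck1_ne := fun e f h => ck1_ne _ _ (ψ.injective.ne h)
      ck2 := fun x hx => by
        rw [← ck2 (φ x) ((hreg x).1 hx)]
        refine Finset.sum_equiv ψ (fun e => ?_) fun _ _ => rfl
        rw [Set.Finite.mem_toFinset, Set.Finite.mem_toFinset, ← key, ψ.injective.mem_set_image] }
  let G : E'.LeavittFamily (LeavittPathAlgebra R E) :=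
    { vert := fun x => vert R (φ.symm x)
      edge := fun e => edge R (ψ.symm e)
      ghost := fun e => ghost R (ψ.symm e)
      vert_idem := fun x => vert_idem _
      vert_orth := fun x y h => vert_orth _ _ (φ.symm.injective.ne h)
      s_edge := fun e => by
        obtain ⟨e, rfl⟩ := ψ.surjective e
        rw [hs, φ.symm_apply_apply, ψ.symm_apply_apply, s_edge]
      edge_r := fun e => by
        obtain ⟨e, rfl⟩ := ψ.surjective e
        rw [hr, φ.symm_apply_apply, ψ.symm_apply_apply, edge_r]
      r_ghost := fun e => by
        obtain ⟨e, rfl⟩ := ψ.surjective e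
        rw [hr, φ.symm_apply_apply, ψ.symm_apply_apply, r_ghost]
      ghost_s := fun e => by
        obtain ⟨e, rfl⟩ := ψ.surjective e
        rw [hs, φ.symm_apply_apply, ψ.symm_apply_apply, ghost_s]
      ck1_self := fun e => by
        obtain ⟨e, rfl⟩ := ψ.surjective e
        rw [hr, φ.symm_apply_apply, ψ.symm_apply_apply, ck1_self]
      ck1_ne := fun e f h => ck1_ne _ _ (ψ.symm.injective.ne h)
      ck2 := fun x hx => by
        obtain ⟨x, rfl⟩ := φ.surjective x
        rw [φ.symm_apply_apply, ← ck2 x ((hreg x).2 hx)]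
        refine (Finset.sum_equiv ψ (fun e => ?_) fun e _ => ?_).symm
        · rw [Set.Finite.mem_toFinset, Set.Finite.mem_toFinset, ← key, ψ.injective.mem_set_image]
        · rw [ψ.symm_apply_apply] }
  have hFv : ∀ x, F.lift R (vert R x) = vert R (φ x) := F.lift_vert R
  have hFe : ∀ e, F.lift R (edge R e) = edge R (ψ e) := F.lift_edge R
  have hFg : ∀ e, F.lift R (ghost R e) = ghost R (ψ e) := F.lift_ghost R
  have hGv : ∀ x, G.lift R (vert R x) = vert R (φ.symm x) := G.lift_vert R
  have hGe : ∀ e, G.lift R (edge R e) = edge R (ψ.symm e) := G.lift_edge R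
  have hGg : ∀ e, G.lift R (ghost R e) = ghost R (ψ.symm e) := G.lift_ghost R
  exact algIso_of_families F G (fun x => (hGv _).trans (by rw [φ.symm_apply_apply]))
    (fun e => (hGe _).trans (by rw [ψ.symm_apply_apply]))
    (fun e => (hGg _).trans (by rw [ψ.symm_apply_apply]))
    (fun x => (hFv _).trans (by rw [φ.apply_symm_apply]))
    (fun e => (hFe _).trans (by rw [ψ.apply_symm_apply]))
    (fun e => (hFg _).trans (by rw [ψ.apply_symm_apply]))

/-- The Leavitt path algebra of a finite graph without sinks and sources is an algebraic
Cuntz-Krieger algebra, also in the universe `0`. -/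
theorem IsCuntzKrieger.isoToAlgebraicCuntzKrieger (R : Type w) [CommRing R] {E : DiGraph.{u, v}}
    (hE : E.IsCuntzKrieger) : IsoToAlgebraicCuntzKrieger R (LeavittPathAlgebra R E) := by
  obtain ⟨⟨_, _⟩, hsink, hsource⟩ := hE
  let φ := Finite.equivFin E.V
  let ψ := Finite.equivFin E.Edge
  let F : DiGraph.{0, 0} := ⟨Fin (Nat.card E.V), Fin (Nat.card E.Edge),
    fun e => φ (E.s (ψ.symm e)), fun e => φ (E.r (ψ.symm e))⟩
  refine ⟨F, ⟨⟨inferInstanceAs (Finite (Fin _)), inferInstanceAs (Finite (Fin _))⟩, fun x hx => ?_,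
    fun x hx => ?_⟩, algIso_of_equiv R (E' := F) φ ψ (fun e => ?_) (fun e => ?_)⟩
  · obtain ⟨e, he⟩ := Set.nonempty_iff_ne_empty.2 (hsink (φ.symm x))
    have : ψ e ∈ F.outEdges x := by
      change φ (E.s (ψ.symm (ψ e))) = x
      rw [ψ.symm_apply_apply, show E.s e = φ.symm x from he, φ.apply_symm_apply]
    rw [hx] at this
    exact this
  · obtain ⟨e, he⟩ := Set.nonempty_iff_ne_empty.2 (hsource (φ.symm x))
    have : ψ e ∈ F.inEdges x := by
      change φ (E.r (ψ.symm (ψ e))) = x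
      rw [ψ.symm_apply_apply, show E.r e = φ.symm x from he, φ.apply_symm_apply]
    rw [hx] at this
    exact this
  · exact congrArg φ (congrArg E.s (ψ.symm_apply_apply e))
  · exact congrArg φ (congrArg E.r (ψ.symm_apply_apply e))

end GraphIso

/-! ### First move: redirecting an edge. -/

section Redirect

/-- The graph in which the range of the edge `f` is changed to `x`. -/
def redirect (E : DiGraph.{u, v}) (f : E.Edge) (x : E.V) : DiGraph.{u, v} where
  V := E.V
  Edge := E.Edge
  s := E.s
  r := Function.update E.r f x

theorem redirect_r_self (E : DiGraph.{u, v}) (f : E.Edge) (x : E.V) :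
    (E.redirect f x).r f = x := by
  change Function.update E.r f x f = x
  rw [Function.update_self]

theorem redirect_r_of_ne (E : DiGraph.{u, v}) {f g : E.Edge} (h : g ≠ f) (x : E.V) :
    (E.redirect f x).r g = E.r g := by
  change Function.update E.r f x g = _
  rw [Function.update_of_ne h]

theorem LeavittPathAlgebra.edge_mul_ghost_of_unique {R : Type w} [CommRing R] {E : DiGraph.{u, v}}
    {e : E.Edge} (he : ∀ g, E.s g = E.s e → g = e) : edge R e * ghost R e = vert R (E.s e) := by
  have hset : E.outEdges (E.s e) = {e} := Set.eq_singleton_iff_unique_mem.2 ⟨rfl, he⟩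
  have hreg : E.IsRegular (E.s e) := by
    rw [IsRegular, hset]
    exact ⟨Set.finite_singleton e, Set.singleton_nonempty e⟩
  rw [← ck2 _ hreg, Finset.sum_eq_single_of_mem e (hreg.1.mem_toFinset.2 rfl)]
  exact fun g hg hge => absurd (he g (hreg.1.mem_toFinset.1 hg)) hge

variable (R : Type w) [CommRing R] {E : DiGraph.{u, v}} {e f : E.Edge}

/-- If `e` is the only edge that its source emits, then another edge with the same range as `e` may
be redirected to the source of `e`. -/
theorem algIso_redirect (he : ∀ g, E.s g = E.s e → g = e) (hfe : f ≠ e) (hr : E.r f = E.r e) :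
    AlgIso R (LeavittPathAlgebra R E) (LeavittPathAlgebra R (E.redirect f (E.s e))) := by
  set E' := E.redirect f (E.s e) with hE'
  let vert' : E.V → LeavittPathAlgebra R E' := vert R (E := E')
  let edge' : E.Edge → LeavittPathAlgebra R E' := edge R (E := E')
  let ghost' : E.Edge → LeavittPathAlgebra R E' := ghost R (E := E')
  have hee : edge R e * ghost R e = vert R (E.s e) := edge_mul_ghost_of_unique he
  have hee' : edge' e * ghost' e = vert' (E.s e) := edge_mul_ghost_of_unique (E := E') he
  have hrf : E'.r f = E.s e := E.redirect_r_self f _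
  have hrg : ∀ g, g ≠ f → E'.r g = E.r g := fun g hg => E.redirect_r_of_ne hg _
  have s_edge' : ∀ g, vert' (E.s g) * edge' g = edge' g := s_edge (E := E')
  have ghost_s' : ∀ g, ghost' g * vert' (E.s g) = ghost' g := ghost_s (E := E')
  have edge_r' : ∀ g, g ≠ f → edge' g * vert' (E.r g) = edge' g := fun g hg => by
    rw [← hrg g hg]; exact edge_r (E := E') g
  have r_ghost' : ∀ g, g ≠ f → vert' (E.r g) * ghost' g = ghost' g := fun g hg => by
    rw [← hrg g hg]; exact r_ghost (E := E') g
  have edge_rf : edge' f * vert' (E.s e) = edge' f := by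
    rw [← hrf]; exact edge_r (E := E') f
  have r_ghostf : vert' (E.s e) * ghost' f = ghost' f := by
    rw [← hrf]; exact r_ghost (E := E') f
  have ck1' : ∀ g, g ≠ f → ghost' g * edge' g = vert' (E.r g) := fun g hg => by
    rw [← hrg g hg]; exact ck1_self (E := E') g
  have ck1f : ghost' f * edge' f = vert' (E.s e) := by
    rw [← hrf]; exact ck1_self (E := E') f
  have ck1_ne' : ∀ g g', g ≠ g' → ghost' g * edge' g' = 0 := ck1_ne (E := E')
  -- Since e e* = s(e) and e* e = r(e), right multiplication by e converts edges into s(e) to edges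
  -- into r(e). So f goes to f e, which does not change f f*; the inverse sends the redirected f to
  -- f e*.
  let F : E.LeavittFamily (LeavittPathAlgebra R E') :=
    { vert := vert'
      edge := fun g => if g = f then edge' f * edge' e else edge' g
      ghost := fun g => if g = f then ghost' e * ghost' f else ghost' g
      vert_idem := fun x => vert_idem (E := E') x
      vert_orth := fun x y h => vert_orth (E := E') x y h
      s_edge := fun g => by
        split_ifs with hg
        · rw [hg, ← mul_assoc, s_edge']
        · exact s_edge' g
      edge_r := fun g => by
        split_ifs with hg
        · rw [hg, hr, mul_assoc, edge_r' e hfe.symm]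
        · exact edge_r' g hg
      r_ghost := fun g => by
        split_ifs with hg
        · rw [hg, hr, ← mul_assoc, r_ghost' e hfe.symm]
        · exact r_ghost' g hg
      ghost_s := fun g => by
        split_ifs with hg
        · rw [hg, mul_assoc, ghost_s']
        · exact ghost_s' g
      ck1_self := fun g => by
        split_ifs with hg
        · rw [hg, hr, mul_assoc, mul_mul_of_mul_eq ck1f, s_edge', ck1' e hfe.symm]
        · exact ck1' g hg
      ck1_ne := fun g g' h => by
        by_cases hg : g = f
        · rw [if_pos hg, if_neg (fun hg' => h (hg.trans hg'.symm)), mul_assoc, ck1_ne' f g'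
            (hg ▸ h), mul_zero]
        · rw [if_neg hg]
          by_cases hg' : g' = f
          · rw [if_pos hg', ← mul_assoc, ck1_ne' g f hg, zero_mul]
          · rw [if_neg hg', ck1_ne' g g' h]
      ck2 := fun x hx => by
        refine Eq.trans (Finset.sum_congr rfl fun g _ => ?_) (ck2 (E := E') x hx)
        split_ifs with hg
        · rw [hg, mul_assoc, mul_mul_of_mul_eq hee', r_ghostf]
        · rfl }
  let G : E'.LeavittFamily (LeavittPathAlgebra R E) :=
    { vert := fun x => vert R (E := E) x
      edge := fun g => if g = f then edge R f * ghost R e else edge R (E := E) g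
      ghost := fun g => if g = f then edge R e * ghost R f else ghost R (E := E) g
      vert_idem := fun x => vert_idem (E := E) x
      vert_orth := fun x y h => vert_orth (E := E) x y h
      s_edge := fun g => by
        change vert R (E.s g) * _ = _
        split_ifs with hg
        · rw [hg, ← mul_assoc, s_edge]
        · exact s_edge (E := E) g
      edge_r := fun g => by
        split_ifs with hg
        · rw [hg, hrf, mul_assoc, ghost_s]
        · rw [hrg g hg]; exact edge_r (E := E) g
      r_ghost := fun g => by
        split_ifs with hg
        · rw [hg, hrf, ← mul_assoc, s_edge]
        · rw [hrg g hg]; exact r_ghost (E := E) g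
      ghost_s := fun g => by
        change _ * vert R (E.s g) = _
        split_ifs with hg
        · rw [hg, mul_assoc, ghost_s]
        · exact ghost_s (E := E) g
      ck1_self := fun g => by
        split_ifs with hg
        · rw [hg, hrf, mul_assoc, mul_mul_of_mul_eq (ck1_self f), hr, r_ghost, hee]
        · rw [hrg g hg]; exact ck1_self (E := E) g
      ck1_ne := fun g g' h => by
        by_cases hg : g = f
        · rw [if_pos hg, if_neg (fun hg' => h (hg.trans hg'.symm)), mul_assoc,
            ck1_ne (E := E) f g' (hg ▸ h), mul_zero]
        · rw [if_neg hg]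
          by_cases hg' : g' = f
          · rw [if_pos hg', ← mul_assoc, ck1_ne (E := E) g f hg, zero_mul]
          · rw [if_neg hg', ck1_ne (E := E) g g' h]
      ck2 := fun x hx => by
        refine Eq.trans (Finset.sum_congr rfl fun g _ => ?_) (ck2 (E := E) x hx)
        split_ifs with hg
        · rw [hg, mul_assoc, mul_mul_of_mul_eq (ck1_self e), ← hr, r_ghost]
        · rfl }
  have hFe : ∀ g, F.lift R (edge R g) = if g = f then edge' f * edge' e else edge' g :=
    F.lift_edge R
  have hFg : ∀ g, F.lift R (ghost R g) = if g = f then ghost' e * ghost' f else ghost' g :=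
    F.lift_ghost R
  have hGe : ∀ g, G.lift R (edge' g) = if g = f then edge R f * ghost R e else edge R g :=
    G.lift_edge R
  have hGg : ∀ g, G.lift R (ghost' g) = if g = f then edge R e * ghost R f else ghost R g :=
    G.lift_ghost R
  refine algIso_of_families F G (fun x => G.lift_vert R x) (fun g => ?_) (fun g => ?_)
    (fun x => F.lift_vert R x) (fun g => ?_) (fun g => ?_)
  · change G.lift R (if g = f then edge' f * edge' e else edge' g) = _
    split_ifs with hg
    · rw [map_mul, hGe, hGe, if_pos rfl, if_neg hfe.symm, mul_assoc, ck1_self, ← hr, edge_r, hg]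
    · rw [hGe, if_neg hg]
  · change G.lift R (if g = f then ghost' e * ghost' f else ghost' g) = _
    split_ifs with hg
    · rw [map_mul, hGg, hGg, if_pos rfl, if_neg hfe.symm, ← mul_assoc, ck1_self, ← hr, r_ghost, hg]
    · rw [hGg, if_neg hg]
  · change F.lift R (if g = f then edge R f * ghost R e else edge R (E := E) g) = edge' g
    split_ifs with hg
    · rw [map_mul, hFe, hFg, if_pos rfl, if_neg hfe.symm, mul_assoc, hee', edge_rf, hg]
    · exact (hFe g).trans (if_neg hg)
  · change F.lift R (if g = f then edge R e * ghost R f else ghost R (E := E) g) = ghost' g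
    split_ifs with hg
    · rw [map_mul, hFe, hFg, if_pos rfl, if_neg hfe.symm, ← mul_assoc, hee', r_ghostf, hg]
    · exact (hFg g).trans (if_neg hg)

end Redirect

/-! ### Second move: out-splitting a vertex. -/

/-- The out-split graph: `π` maps the new vertices to the old ones, and `t e` is the part of the
source of `e` that emits `e`. -/
def outSplit (E : DiGraph.{u, v}) {W : Type u'} (π : W → E.V) (t : E.Edge → W) :
    DiGraph.{u', max u' v} where
  V := W
  Edge := {k : E.Edge × W // π k.2 = E.r k.1}
  s k := t k.1.1
  r k := k.1.2

namespace outSplit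

variable {R : Type w} [CommRing R] {E : DiGraph.{u, v}} {W : Type u'} {π : W → E.V}
  {t : E.Edge → W}

variable (R π t) in
/-- A vertex of the out-split graph. -/
def sVert (y : W) : LeavittPathAlgebra R (E.outSplit π t) := vert R (E := E.outSplit π t) y

variable (R π t) in
/-- An edge of the out-split graph, or `0` if there is no such edge. -/
def sEdge (e : E.Edge) (y : W) : LeavittPathAlgebra R (E.outSplit π t) :=
  if h : π y = E.r e then edge R (E := E.outSplit π t) ⟨(e, y), h⟩ else 0

variable (R π t) in
/-- A ghost edge of the out-split graph, or `0` if there is no such edge. -/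
def sGhost (e : E.Edge) (y : W) : LeavittPathAlgebra R (E.outSplit π t) :=
  if h : π y = E.r e then ghost R (E := E.outSplit π t) ⟨(e, y), h⟩ else 0

theorem sVert_mul_sVert (x y : W) :
    sVert R π t x * sVert R π t y = if x = y then sVert R π t x else 0 :=
  vert_mul_vert (E := E.outSplit π t) x y

theorem sVert_mul_sEdge (e : E.Edge) (y : W) :
    sVert R π t (t e) * sEdge R π t e y = sEdge R π t e y := by
  unfold sEdge
  split_ifs with h
  · exact s_edge (E := E.outSplit π t) ⟨(e, y), h⟩
  · rw [mul_zero]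

theorem sEdge_mul_sVert (e : E.Edge) (y : W) :
    sEdge R π t e y * sVert R π t y = sEdge R π t e y := by
  unfold sEdge
  split_ifs with h
  · exact edge_r (E := E.outSplit π t) ⟨(e, y), h⟩
  · rw [zero_mul]

theorem sGhost_mul_sVert (e : E.Edge) (y : W) :
    sGhost R π t e y * sVert R π t (t e) = sGhost R π t e y := by
  unfold sGhost
  split_ifs with h
  · exact ghost_s (E := E.outSplit π t) ⟨(e, y), h⟩
  · rw [zero_mul]

theorem sVert_mul_sGhost (e : E.Edge) (y : W) :
    sVert R π t y * sGhost R π t e y = sGhost R π t e y := by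
  unfold sGhost
  split_ifs with h
  · exact r_ghost (E := E.outSplit π t) ⟨(e, y), h⟩
  · rw [mul_zero]

theorem sGhost_mul_sEdge_self (e : E.Edge) (y : W) :
    sGhost R π t e y * sEdge R π t e y = if π y = E.r e then sVert R π t y else 0 := by
  unfold sGhost sEdge
  split_ifs with h
  · exact ck1_self (E := E.outSplit π t) ⟨(e, y), h⟩
  · rw [zero_mul]

theorem sGhost_mul_sEdge_of_ne {e e' : E.Edge} {y y' : W} (h : (e, y) ≠ (e', y')) :
    sGhost R π t e y * sEdge R π t e' y' = 0 := by
  unfold sGhost sEdge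
  split_ifs
  · exact ck1_ne _ _ fun hh => h (congrArg Subtype.val hh)
  · rw [mul_zero]
  · rw [zero_mul]
  · rw [zero_mul]

theorem sEdge_mul_sGhost_of_ne (e e' : E.Edge) {y y' : W} (h : y ≠ y') :
    sEdge R π t e y * sGhost R π t e' y' = 0 := by
  rw [← sEdge_mul_sVert, ← sVert_mul_sGhost, mul_assoc, ← mul_assoc (sVert R π t y),
    sVert_mul_sVert, if_neg h, zero_mul, mul_zero]

/-- The second relation of the split graph as a double sum. It applies at y because some e is
emitted by the part y, and any edge emitted by r(e) determines a part of r(e) and so a copy of e. -/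
theorem sum_sEdge_mul_sGhost [Fintype E.Edge] [Fintype W] (ht : ∀ e, π (t e) = E.s e) (hW : ∀ y, ∃ e, t e = y)
    (hE : ∀ x, ∃ e, E.s e = x) (y : W) :
    ∑ e, (if t e = y then ∑ z, sEdge R π t e z * sGhost R π t e z else 0) = sVert R π t y := by
  let _ : Fintype (E.outSplit π t).Edge :=
    inferInstanceAs (Fintype {k : E.Edge × W // π k.2 = E.r k.1})
  have hy : ∃ k : (E.outSplit π t).Edge, (E.outSplit π t).s k = y := by
    obtain ⟨e, he⟩ := hW y
    obtain ⟨f, hf⟩ := hE (E.r e)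
    exact ⟨⟨(e, t f), (ht f).trans hf⟩, he⟩
  refine Eq.trans ?_ (sum_edge_mul_ghost (R := R) hy)
  refine Eq.trans ?_ (sum_subtype_eq_sum_dite (p := fun k : E.Edge × W => π k.2 = E.r k.1)
    (fun k => if (E.outSplit π t).s k = y then edge R (E := E.outSplit π t) k *
      ghost R (E := E.outSplit π t) k else 0)).symm
  rw [Fintype.sum_prod_type]
  refine Finset.sum_congr rfl fun e _ => ?_
  by_cases he : t e = y
  · rw [if_pos he]
    refine Finset.sum_congr rfl fun z _ => ?_
    by_cases hz : π z = E.r e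
    · simp only [sEdge, sGhost, dif_pos hz]
      exact (if_pos he).symm
    · rw [sEdge, dif_neg hz, zero_mul]
      rw [dif_neg (show ¬ π (e, z).2 = E.r (e, z).1 from hz)]
  · rw [if_neg he]
    refine (Finset.sum_eq_zero fun z _ => ?_).symm
    by_cases hz : π z = E.r e
    · exact (dif_pos hz).trans (if_neg he)
    · exact dif_neg hz

section Old

variable [Fintype W]

variable (R π t) in
/-- The image of a vertex of the original graph. -/
def oldVert (x : E.V) : LeavittPathAlgebra R (E.outSplit π t) :=
  ∑ y, if π y = x then sVert R π t y else 0

variable (R π t) in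
/-- The image of an edge of the original graph. -/
def oldEdge (e : E.Edge) : LeavittPathAlgebra R (E.outSplit π t) := ∑ y, sEdge R π t e y

variable (R π t) in
/-- The image of a ghost edge of the original graph. -/
def oldGhost (e : E.Edge) : LeavittPathAlgebra R (E.outSplit π t) := ∑ y, sGhost R π t e y

theorem oldVert_mul_sVert (x : E.V) (y : W) :
    oldVert R π t x * sVert R π t y = if π y = x then sVert R π t y else 0 := by
  rw [oldVert, Finset.sum_mul, Finset.sum_eq_single_of_mem y (Finset.mem_univ y)]
  · rw [ite_mul, zero_mul, sVert_mul_sVert, if_pos rfl]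
  · intro z _ hz
    rw [ite_mul, zero_mul, sVert_mul_sVert, if_neg hz, ite_self]

theorem sVert_mul_oldVert (x : E.V) (y : W) :
    sVert R π t y * oldVert R π t x = if π y = x then sVert R π t y else 0 := by
  rw [oldVert, Finset.mul_sum, Finset.sum_eq_single_of_mem y (Finset.mem_univ y)]
  · rw [mul_ite, mul_zero, sVert_mul_sVert, if_pos rfl]
  · intro z _ hz
    rw [mul_ite, mul_zero, sVert_mul_sVert, if_neg hz.symm, ite_self]

theorem oldEdge_mul_oldGhost (e : E.Edge) :
    oldEdge R π t e * oldGhost R π t e = ∑ y, sEdge R π t e y * sGhost R π t e y := by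
  rw [oldEdge, oldGhost, Finset.sum_mul_sum]
  refine Finset.sum_congr rfl fun y _ => ?_
  exact Finset.sum_eq_single_of_mem y (Finset.mem_univ y) fun z _ hz =>
    sEdge_mul_sGhost_of_ne e e hz.symm

/-- The Leavitt family of the original graph. -/
def oldFamily [Fintype E.Edge] (ht : ∀ e, π (t e) = E.s e) (hW : ∀ y, ∃ e, t e = y) (hE : ∀ x, ∃ e, E.s e = x) :
    E.LeavittFamily (LeavittPathAlgebra R (E.outSplit π t)) where
  vert := oldVert R π t
  edge := oldEdge R π t
  ghost := oldGhost R π t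
  vert_idem x := by
    nth_rw 2 3 [oldVert]
    rw [Finset.mul_sum]
    refine Finset.sum_congr rfl fun y _ => ?_
    rw [mul_ite, mul_zero, oldVert_mul_sVert]
    split_ifs <;> rfl
  vert_orth x x' h := by
    nth_rw 2 [oldVert]
    rw [Finset.mul_sum]
    refine Finset.sum_eq_zero fun y _ => ?_
    rw [mul_ite, mul_zero, oldVert_mul_sVert]
    split_ifs with h1 h2
    · exact absurd (h2.symm.trans h1) h
    · rfl
    · rfl
  s_edge e := by
    rw [oldEdge, Finset.mul_sum]
    refine Finset.sum_congr rfl fun y _ => ?_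
    rw [← sVert_mul_sEdge, ← mul_assoc, oldVert_mul_sVert, if_pos (ht e)]
  edge_r e := by
    rw [oldEdge, Finset.sum_mul]
    refine Finset.sum_congr rfl fun y _ => ?_
    by_cases hy : π y = E.r e
    · rw [← sEdge_mul_sVert, mul_assoc, sVert_mul_oldVert, if_pos hy]
    · rw [sEdge, dif_neg hy, zero_mul]
  r_ghost e := by
    rw [oldGhost, Finset.mul_sum]
    refine Finset.sum_congr rfl fun y _ => ?_
    by_cases hy : π y = E.r e
    · rw [← sVert_mul_sGhost, ← mul_assoc, oldVert_mul_sVert, if_pos hy]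
    · rw [sGhost, dif_neg hy, mul_zero]
  ghost_s e := by
    rw [oldGhost, Finset.sum_mul]
    refine Finset.sum_congr rfl fun y _ => ?_
    rw [← sGhost_mul_sVert, mul_assoc, sVert_mul_oldVert, if_pos (ht e)]
  ck1_self e := by
    rw [oldEdge, oldGhost, Finset.sum_mul_sum, oldVert]
    refine Finset.sum_congr rfl fun y _ => ?_
    rw [Finset.sum_eq_single_of_mem y (Finset.mem_univ y), sGhost_mul_sEdge_self]
    intro z _ hz
    exact sGhost_mul_sEdge_of_ne fun h => hz (congrArg Prod.snd h).symm
  ck1_ne e f h := by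
    rw [oldEdge, oldGhost, Finset.sum_mul_sum]
    refine Finset.sum_eq_zero fun y _ => Finset.sum_eq_zero fun z _ => ?_
    exact sGhost_mul_sEdge_of_ne fun h' => h (congrArg Prod.fst h')
  ck2 x hx := by
    rw [sum_outEdges hx.1, oldVert]
    -- The relation at x is the sum of the relations at the parts of x, since each edge emitted by x
    -- belongs to exactly one of them.
    have h1 : ∀ y, (if π y = x then sVert R π t y else 0) = ∑ e, if t e = y then
        (if E.s e = x then oldEdge R π t e * oldGhost R π t e else 0) else 0 := by
      intro y
      split_ifs with hy
      · rw [← sum_sEdge_mul_sGhost ht hW hE y]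
        refine Finset.sum_congr rfl fun e _ => ?_
        by_cases he : t e = y
        · rw [if_pos he, if_pos he, if_pos (by rw [← ht, he, hy]), oldEdge_mul_oldGhost]
        · rw [if_neg he, if_neg he]
      · refine (Finset.sum_eq_zero fun e _ => ?_).symm
        by_cases he : t e = y
        · rw [if_pos he, if_neg]
          rwa [← ht, he]
        · rw [if_neg he]
    rw [Finset.sum_congr rfl fun y _ => h1 y, Finset.sum_comm]
    refine Finset.sum_congr rfl fun e _ => ?_
    rw [Finset.sum_ite_eq, if_pos (Finset.mem_univ _)]

end Old

section New

variable [Fintype E.Edge]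

variable (R t) in
/-- The image of a vertex of the out-split graph. -/
def newVert (y : W) : LeavittPathAlgebra R E := ∑ e, if t e = y then edge R e * ghost R e else 0

theorem newVert_mul_edge (y : W) (e : E.Edge) :
    newVert R t y * edge R e = if t e = y then edge R e else 0 := by
  rw [newVert, Finset.sum_mul, Finset.sum_eq_single_of_mem e (Finset.mem_univ e)]
  · rw [ite_mul, zero_mul, mul_assoc, ck1_self, edge_r]
  · intro f _ hf
    rw [ite_mul, zero_mul, mul_assoc, ck1_ne f e hf, mul_zero, ite_self]

theorem ghost_mul_newVert (y : W) (e : E.Edge) :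
    ghost R e * newVert R t y = if t e = y then ghost R e else 0 := by
  rw [newVert, Finset.mul_sum, Finset.sum_eq_single_of_mem e (Finset.mem_univ e)]
  · rw [mul_ite, mul_zero, ← mul_assoc, ck1_self, r_ghost]
  · intro f _ hf
    rw [mul_ite, mul_zero, ← mul_assoc, ck1_ne e f hf.symm, zero_mul, ite_self]

theorem newVert_mul_newVert (y z : W) :
    newVert R t y * newVert R t z = if y = z then newVert R t y else 0 := by
  nth_rw 2 [newVert]
  rw [Finset.mul_sum]
  split_ifs with h
  · subst h
    rw [newVert]
    refine Finset.sum_congr rfl fun e _ => ?_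
    rw [mul_ite, mul_zero, ← newVert, ← mul_assoc, newVert_mul_edge]
    split_ifs <;> rfl
  · refine Finset.sum_eq_zero fun e _ => ?_
    rw [mul_ite, mul_zero, ← mul_assoc, newVert_mul_edge]
    split_ifs with h1 h2
    · exact absurd (h2.symm.trans h1) h
    · rw [zero_mul]
    · rfl

theorem vert_mul_newVert (ht : ∀ e, π (t e) = E.s e) (y : W) :
    vert R (π y) * newVert R t y = newVert R t y := by
  rw [newVert, Finset.mul_sum]
  refine Finset.sum_congr rfl fun e _ => ?_
  split_ifs with h
  · rw [← h, ht, ← mul_assoc, s_edge]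
  · rw [mul_zero]

/-- The parts of x partition the edges that x emits, so this regroups the second relation at x. -/
theorem sum_newVert [Fintype W] (ht : ∀ e, π (t e) = E.s e) (hE : ∀ x, ∃ e, E.s e = x) (x : E.V) :
    ∑ y, (if π y = x then newVert R t y else 0) = vert R x := by
  rw [← sum_edge_mul_ghost (hE x)]
  have h1 : ∀ y, (if π y = x then newVert R t y else 0) = ∑ e, if t e = y then
      (if E.s e = x then edge R e * ghost R e else 0) else 0 := by
    intro y
    split_ifs with hy
    · refine Finset.sum_congr rfl fun e _ => ?_
      by_cases he : t e = y
      · rw [if_pos he, if_pos he, if_pos (by rw [← ht, he, hy])]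
      · rw [if_neg he, if_neg he]
    · refine (Finset.sum_eq_zero fun e _ => ?_).symm
      by_cases he : t e = y
      · rw [if_pos he, if_neg]
        rwa [← ht, he]
      · rw [if_neg he]
  rw [Finset.sum_congr rfl fun y _ => h1 y, Finset.sum_comm]
  refine Finset.sum_congr rfl fun e _ => ?_
  rw [Finset.sum_ite_eq, if_pos (Finset.mem_univ _)]

/-- The Leavitt family of the out-split graph. -/
def newFamily [Fintype W] (ht : ∀ e, π (t e) = E.s e) (hE : ∀ x, ∃ e, E.s e = x) :
    (E.outSplit π t).LeavittFamily (LeavittPathAlgebra R E) where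
  vert y := newVert R t y
  edge k := edge R k.1.1 * newVert R t k.1.2
  ghost k := newVert R t k.1.2 * ghost R k.1.1
  vert_idem y := (newVert_mul_newVert y y).trans (if_pos rfl)
  vert_orth y z h := (newVert_mul_newVert y z).trans (if_neg h)
  s_edge k := by
    change newVert R t (t k.1.1) * _ = _
    rw [← mul_assoc, newVert_mul_edge, if_pos rfl]
  edge_r k := by
    change _ * newVert R t k.1.2 = _
    rw [mul_assoc, newVert_mul_newVert, if_pos rfl]
  r_ghost k := by
    change newVert R t k.1.2 * _ = _
    rw [← mul_assoc, newVert_mul_newVert, if_pos rfl]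
  ghost_s k := by
    change _ * newVert R t (t k.1.1) = _
    rw [mul_assoc, ghost_mul_newVert, if_pos rfl]
  ck1_self k := by
    change _ = newVert R t k.1.2
    rw [mul_assoc, mul_mul_of_mul_eq (ck1_self k.1.1), ← k.2, vert_mul_newVert ht,
      newVert_mul_newVert, if_pos rfl]
  ck1_ne k k' h := by
    rw [mul_assoc, mul_mul_of_mul_eq (ghost_mul_edge k.1.1 k'.1.1)]
    split_ifs with he
    · rw [he, ← k'.2, vert_mul_newVert ht, newVert_mul_newVert, if_neg]
      exact fun hy => h (Subtype.ext (Prod.ext he hy))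
    · rw [zero_mul, mul_zero]
  ck2 y hy := by
    let _ : Fintype (E.outSplit π t).Edge :=
      inferInstanceAs (Fintype {k : E.Edge × W // π k.2 = E.r k.1})
    rw [sum_outEdges hy.1]
    refine Eq.trans (sum_subtype_eq_sum_dite (p := fun k : E.Edge × W => π k.2 = E.r k.1)
      (fun k => if (E.outSplit π t).s k = y then edge R k.1.1 * newVert R t k.1.2 *
        (newVert R t k.1.2 * ghost R k.1.1) else 0)) ?_
    rw [Fintype.sum_prod_type]
    change _ = ∑ e, if t e = y then edge R e * ghost R e else 0
    refine Finset.sum_congr rfl fun e _ => ?_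
    by_cases he : t e = y
    -- Decomposing r(e) into its parts inside e r(e) e* yields the copies of e.
    · rw [if_pos he, ← edge_r e, ← sum_newVert ht hE (E.r e), Finset.mul_sum, Finset.sum_mul]
      refine Finset.sum_congr rfl fun z _ => ?_
      by_cases hz : π z = E.r e
      · refine (dif_pos hz).trans ((if_pos he).trans ?_)
        rw [if_pos hz, mul_assoc, ← mul_assoc (newVert R t z), newVert_mul_newVert, if_pos rfl,
          mul_assoc]
      · rw [if_neg hz, mul_zero, zero_mul]
        exact dif_neg hz
    · rw [if_neg he]
      refine Finset.sum_eq_zero fun z _ => ?_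
      by_cases hz : π z = E.r e
      · exact (dif_pos hz).trans (if_neg he)
      · exact dif_neg hz

variable (R) in
/-- Out-splitting a finite graph without sinks does not change the Leavitt path algebra. -/
theorem algIso [Fintype W] (ht : ∀ e, π (t e) = E.s e) (hW : ∀ y, ∃ e, t e = y) (hE : ∀ x, ∃ e, E.s e = x) :
    AlgIso R (LeavittPathAlgebra R E) (LeavittPathAlgebra R (E.outSplit π t)) := by
  let F := oldFamily (R := R) ht hW hE
  let G := newFamily (R := R) ht hE
  have hFv : ∀ x, F.lift R (vert R x) = oldVert R π t x := F.lift_vert R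
  have hFe : ∀ e, F.lift R (edge R e) = oldEdge R π t e := F.lift_edge R
  have hFg : ∀ e, F.lift R (ghost R e) = oldGhost R π t e := F.lift_ghost R
  have hGv : ∀ y, G.lift R (sVert R π t y) = newVert R t y := G.lift_vert R
  have hGe : ∀ e y, G.lift R (sEdge R π t e y) =
      if π y = E.r e then edge R e * newVert R t y else 0 := by
    intro e y
    unfold sEdge
    split_ifs
    · exact G.lift_edge R _
    · exact map_zero _
  have hGg : ∀ e y, G.lift R (sGhost R π t e y) =
      if π y = E.r e then newVert R t y * ghost R e else 0 := by
    intro e y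
    unfold sGhost
    split_ifs
    · exact G.lift_ghost R _
    · exact map_zero _
  have hFn : ∀ y, F.lift R (newVert R t y) = sVert R π t y := by
    intro y
    rw [newVert, map_sum, ← sum_sEdge_mul_sGhost ht hW hE y]
    refine Finset.sum_congr rfl fun e _ => ?_
    split_ifs
    · rw [map_mul, hFe, hFg, oldEdge_mul_oldGhost]
    · exact map_zero _
  refine algIso_of_families F G (fun x => ?_) (fun e => ?_) (fun e => ?_) hFn (fun k => ?_)
    (fun k => ?_)
  · change G.lift R (oldVert R π t x) = _
    rw [oldVert, map_sum, ← sum_newVert ht hE x]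
    refine Finset.sum_congr rfl fun y _ => ?_
    split_ifs
    · exact hGv y
    · exact map_zero _
  · change G.lift R (oldEdge R π t e) = _
    rw [oldEdge, map_sum, ← edge_r e, ← sum_newVert ht hE (E.r e), Finset.mul_sum]
    refine Finset.sum_congr rfl fun y _ => ?_
    rw [hGe, mul_ite, mul_zero]
  · change G.lift R (oldGhost R π t e) = _
    rw [oldGhost, map_sum, ← r_ghost e, ← sum_newVert ht hE (E.r e), Finset.sum_mul]
    refine Finset.sum_congr rfl fun y _ => ?_
    rw [hGg, ite_mul, zero_mul]
  · change F.lift R (edge R k.1.1 * newVert R t k.1.2) = _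
    have hk : sEdge R π t k.1.1 k.1.2 = edge R k := dif_pos k.2
    rw [map_mul, hFe, hFn, ← hk, oldEdge, Finset.sum_mul,
      Finset.sum_eq_single_of_mem k.1.2 (Finset.mem_univ _), sEdge_mul_sVert]
    intro z _ hz
    rw [← sEdge_mul_sVert, mul_assoc, sVert_mul_sVert, if_neg hz, mul_zero]
  · change F.lift R (newVert R t k.1.2 * ghost R k.1.1) = _
    have hk : sGhost R π t k.1.1 k.1.2 = ghost R k := dif_pos k.2
    rw [map_mul, hFg, hFn, ← hk, oldGhost, Finset.mul_sum,
      Finset.sum_eq_single_of_mem k.1.2 (Finset.mem_univ _), sVert_mul_sGhost]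
    intro z _ hz
    rw [← sVert_mul_sGhost, ← mul_assoc, sVert_mul_sVert, if_neg hz.symm, zero_mul]

end New

end outSplit

/-! ### Removing sources from a finite graph without sinks. -/

/-- A hereditary set of vertices, each of which receives an edge from the set, such that the rest of
the graph has no infinite paths. -/
structure IsCore (E : DiGraph.{u, v}) (S : Set E.V) (ρ : E.V → ℕ) : Prop where
  hereditary : ∀ e, E.s e ∈ S → E.r e ∈ S
  exists_edge : ∀ x ∈ S, ∃ e, E.s e ∈ S ∧ E.r e = x
  rank_lt : ∀ e, E.s e ∉ S → E.r e ∉ S → ρ (E.r e) < ρ (E.s e)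

/-- The core consists of what is reachable from closed walks, and the rank counts reachable
vertices. If an edge did not lower the rank, its range would reach its source, which would then lie
on a closed walk. -/
theorem exists_isCore (E : DiGraph.{u, v}) [Finite E.V] : ∃ S ρ, E.IsCore S ρ := by
  refine ⟨{x | ∃ c, Relation.TransGen E.Adj c c ∧ Relation.ReflTransGen E.Adj c x},
    fun x => {y | Relation.ReflTransGen E.Adj x y}.ncard, ?_, ?_, ?_⟩
  · rintro e ⟨c, hc, hce⟩
    exact ⟨c, hc, hce.tail (.of_edge e)⟩
  · rintro x ⟨c, hc, hcx⟩
    have : Relation.TransGen E.Adj c x := hc.trans_left hcx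
    obtain ⟨y, hcy, e, rfl, rfl⟩ := Relation.TransGen.tail'_iff.1 this
    exact ⟨e, ⟨c, hc, hcy⟩, rfl⟩
  · intro e hs _
    refine Set.ncard_lt_ncard ⟨fun y hy => .head (.of_edge e) hy, fun hsub => hs ?_⟩ (Set.toFinite _)
    have hrs : Relation.ReflTransGen E.Adj (E.r e) (E.s e) :=
      hsub (show Relation.ReflTransGen E.Adj (E.s e) (E.s e) from .refl)
    exact ⟨E.s e, .head' (.of_edge e) hrs, .refl⟩

namespace IsCore

variable {E : DiGraph.{u, v}} {S : Set E.V} {ρ : E.V → ℕ}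

/-- The vertex s(e) now receives f from the core; r(e), which loses f, receives e from the enlarged
core. -/
theorem redirect (h : E.IsCore S ρ) {e f : E.Edge} (he : ∀ g, E.s g = E.s e → g = e)
    (hs : E.s e ∉ S) (hr : E.r e ∈ S) (hf : E.s f ∈ S) (hfe : E.r f = E.r e) :
    (E.redirect f (E.s e)).IsCore (insert (E.s e) S) ρ := by
  have hne : e ≠ f := fun h' => hs (h' ▸ hf)
  have hrf := E.redirect_r_self f (E.s e)
  have hrg : ∀ g, g ≠ f → (E.redirect f (E.s e)).r g = E.r g := fun g hg =>
    E.redirect_r_of_ne hg _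
  refine ⟨fun g hg => ?_, fun x hx => ?_, fun g hg hg' => ?_⟩
  · by_cases hgf : g = f
    · rw [hgf, hrf]; exact .inl rfl
    · rw [hrg g hgf]
      rcases hg with hg | hg
      · rw [he g hg]; exact .inr hr
      · exact .inr (h.hereditary g hg)
  · rcases hx with rfl | hx
    · exact ⟨f, .inr hf, hrf⟩
    · obtain ⟨g, hg, rfl⟩ := h.exists_edge x hx
      by_cases hgf : g = f
      · exact ⟨e, .inl rfl, by rw [hrg e hne, hgf, hfe]⟩
      · exact ⟨g, .inr hg, hrg g hgf⟩
  · have hgf : g ≠ f := fun h' => hg' (by rw [h', hrf]; exact .inl rfl)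
    rw [hrg g hgf] at hg' ⊢
    exact h.rank_lt g (fun h' => hg (.inr h')) (fun h' => hg' (.inr h'))

/-- The map that sends the new vertex to `x`. -/
def unsplit (x : E.V) : Option E.V → E.V := fun y => y.getD x

/-- The map that moves the edge `e` to the new vertex. -/
def peel (e : E.Edge) : E.Edge → Option E.V := fun g => if g = e then none else some (E.s g)

theorem unsplit_peel (e g : E.Edge) : unsplit (E.s e) (peel e g) = E.s g := by
  unfold peel
  split_ifs with h
  · rw [h]; rfl
  · rfl

theorem eq_some_of_unsplit_mem {x : E.V} (hx : x ∉ S) {y : Option E.V} (hy : unsplit x y ∈ S) :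
    y = some (unsplit x y) := by
  cases y with
  | none => exact absurd hy hx
  | some y => rfl

/-- Only s(e) is split and it lies outside the core, so each vertex of the core has a single copy
and keeps its edges from the core. -/
theorem outSplit (h : E.IsCore S ρ) {e : E.Edge} (hs : E.s e ∉ S) :
    (E.outSplit (unsplit (E.s e)) (peel e)).IsCore (some '' S) (ρ ∘ unsplit (E.s e)) := by
  have hpeel : ∀ g, E.s g ∈ S → peel e g = some (E.s g) := fun g hg =>
    if_neg fun h' : g = e => hs (h' ▸ hg)
  have hmem : ∀ y, unsplit (E.s e) y ∈ S → y ∈ some '' S := fun y hy =>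
    ⟨_, hy, (eq_some_of_unsplit_mem hs hy).symm⟩
  refine ⟨?_, ?_, ?_⟩
  · rintro ⟨⟨g, y⟩, hy : unsplit (E.s e) y = E.r g⟩ ⟨x, hx, hxg : some x = peel e g⟩
    have hgs : E.s g ∈ S := by
      rw [← unsplit_peel e g, ← hxg]
      exact hx
    exact hmem y (hy ▸ h.hereditary g hgs)
  · rintro _ ⟨x, hx, rfl⟩
    obtain ⟨f, hf, rfl⟩ := h.exists_edge x hx
    exact ⟨⟨(f, some (E.r f)), rfl⟩, ⟨E.s f, hf, (hpeel f hf).symm⟩, rfl⟩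
  · rintro ⟨⟨g, y⟩, hy : unsplit (E.s e) y = E.r g⟩ (hg : peel e g ∉ some '' S)
      (hgy : y ∉ some '' S)
    change ρ (unsplit (E.s e) y) < ρ (unsplit (E.s e) (peel e g))
    rw [unsplit_peel, hy]
    refine h.rank_lt g (fun h' => hg ⟨_, h', (hpeel g h').symm⟩) fun h' => hgy (hmem y ?_)
    rwa [hy]

end IsCore

open IsCore

theorem isoToAlgebraicCuntzKrieger_of_algIso {R : Type w} [CommRing R] {A B : Type*}
    [NonUnitalRing A] [Module R A] [NonUnitalRing B] [Module R B] (h : AlgIso R A B)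
    (hB : IsoToAlgebraicCuntzKrieger R B) : IsoToAlgebraicCuntzKrieger R A := by
  obtain ⟨F, hF, hBF⟩ := hB
  exact ⟨F, hF, h.trans hBF⟩

variable (R : Type w) [CommRing R]

/-- The induction step: a vertex outside the core that only emits edges into the core can be
absorbed into the core. -/
theorem isoToAlgebraicCuntzKrieger_step (k : ℕ)
    (IH : ∀ (E : DiGraph.{0, 0}) (S : Set E.V) (ρ : E.V → ℕ), Finite E.V → Finite E.Edge →
      (∀ x, ∃ e, E.s e = x) → E.IsCore S ρ → Sᶜ.ncard < k →
      IsoToAlgebraicCuntzKrieger R (LeavittPathAlgebra R E)) (m : ℕ) :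
    ∀ (E : DiGraph.{0, 0}) (S : Set E.V) (ρ : E.V → ℕ) (x : E.V), Finite E.V → Finite E.Edge →
      (∀ x, ∃ e, E.s e = x) → E.IsCore S ρ → Sᶜ.ncard = k → x ∉ S →
      (∀ e, E.s e = x → E.r e ∈ S) → (E.outEdges x).ncard ≤ m →
      IsoToAlgebraicCuntzKrieger R (LeavittPathAlgebra R E) := by
  induction m with
  | zero =>
    intro E S ρ x _ _ hE _ _ _ _ hm
    obtain ⟨e, he⟩ := hE x
    have : E.outEdges x = ∅ := (Set.ncard_eq_zero (Set.toFinite _)).1 (by omega)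
    exact absurd (show e ∈ E.outEdges x from he) (by rw [this]; exact Set.notMem_empty e)
  | succ m ihm =>
    intro E S ρ x hV hEdge hE hS hk hx hxS hm
    obtain ⟨e, rfl⟩ := hE x
    obtain ⟨f, hf, hfe⟩ := hS.exists_edge (E.r e) (hxS e rfl)
    have hne : f ≠ e := fun h' => hx (h' ▸ hf)
    by_cases huniq : ∀ g, E.s g = E.s e → g = e
    -- With a single emitted edge, one redirection absorbs the vertex, and the complement of the
    -- core shrinks.
    · refine isoToAlgebraicCuntzKrieger_of_algIso (algIso_redirect R huniq hne hfe) ?_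
      refine IH (E.redirect f (E.s e)) (insert (E.s e) S) ρ hV hEdge hE
        (hS.redirect huniq hx (hxS e rfl) hf hfe) ?_
      have hfin : (Sᶜ : Set E.V).Finite := Set.toFinite _
      rw [← hk]
      refine Set.ncard_lt_ncard ⟨fun y hy hyS => hy (.inr hyS), fun hsub => ?_⟩ hfin
      exact hsub (show E.s e ∈ Sᶜ from hx) (.inl rfl)
    · push Not at huniq
      obtain ⟨e', hs', hne'⟩ := huniq
      let _ := Fintype.ofFinite E.V
      let _ := Fintype.ofFinite E.Edge
      have hpeel : ∀ g, g ≠ e → peel e g = some (E.s g) := fun g hg => if_neg hg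
      have hW : ∀ y : Option E.V, ∃ g, peel e g = y := by
        intro y
        cases y with
        | none => exact ⟨e, if_pos rfl⟩
        | some y =>
          by_cases hy : y = E.s e
          · exact ⟨e', by rw [hpeel e' hne', hs', hy]⟩
          · obtain ⟨g, rfl⟩ := hE y
            exact ⟨g, hpeel g fun h' => hy (h' ▸ rfl)⟩
      -- Otherwise e moves to the new vertex `none`, which is absorbed at once. The old vertex, now
      -- `some (E.s e)`, emits fewer edges, and the induction on m continues.
      set E₁ := E.outSplit (unsplit (E.s e)) (peel e) with hE₁
      have hiso₁ : AlgIso R (LeavittPathAlgebra R E) (LeavittPathAlgebra R E₁) :=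
        outSplit.algIso R (unsplit_peel e) hW hE
      have hS₁ : E₁.IsCore (some '' S) (ρ ∘ unsplit (E.s e)) := hS.outSplit hx
      have hV₁ : Finite E₁.V := inferInstanceAs (Finite (Option E.V))
      have hEdge₁ : Finite E₁.Edge := inferInstanceAs
        (Finite {k : E.Edge × Option E.V // unsplit (E.s e) k.2 = E.r k.1})
      have hmem : ∀ y, unsplit (E.s e) y ∈ S → y ∈ some '' S := fun y hy =>
        ⟨_, hy, (eq_some_of_unsplit_mem hx hy).symm⟩
      have hE₁s : ∀ y, ∃ k, E₁.s k = y := by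
        intro y
        obtain ⟨g, hg⟩ := hW y
        exact ⟨⟨(g, some (E.r g)), rfl⟩, hg⟩
      let e₁ : E₁.Edge := ⟨(e, some (E.r e)), rfl⟩
      let f₁ : E₁.Edge := ⟨(f, some (E.r f)), rfl⟩
      have hse₁ : E₁.s e₁ = none := if_pos rfl
      have hne₁ : f₁ ≠ e₁ := fun h' => hne (congrArg (fun k : E₁.Edge => k.1.1) h')
      have hfe₁ : E₁.r f₁ = E₁.r e₁ := congrArg some hfe
      -- Copies of e correspond to vertices over r(e), and r(e), being in the core, has only one.
      have huniq₁ : ∀ g, E₁.s g = E₁.s e₁ → g = e₁ := by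
        rintro ⟨⟨g, y⟩, hy : unsplit (E.s e) y = E.r g⟩ hg
        rw [hse₁] at hg
        have hge : g = e := by
          by_contra hge
          exact absurd ((hpeel g hge).symm.trans hg) (Option.some_ne_none _)
        subst hge
        refine Subtype.ext (Prod.ext rfl ?_)
        have := eq_some_of_unsplit_mem (S := S) hx (y := y) (by rw [hy]; exact hxS g rfl)
        rw [hy] at this
        exact this
      have hnone : E₁.s e₁ ∉ some '' S := by
        rw [hse₁]
        rintro ⟨z, -, hz⟩
        exact Option.some_ne_none z hz
      have hiso₂ := algIso_redirect R huniq₁ hne₁ hfe₁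
      have hS₂ := hS₁.redirect huniq₁ hnone ⟨E.r e, hxS e rfl, rfl⟩
        (f := f₁) ⟨E.s f, hf, (hpeel f hne).symm⟩ hfe₁
      refine isoToAlgebraicCuntzKrieger_of_algIso (hiso₁.trans hiso₂) ?_
      have hsome : ∀ k : E₁.Edge, E₁.s k = some (E.s e) → k.1.1 ≠ e ∧ E.s k.1.1 = E.s e := by
        rintro ⟨⟨g, y⟩, hy : unsplit (E.s e) y = E.r g⟩ (hg : peel e g = some (E.s e))
        have hge : g ≠ e := fun h' => by
          rw [h', peel, if_pos rfl] at hg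
          exact Option.some_ne_none _ hg.symm
        refine ⟨hge, Option.some_injective _ ?_⟩
        rw [← hg, hpeel g hge]
      refine ihm (E₁.redirect f₁ (E₁.s e₁)) _ _ (some (E.s e)) hV₁ hEdge₁ hE₁s hS₂ ?_ ?_ ?_ ?_
      -- The only additional vertex, `none`, has joined the core, so the complement is a copy of the
      -- old one and still has k elements.
      · rw [← hk, ← Set.ncard_image_of_injective Sᶜ (Option.some_injective _), hse₁]
        congr 1
        ext y
        cases y with
        | none =>
          refine ⟨fun h' => absurd (.inl rfl) h', ?_⟩
          rintro ⟨z, -, hz⟩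
          exact absurd hz (Option.some_ne_none z)
        | some y =>
          constructor
          · intro h'
            exact ⟨y, fun hy => h' (.inr ⟨y, hy, rfl⟩), rfl⟩
          · rintro ⟨z, hz, hzy⟩ h'
            rcases h' with h' | ⟨z', hz', hzy'⟩
            · exact Option.some_ne_none y h'
            · exact hz (Option.some_injective _ (hzy'.trans hzy.symm) ▸ hz')
      · rintro (h' | ⟨z, hz, hzx⟩)
        · rw [hse₁] at h'
          exact Option.some_ne_none _ h'
        · exact hx (Option.some_injective _ hzx ▸ hz)
      · intro k hks
        by_cases hkf : k = f₁
        · rw [hkf, redirect_r_self]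
          exact .inl rfl
        · have hr : (E₁.redirect f₁ (E₁.s e₁)).r k = k.1.2 := E₁.redirect_r_of_ne hkf _
          rw [hr]
          refine .inr (hmem k.1.2 ?_)
          rw [k.2]
          exact hxS _ (hsome k hks).2
      -- The remaining edges have ranges in the core before the redirection, hence one copy each, so
      -- they inject into the old edges other than e.
      · have hlt : (E.outEdges (E.s e) \ {e}).ncard < (E.outEdges (E.s e)).ncard :=
          Set.ncard_sdiff_singleton_lt_of_mem rfl (Set.toFinite _)
        refine le_trans (Set.ncard_le_ncard_of_injOn (fun k : E₁.Edge => k.1.1)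
          (t := E.outEdges (E.s e) \ {e}) ?_ ?_ (Set.toFinite _)) (by omega)
        · intro k hk
          exact ⟨(hsome k hk).2, (hsome k hk).1⟩
        · intro k hk k' hk' hkk
          have key : ∀ k : E₁.Edge, E₁.s k = some (E.s e) → k.1.2 = some (E.r k.1.1) := by
            intro k hk
            have := eq_some_of_unsplit_mem (S := S) hx (y := k.1.2)
              (by rw [k.2]; exact hxS _ (hsome k hk).2)
            rwa [k.2] at this
          refine Subtype.ext (Prod.ext hkk ?_)
          rw [key k hk, key k' hk']
          exact congrArg (fun g => some (E.r g)) hkk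

/-- Induction on the number of vertices outside the core. One of minimal rank emits only into the
core and is absorbed; when none is left, the core provides every vertex with an incoming edge. -/
theorem isoToAlgebraicCuntzKrieger_of_isCore (k : ℕ) :
    ∀ (E : DiGraph.{0, 0}) (S : Set E.V) (ρ : E.V → ℕ), Finite E.V → Finite E.Edge →
      (∀ x, ∃ e, E.s e = x) → E.IsCore S ρ → Sᶜ.ncard = k →
      IsoToAlgebraicCuntzKrieger R (LeavittPathAlgebra R E) := by
  induction k using Nat.strong_induction_on with
  | _ k ih =>
    intro E S ρ hV hEdge hE hS hk
    by_cases hne : (Sᶜ).Nonempty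
    · obtain ⟨x, hx, hmin⟩ := Set.exists_min_image Sᶜ ρ (Set.toFinite _) hne
      refine isoToAlgebraicCuntzKrieger_step R k
        (fun E S ρ h1 h2 h3 h4 h5 => ih _ h5 E S ρ h1 h2 h3 h4 rfl) _ E S ρ x hV hEdge hE hS hk hx
        (fun e he => ?_) le_rfl
      by_contra hr
      have := hS.rank_lt e (by rw [he]; exact hx) hr
      rw [he] at this
      exact absurd (hmin _ hr) (by omega)
    · rw [Set.not_nonempty_iff_eq_empty, Set.compl_empty_iff] at hne
      refine IsCuntzKrieger.isoToAlgebraicCuntzKrieger R ⟨⟨hV, hEdge⟩, fun x hx => ?_, fun x hx => ?_⟩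
      · obtain ⟨e, he⟩ := hE x
        have : e ∈ E.outEdges x := he
        rw [hx] at this
        exact this
      · obtain ⟨e, -, he⟩ := hS.exists_edge x (hne ▸ trivial)
        have : e ∈ E.inEdges x := he
        rw [hx] at this
        exact this

/-- The Leavitt path algebra of a finite graph without sinks is isomorphic to an algebraic
Cuntz-Krieger algebra. -/
theorem isoToAlgebraicCuntzKrieger_of_noSink (E : DiGraph.{u, v}) (hfin : E.IsFinite)
    (hE : ∀ x, ∃ e, E.s e = x) : IsoToAlgebraicCuntzKrieger R (LeavittPathAlgebra R E) := by
  obtain ⟨_, _⟩ := hfin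
  let φ := Finite.equivFin E.V
  let ψ := Finite.equivFin E.Edge
  -- The induction ranges over graphs in universe 0, so vertices and edges are first renumbered.
  let F : DiGraph.{0, 0} := ⟨Fin (Nat.card E.V), Fin (Nat.card E.Edge),
    fun e => φ (E.s (ψ.symm e)), fun e => φ (E.r (ψ.symm e))⟩
  have hiso : AlgIso R (LeavittPathAlgebra R E) (LeavittPathAlgebra R F) :=
    algIso_of_equiv R (E' := F) φ ψ (fun e => congrArg φ (congrArg E.s (ψ.symm_apply_apply e)))
      (fun e => congrArg φ (congrArg E.r (ψ.symm_apply_apply e)))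
  have hV : Finite F.V := inferInstanceAs (Finite (Fin _))
  obtain ⟨S, ρ, hS⟩ := exists_isCore F
  refine isoToAlgebraicCuntzKrieger_of_algIso hiso (isoToAlgebraicCuntzKrieger_of_isCore R _ F S ρ
    hV (inferInstanceAs (Finite (Fin _))) (fun x => ?_) hS rfl)
  obtain ⟨e, he⟩ := hE (φ.symm x)
  refine ⟨ψ e, ?_⟩
  change φ (E.s (ψ.symm (ψ e))) = x
  rw [ψ.symm_apply_apply, he, φ.apply_symm_apply]

/-- Every vertex of E is regular, and regularity passes to E(T); so E(T) has no sinks, and it is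
finite. -/
theorem Subgraph.IsFiniteForest.isoToAlgebraicCuntzKrieger {E : DiGraph.{u, v}} {T : E.Subgraph}
    {X : Finset E.V} (h : T.IsFiniteForest X) (hE : E.IsCuntzKrieger) :
    IsoToAlgebraicCuntzKrieger R (LeavittPathAlgebra R T.cornerGraph) := by
  obtain ⟨⟨_, _⟩, hsink, -⟩ := hE
  refine isoToAlgebraicCuntzKrieger_of_noSink R _ ⟨h.finite_cornerGraph_verts,
    inferInstanceAs (Finite T.cornerEdges)⟩ fun x => ?_
  exact (h.isRegular_corner x ⟨Set.toFinite _, Set.nonempty_iff_ne_empty.2 (hsink x.1)⟩).2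

end DiGraph

end

theorem mainTheorem7 {R : Type*} [CommRing R] (E : DiGraph) (X : Finset E.V)
    (hX : (X : Set E.V) ⊂ Set.univ) (T : E.Subgraph) (hforest : T.IsDirectedForest)
    (hrow : T.toDiGraph.IsRowFinite) (hpath : T.toDiGraph.IsPathFinite)
    (hroots : T.roots = X) (hverts : T.verts = E.hereditaryClosure X) :
    DiGraph.AlgIso R (DiGraph.LeavittPathAlgebra R T.cornerGraph)
        (DiGraph.cornerSubalgebra R (DiGraph.LeavittPathAlgebra.vertSum R X)) ∧
      (E.IsCuntzKrieger →
        DiGraph.IsoToAlgebraicCuntzKrieger R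
          (DiGraph.LeavittPathAlgebra R T.cornerGraph)) := by
  have h := DiGraph.Subgraph.isFiniteForest hforest hrow hpath hroots hverts
  refine ⟨h.algIso_corner R, fun hE => ?_⟩
  exact h.isoToAlgebraicCuntzKrieger R hE
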